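/- Let $n \ge 3$ and $p > 1$. Let $\mathcal K^n$ be the set of convex bodies (nonempty compact convex subsets) of $\mathbb R^n$ with the Hausdorff metric, and let $\mathcal K^n_o \subseteq \mathcal K^n$ be the set of convex bodies containing the origin $o$. Write $h(K,u) = \max_{x \in K} \langle x, u\rangle$ for the support function of $K$, and for $K, L \in \mathcal K^n_o$ let $K +_p L \in \mathcal K^n_o$ be the convex body with $h(K +_p L, \cdot)^p = h(K,\cdot)^p + h(L,\cdot)^p$. For $K \in \mathcal K^n$ let $K_o$ be the convex hull of $K$ and the origin, and let $M_p^{\pm} K,\ M_p^{\pm *} K \in \mathcal K^n_o$ be the convex bodies with $$h(M_p^{\pm} K, u)^p = \int_K \langle x, u\rangle_{\pm}^p \, dx, \qquad h(M_p^{\pm *} K, u)^p = \int_{K_o \setminus K} \langle x, u\rangle_{\pm}^p \, dx \qquad (u \in \mathbb R^n),$$ where $t_+ = \max(0,t)$ and $t_- = \max(0,-t)$. A map $\Phi \colon \mathcal K^n \to \mathcal K^n_o$ is called an $L_p$-Minkowski valuation if $\Phi(K \cup L) +_p \Phi(K \cap L) = \Phi K +_p \Phi L$ for all $K, L \in \mathcal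 K^n$ with $K \cup L, K \cap L \in \mathcal K^n$, and it is called $\mathrm{SL}(n)$-covariant if $\Phi(\phi K) = \phi\, \Phi K$ for all $K \in \mathcal K^n$ and $\phi \in \mathrm{SL}(n)$. Then a map $\Phi \colon \mathcal K^n \to \mathcal K^n_o$ is a continuous $\mathrm{SL}(n)$-covariant $L_p$-Minkowski valuation if and only if there exist constants $c_1, \dots, c_6 \ge 0$ such that $$\Phi K = c_1 M_p^+ K +_p c_2 M_p^- K +_p c_3 M_p^{+*} K +_p c_4 M_p^{-*} K +_p c_5 K_o +_p c_6 (-K_o)$$ for all $K \in \mathcal K^n$. -/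

import Mathlib

open Set MeasureTheory
open scoped Pointwise

noncomputable section

/-- Euclidean space `ℝⁿ`. -/
abbrev Eucl (n : ℕ) : Type := EuclideanSpace ℝ (Fin n)

/-- The convex bodies in `ℝⁿ` that contain the origin, with the Hausdorff metric. -/
abbrev BodyO (n : ℕ) : Type := {K : ConvexBody (Eucl n) // (0 : Eucl n) ∈ K}

/-- The support function `h(K, u) = max_{x ∈ K} ⟨x, u⟩`. -/
def suppFun {n : ℕ} (K : ConvexBody (Eucl n)) (u : Eucl n) : ℝ :=
  sSup ((fun x : Eucl n => inner ℝ x u) '' (K : Set (Eucl n)))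

lemma suppFun_nonneg {n : ℕ} (K : BodyO n) (u : Eucl n) : 0 ≤ suppFun K.1 u :=
  Real.sSup_nonneg' ⟨0, ⟨0, K.2, by simp⟩, le_rfl⟩

lemma isBounded_halfspaces {n : ℕ} (f : Eucl n → ℝ) :
    Bornology.IsBounded {x : Eucl n | ∀ u, inner ℝ x u ≤ f u} := by
  have hb : Bornology.IsBounded (EuclideanSpace.equiv (Fin n) ℝ ''
      {x : Eucl n | ∀ u, inner ℝ x u ≤ f u}) := by
    refine (Metric.isBounded_Icc
      (fun i => - f (- EuclideanSpace.single i (1 : ℝ)))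
      (fun i => f (EuclideanSpace.single i (1 : ℝ)))).subset ?_
    rintro _ ⟨x, hx, rfl⟩
    refine ⟨fun i => ?_, fun i => ?_⟩
    · have h := hx (- EuclideanSpace.single i (1 : ℝ))
      simp [EuclideanSpace.inner_single_right] at h
      simp; linarith
    · have h := hx (EuclideanSpace.single i (1 : ℝ))
      simp [EuclideanSpace.inner_single_right] at h
      simpa using h
  have h2 := (EuclideanSpace.equiv (Fin n) ℝ).symm.lipschitz.isBounded_image hb
  rwa [← Set.image_comp, show ((EuclideanSpace.equiv (Fin n) ℝ).symm ∘
    (EuclideanSpace.equiv (Fin n) ℝ)) = id by ext; simp, Set.image_id] at h2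

/-- The convex body `{x | ⟨x, u⟩ ≤ f(u) for all u}` of a nonnegative function `f`. If `f` is
sublinear, this is the unique convex body with support function `f`; see `suppFun_ofSupp`. -/
def ofSupp {n : ℕ} (f : Eucl n → ℝ) (hf : ∀ u, 0 ≤ f u) : BodyO n :=
  ⟨{ carrier := {x | ∀ u, inner ℝ x u ≤ f u}
     convex' := by
       intro x hx y hy a b ha hb hab u
       have h1 := mul_le_mul_of_nonneg_left (hx u) ha
       have h2 := mul_le_mul_of_nonneg_left (hy u) hb
       have h3 : a * f u + b * f u = f u := by rw [← add_mul, hab, one_mul]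
       rw [inner_add_left, real_inner_smul_left, real_inner_smul_left]
       linarith
     isCompact' := by
       refine Metric.isCompact_of_isClosed_isBounded ?_ (isBounded_halfspaces f)
       rw [Set.ofPred_forall]
       exact isClosed_iInter fun u => isClosed_le (by fun_prop) continuous_const
     nonempty' := ⟨0, fun u => by simpa using hf u⟩ },
   fun u => by simpa using hf u⟩

/-- The `L_p`-Minkowski sum `K +_p L`, given by `h(K +_p L, ·)^p = h(K, ·)^p + h(L, ·)^p`; see
`suppFun_lpAdd`. -/
def lpAdd {n : ℕ} (p : ℝ) (K L : BodyO n) : BodyO n :=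
  ofSupp (fun u => (suppFun K.1 u ^ p + suppFun L.1 u ^ p) ^ (1 / p)) fun u =>
    Real.rpow_nonneg (add_nonneg (Real.rpow_nonneg (suppFun_nonneg K u) p)
      (Real.rpow_nonneg (suppFun_nonneg L u) p)) _

/-- The body `M` with `h(M, u)^p = ∫_A ⟨x, u⟩₊^p dx`; see `suppFun_momentPos`. -/
def momentPos {n : ℕ} (p : ℝ) (A : Set (Eucl n)) : BodyO n :=
  ofSupp (fun u => (∫ x in A, (max 0 (inner ℝ x u : ℝ)) ^ p) ^ (1 / p)) fun _ =>
    Real.rpow_nonneg (integral_nonneg fun _ => Real.rpow_nonneg (le_max_left _ _) _) _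

/-- The body `M` with `h(M, u)^p = ∫_A ⟨x, u⟩₋^p dx`; see `suppFun_momentNeg`. -/
def momentNeg {n : ℕ} (p : ℝ) (A : Set (Eucl n)) : BodyO n :=
  ofSupp (fun u => (∫ x in A, (max 0 (-(inner ℝ x u : ℝ))) ^ p) ^ (1 / p)) fun _ =>
    Real.rpow_nonneg (integral_nonneg fun _ => Real.rpow_nonneg (le_max_left _ _) _) _

lemma isCompact_convexHull_insert_zero {n : ℕ} (K : ConvexBody (Eucl n)) :
    IsCompact (convexHull ℝ (insert 0 (K : Set (Eucl n)))) := by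
  have h : convexHull ℝ (insert 0 (K : Set (Eucl n))) =
      (fun q : ℝ × Eucl n => q.1 • q.2) '' (Icc (0 : ℝ) 1 ×ˢ (K : Set (Eucl n))) := by
    rw [convexHull_insert K.nonempty, K.convex.convexHull_eq]
    ext x
    simp only [convexJoin_singleton_left, mem_iUnion, segment_eq_image, mem_image, mem_prod,
      Prod.exists, smul_zero, zero_add]
    constructor
    · rintro ⟨y, hy, t, ht, rfl⟩
      exact ⟨t, y, ⟨ht, hy⟩, rfl⟩
    · rintro ⟨t, y, ⟨ht, hy⟩, rfl⟩
      exact ⟨y, hy, t, ht, rfl⟩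
  rw [h]
  exact (isCompact_Icc.prod K.isCompact).image (by fun_prop)

/-- `K_o`, the convex hull of `K` and the origin. -/
def hullO {n : ℕ} (K : ConvexBody (Eucl n)) : BodyO n :=
  ⟨{ carrier := convexHull ℝ (insert 0 (K : Set (Eucl n)))
     convex' := convex_convexHull ℝ _
     isCompact' := isCompact_convexHull_insert_zero K
     nonempty' := ⟨0, subset_convexHull ℝ _ (mem_insert _ _)⟩ },
   subset_convexHull ℝ _ (mem_insert _ _)⟩

/-- `M_p⁺ K`, where `h(M_p⁺ K, u)^p = ∫_K ⟨x, u⟩₊^p dx`. -/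
def MPos {n : ℕ} (p : ℝ) (K : ConvexBody (Eucl n)) : BodyO n :=
  momentPos p (K : Set (Eucl n))

/-- `M_p⁻ K`, where `h(M_p⁻ K, u)^p = ∫_K ⟨x, u⟩₋^p dx`. -/
def MNeg {n : ℕ} (p : ℝ) (K : ConvexBody (Eucl n)) : BodyO n :=
  momentNeg p (K : Set (Eucl n))

/-- `M_p^{+*} K`, where the integral of `⟨x, u⟩₊^p` is over `K_o \ K`. -/
def MPosStar {n : ℕ} (p : ℝ) (K : ConvexBody (Eucl n)) : BodyO n :=
  momentPos p (((hullO K).1 : Set (Eucl n)) \ (K : Set (Eucl n)))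

/-- `M_p^{-*} K`, where the integral of `⟨x, u⟩₋^p` is over `K_o \ K`. -/
def MNegStar {n : ℕ} (p : ℝ) (K : ConvexBody (Eucl n)) : BodyO n :=
  momentNeg p (((hullO K).1 : Set (Eucl n)) \ (K : Set (Eucl n)))

/-- The dilate `c K = {c x | x ∈ K}`. -/
instance {n : ℕ} : SMul ℝ (BodyO n) where
  smul c K := ⟨c • K.1, ⟨0, K.2, by simp⟩⟩

/-- The reflection `-K = {-x | x ∈ K}`. -/
instance {n : ℕ} : Neg (BodyO n) where
  neg K :=
    ⟨{ carrier := -(K.1 : Set (Eucl n))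
       convex' := K.1.convex.neg
       isCompact' := K.1.isCompact.neg
       nonempty' := K.1.nonempty.neg }, by
      change (0 : Eucl n) ∈ -(K.1 : Set (Eucl n))
      rw [Set.mem_neg, neg_zero]; exact K.2⟩

/-- The image `φ K` of a convex body under the linear map with matrix `φ ∈ SL(n)`. -/
def slImage {n : ℕ} (φ : Matrix.SpecialLinearGroup (Fin n) ℝ) (K : ConvexBody (Eucl n)) :
    ConvexBody (Eucl n) where
  carrier := Matrix.toEuclideanCLM (𝕜 := ℝ) φ.1 '' (K : Set (Eucl n))
  convex' := K.convex.linear_image (Matrix.toEuclideanCLM (𝕜 := ℝ) φ.1).toLinearMap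
  isCompact' := K.isCompact.image (Matrix.toEuclideanCLM (𝕜 := ℝ) φ.1).continuous
  nonempty' := K.nonempty.image _

/-- `Φ (φ K) = φ (Φ K)` for all convex bodies `K` and all `φ ∈ SL(n)`. -/
def IsSLCovariant {n : ℕ} (Φ : ConvexBody (Eucl n) → BodyO n) : Prop :=
  ∀ (φ : Matrix.SpecialLinearGroup (Fin n) ℝ) (K : ConvexBody (Eucl n)),
    (Φ (slImage φ K)).1 = slImage φ (Φ K).1

/-- `Φ (K ∪ L) +_p Φ (K ∩ L) = Φ K +_p Φ L` whenever `K`, `L`, `K ∪ L` and `K ∩ L` are convex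
bodies; here `U` and `I` stand for `K ∪ L` and `K ∩ L`. -/
def IsLpMinkowskiValuation {n : ℕ} (p : ℝ) (Φ : ConvexBody (Eucl n) → BodyO n) : Prop :=
  ∀ K L U I : ConvexBody (Eucl n),
    (U : Set (Eucl n)) = (K : Set (Eucl n)) ∪ (L : Set (Eucl n)) →
    (I : Set (Eucl n)) = (K : Set (Eucl n)) ∩ (L : Set (Eucl n)) →
    lpAdd p (Φ U) (Φ I) = lpAdd p (Φ K) (Φ L)


lemma suppFun_add_le {n : ℕ} (K : ConvexBody (Eucl n)) (u v : Eucl n) :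
    suppFun K (u + v) ≤ suppFun K u + suppFun K v := by
  have hbdd : ∀ w : Eucl n, BddAbove ((fun x : Eucl n => inner ℝ x w) '' (K : Set (Eucl n))) :=
    fun w => K.isCompact.bddAbove_image (by fun_prop)
  refine csSup_le (K.nonempty.image _) ?_
  rintro _ ⟨x, hx, rfl⟩
  have h1 := le_csSup (hbdd u) (mem_image_of_mem _ hx)
  have h2 := le_csSup (hbdd v) (mem_image_of_mem _ hx)
  simp only [inner_add_right, suppFun]
  linarith

lemma suppFun_smul {n : ℕ} (K : ConvexBody (Eucl n)) {c : ℝ} (hc : 0 < c) (u : Eucl n) :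
    suppFun K (c • u) = c * suppFun K u := by
  have h : (fun x : Eucl n => (inner ℝ x (c • u) : ℝ)) '' (K : Set (Eucl n)) =
      c • ((fun x : Eucl n => (inner ℝ x u : ℝ)) '' (K : Set (Eucl n))) := by
    ext y
    simp [Set.mem_smul_set, inner_smul_right]
  rw [suppFun, h, Real.sSup_smul_of_nonneg hc.le, smul_eq_mul, suppFun]

/-- A nonnegative sublinear function is the support function of `ofSupp f`. -/
lemma suppFun_ofSupp {n : ℕ} (f : Eucl n → ℝ) (hf : ∀ u, 0 ≤ f u)
    (hadd : ∀ u v, f (u + v) ≤ f u + f v) (hsmul : ∀ c : ℝ, 0 < c → ∀ u, f (c • u) = c * f u)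
    (u : Eucl n) : suppFun (ofSupp f hf).1 u = f u := by
  have h0 : f 0 = 0 := by
    have := hsmul 2 two_pos 0
    rw [smul_zero] at this
    linarith
  refine IsGreatest.csSup_eq ⟨?_, ?_⟩
  · obtain ⟨g, hg1, hg2⟩ : ∃ g : Eucl n →ₗ[ℝ] ℝ, g u = f u ∧ ∀ v, g v ≤ f v := by
      by_cases hu : u = 0
      · exact ⟨0, by simp [hu, h0], fun v => by simpa using hf v⟩
      · obtain ⟨g, hg1, hg2⟩ := exists_extension_of_le_sublinear
          (LinearPMap.mkSpanSingleton u (f u) hu) f hsmul hadd (by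
            rintro ⟨x, hx⟩
            obtain ⟨t, rfl⟩ := Submodule.mem_span_singleton.1 hx
            rw [LinearPMap.mkSpanSingleton'_apply, RingHom.id_apply, smul_eq_mul]
            rcases lt_trichotomy t 0 with ht | rfl | ht
            · exact (mul_nonpos_of_nonpos_of_nonneg ht.le (hf u)).trans (hf _)
            · simp [h0]
            · exact (hsmul t ht u).ge)
        refine ⟨g, ?_, hg2⟩
        have := hg1 ⟨u, Submodule.mem_span_singleton_self u⟩
        rw [this]
        exact LinearPMap.mkSpanSingleton_apply ℝ ℝ hu (f u)
    refine ⟨(InnerProductSpace.toDual ℝ (Eucl n)).symm (LinearMap.toContinuousLinearMap g),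
      fun v => ?_, ?_⟩
    · simpa using hg2 v
    · simpa using hg1
  · rintro _ ⟨x, hx, rfl⟩
    exact hx u

/-- `h(K +_p L, u)^p = h(K, u)^p + h(L, u)^p`. -/
lemma suppFun_lpAdd {n : ℕ} {p : ℝ} (hp : 1 ≤ p) (K L : BodyO n) (u : Eucl n) :
    suppFun (lpAdd p K L).1 u ^ p = suppFun K.1 u ^ p + suppFun L.1 u ^ p := by
  have hp0 : 0 < p := by linarith
  rw [lpAdd, suppFun_ofSupp]
  · rw [← Real.rpow_mul (add_nonneg (Real.rpow_nonneg (suppFun_nonneg K u) p)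
      (Real.rpow_nonneg (suppFun_nonneg L u) p)), one_div_mul_cancel hp0.ne', Real.rpow_one]
  · intro v w
    have h := Real.Lp_add_le_of_nonneg (Finset.univ : Finset (Fin 2))
      (f := ![suppFun K.1 v, suppFun L.1 v]) (g := ![suppFun K.1 w, suppFun L.1 w]) hp
      (by intro i _; fin_cases i <;> simp [suppFun_nonneg])
      (by intro i _; fin_cases i <;> simp [suppFun_nonneg])
    simp only [Fin.sum_univ_two, Matrix.cons_val_zero, Matrix.cons_val_one] at h
    refine le_trans ?_ h
    have hK := suppFun_nonneg K (v + w)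
    have hL := suppFun_nonneg L (v + w)
    gcongr
    · exact suppFun_add_le _ _ _
    · exact suppFun_add_le _ _ _
  · intro c hc v
    have hK := suppFun_nonneg K v
    have hL := suppFun_nonneg L v
    rw [suppFun_smul _ hc, suppFun_smul _ hc, Real.mul_rpow hc.le hK, Real.mul_rpow hc.le hL,
      ← mul_add, Real.mul_rpow (by positivity) (by positivity), ← Real.rpow_mul hc.le,
      mul_one_div_cancel hp0.ne', Real.rpow_one]

/-- `h(M, u)^p = ∫_A ⟨x, u⟩₊^p dx` for `M = momentPos p A`. -/
lemma suppFun_momentPos {n : ℕ} {p : ℝ} (hp : 1 ≤ p) {A : Set (Eucl n)}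
    (hA : Bornology.IsBounded A) (u : Eucl n) :
    suppFun (momentPos p A).1 u ^ p = ∫ x in A, (max 0 (inner ℝ x u : ℝ)) ^ p := by
  have hp0 : 0 < p := by linarith
  have hint : ∀ w : Eucl n, MemLp (fun x : Eucl n => max 0 (inner ℝ x w : ℝ)) (ENNReal.ofReal p)
      (volume.restrict A) := by
    intro w
    obtain ⟨R, hR⟩ := hA.subset_closedBall 0
    have hc : Continuous (fun x : Eucl n => max 0 (inner ℝ x w : ℝ)) := by fun_prop
    have h1 : MemLp (fun x : Eucl n => max 0 (inner ℝ x w : ℝ)) (ENNReal.ofReal p)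
        (volume.restrict (Metric.closedBall (0 : Eucl n) R)) := by
      obtain ⟨C, hC⟩ := (isCompact_closedBall (0 : Eucl n) R).exists_bound_of_continuousOn
        hc.continuousOn
      have : IsFiniteMeasure (volume.restrict (Metric.closedBall (0 : Eucl n) R)) :=
        ⟨by simpa using (isCompact_closedBall (0 : Eucl n) R).measure_lt_top⟩
      exact MemLp.of_bound hc.aestronglyMeasurable C
        ((ae_restrict_iff' measurableSet_closedBall).2 (Filter.Eventually.of_forall hC))
    exact h1.mono_measure (Measure.restrict_mono hR le_rfl)
  have hnn : ∀ w : Eucl n, 0 ≤ ∫ x in A, (max 0 (inner ℝ x w : ℝ)) ^ p := fun w =>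
    integral_nonneg fun _ => Real.rpow_nonneg (le_max_left _ _) _
  have hnorm : ∀ w : Eucl n, (∫ x in A, (max 0 (inner ℝ x w : ℝ)) ^ p) ^ (1 / p) =
      (eLpNorm (fun x : Eucl n => max 0 (inner ℝ x w : ℝ)) (ENNReal.ofReal p)
        (volume.restrict A)).toReal := by
    intro w
    rw [(hint w).eLpNorm_eq_integral_rpow_norm (by simpa using hp0) ENNReal.ofReal_ne_top,
      ENNReal.toReal_ofReal hp0.le, ENNReal.toReal_ofReal (by positivity), one_div]
    congr 2
    ext x
    rw [Real.norm_of_nonneg (le_max_left _ _)]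
  rw [momentPos, suppFun_ofSupp]
  · rw [← Real.rpow_mul (hnn u), one_div_mul_cancel hp0.ne', Real.rpow_one]
  · intro v w
    rw [hnorm, hnorm, hnorm, ← ENNReal.toReal_add (hint v).2.ne (hint w).2.ne]
    refine ENNReal.toReal_mono (ENNReal.add_ne_top.2 ⟨(hint v).2.ne, (hint w).2.ne⟩) ?_
    refine le_trans (eLpNorm_mono_real (g := (fun x : Eucl n => max 0 (inner ℝ x v : ℝ)) +
      fun x : Eucl n => max 0 (inner ℝ x w : ℝ)) fun x => ?_)
      (eLpNorm_add_le (hint v).1 (hint w).1 (by simpa using hp))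
    rw [Real.norm_of_nonneg (le_max_left _ _), inner_add_right]
    simp only [Pi.add_apply]
    refine max_le (add_nonneg (le_max_left _ _) (le_max_left _ _))
      (add_le_add (le_max_right _ _) (le_max_right _ _))
  · intro c hc v
    have h : ∀ x : Eucl n, (max 0 (inner ℝ x (c • v) : ℝ)) ^ p =
        c ^ p * (max 0 (inner ℝ x v : ℝ)) ^ p := fun x => by
      rw [← Real.mul_rpow hc.le (le_max_left _ _), mul_max_of_nonneg _ _ hc.le, mul_zero,
        real_inner_smul_right]
    simp only [h]
    rw [integral_const_mul, Real.mul_rpow (by positivity) (hnn v), ← Real.rpow_mul hc.le,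
      mul_one_div_cancel hp0.ne', Real.rpow_one]

/-- `h(M, u)^p = ∫_A ⟨x, u⟩₋^p dx` for `M = momentNeg p A`. -/
lemma suppFun_momentNeg {n : ℕ} {p : ℝ} (hp : 1 ≤ p) {A : Set (Eucl n)}
    (hA : Bornology.IsBounded A) (u : Eucl n) :
    suppFun (momentNeg p A).1 u ^ p = ∫ x in A, (max 0 (-(inner ℝ x u : ℝ))) ^ p := by
  have h : momentNeg p A = -(momentPos p A) := by
    refine Subtype.ext (ConvexBody.ext ?_)
    ext x
    change (∀ v, inner ℝ x v ≤ (∫ y in A, (max 0 (-(inner ℝ y v : ℝ))) ^ p) ^ (1 / p)) ↔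
      ∀ v, inner ℝ (-x) v ≤ (∫ y in A, (max 0 (inner ℝ y v : ℝ)) ^ p) ^ (1 / p)
    constructor
    · intro hx v
      simpa [inner_neg_left, inner_neg_right] using hx (-v)
    · intro hx v
      simpa [inner_neg_left, inner_neg_right] using hx (-v)
  have h2 : suppFun (-(momentPos p A)).1 u = suppFun (momentPos p A).1 (-u) := by
    unfold suppFun
    congr 1
    ext y
    change y ∈ _ '' (-((momentPos p A).1 : Set (Eucl n))) ↔ _
    constructor
    · rintro ⟨x, hx, rfl⟩
      exact ⟨-x, hx, by simp⟩
    · rintro ⟨x, hx, rfl⟩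
      exact ⟨-x, by simpa using hx, by simp⟩
  rw [h, h2, suppFun_momentPos hp hA]
  simp [inner_neg_right]

end

/-! Put F(K, u) = h(ΦK, u)^p. The L_p sum becomes ordinary addition, so the hypotheses on Φ say
exactly that F is jointly continuous, SL(n)-covariant, p-homogeneous in u and a real-valued
valuation in K (`isLpVal_suppFun_iff`). These conditions are linear in F. The proof shows that for n
≥ 3 their solutions are spanned by eight functions: the powers max(0, h(K, ±u))^p and max(0, min_{x
∈ K} ⟨x, ±u⟩)^p, and the moments of K and of K_o \ K in the directions ±u (`IsLpVal.eq_basicComb`).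
It then asks which combinations are p-th powers of support functions.

The upper bound on the dimension is `IsLpVal.eq_zero`: a solution G is zero once it vanishes at
eight test values, on a point e_i, a segment [0, e_i], the simplex with vertices 0, e_1, ..., e_n
and its facet opposite 0, each in the directions ±(1, ..., 1). On a simplex with fewer than n
nonzero vertices, covariance makes G depend only on the inner products of the vertices with u.
Cutting an edge gives a functional equation for G, and induction on the number of vertices yields
zero (`stdVal_eq_zero_of_lower`). With n nonzero vertices, G depends on the inner products and on
the determinant s of the vertices. Common faces of cuts now contribute nothing, so G is proportional
to |s| (`topVal_eq`). At s = 1 it is then the average of its values after a midpoint cut, so by a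
maximum principle it is determined by its values on the diagonal (`eq_zero_of_midpoint`). Finally,
vanishing on simplices passes to intersections of simplices with half-spaces
(`VanishesOn.inter_halfspace`), hence by continuity to bodies inside a simplex, and by cutting along
the coordinate hyperplanes to all bodies.

For F = h(ΦK, ·)^p, convexity in u forces the coefficients of the two minimum terms to be zero, by
comparing a segment with a triangle; this uses p > 1. Nonnegativity gives the signs of the other six
(`basicComb_coeff`), and their p-th roots are the constants c_1, ..., c_6. -/

open Filter Topology

/-! ### Support functions and the Hausdorff metric. -/

lemma bddAbove_inner_image {n : ℕ} (K : ConvexBody (Eucl n)) (u : Eucl n) :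
    BddAbove ((fun x : Eucl n => (inner ℝ x u : ℝ)) '' (K : Set (Eucl n))) :=
  K.isCompact.bddAbove_image (by fun_prop)

lemma inner_le_suppFun {n : ℕ} {K : ConvexBody (Eucl n)} {x : Eucl n} (hx : x ∈ K) (u : Eucl n) :
    inner ℝ x u ≤ suppFun K u :=
  le_csSup (bddAbove_inner_image K u) (mem_image_of_mem _ hx)

lemma suppFun_le {n : ℕ} {K : ConvexBody (Eucl n)} {u : Eucl n} {b : ℝ}
    (h : ∀ x ∈ K, inner ℝ x u ≤ b) : suppFun K u ≤ b := by
  refine csSup_le (K.nonempty.image _) ?_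
  rintro _ ⟨x, hx, rfl⟩
  exact h x hx

lemma exists_inner_eq_suppFun {n : ℕ} (K : ConvexBody (Eucl n)) (u : Eucl n) :
    ∃ x ∈ K, inner ℝ x u = suppFun K u := by
  obtain ⟨x, hx, h⟩ := K.isCompact.exists_isMaxOn K.nonempty
    (f := fun x : Eucl n => (inner ℝ x u : ℝ)) (by fun_prop)
  exact ⟨x, hx, le_antisymm (inner_le_suppFun hx u) (suppFun_le fun y hy => h hy)⟩

/-- Let y be the point of K nearest to x. The direction x - y is an outer normal of K at y, so the
hypothesis for u = x - y reads ‖x - y‖² ≤ ε ‖x - y‖. The case ε = 0 is the separation theorem, and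
the general case turns bounds on support functions into bounds on the Hausdorff distance. -/
lemma exists_dist_le_of_inner_le {n : ℕ} {K : ConvexBody (Eucl n)} {x : Eucl n} {ε : ℝ}
    (h : ∀ u, inner ℝ x u ≤ suppFun K u + ε * ‖u‖) (hε : 0 ≤ ε) : ∃ y ∈ K, dist x y ≤ ε := by
  obtain ⟨y, hy, hxy⟩ := exists_norm_eq_iInf_of_complete_convex K.nonempty
    K.isCompact.isComplete K.convex x
  refine ⟨y, hy, ?_⟩
  rw [norm_eq_iInf_iff_real_inner_le_zero K.convex hy] at hxy
  have h1 : suppFun K (x - y) ≤ inner ℝ y (x - y) := suppFun_le fun z hz => by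
    have := hxy z hz
    rw [real_inner_comm, inner_sub_left] at this
    linarith
  have h2 := h (x - y)
  have h3 : (inner ℝ (x - y) (x - y) : ℝ) = ‖x - y‖ * ‖x - y‖ := real_inner_self_eq_norm_mul_norm _
  rw [inner_sub_left] at h3
  rw [dist_eq_norm]
  by_contra hc
  have : 0 < ‖x - y‖ := by linarith [not_le.1 hc]
  nlinarith [not_le.1 hc]

lemma mem_of_inner_le {n : ℕ} {K : ConvexBody (Eucl n)} {x : Eucl n}
    (h : ∀ u, inner ℝ x u ≤ suppFun K u) : x ∈ K := by
  obtain ⟨y, hy, hxy⟩ := exists_dist_le_of_inner_le (K := K) (x := x) (ε := 0)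
    (fun u => by simpa using h u) le_rfl
  rwa [dist_le_zero.1 hxy]

lemma le_of_suppFun_le {n : ℕ} {K L : ConvexBody (Eucl n)}
    (h : ∀ u, suppFun K u ≤ suppFun L u) : K ≤ L :=
  fun _ hx => mem_of_inner_le fun u => (inner_le_suppFun hx u).trans (h u)

lemma suppFun_ext {n : ℕ} {K L : ConvexBody (Eucl n)} (h : ∀ u, suppFun K u = suppFun L u) :
    K = L :=
  le_antisymm (le_of_suppFun_le fun u => (h u).le) (le_of_suppFun_le fun u => (h u).ge)

lemma suppFun_le_add_dist {n : ℕ} (K L : ConvexBody (Eucl n)) (u : Eucl n) :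
    suppFun K u ≤ suppFun L u + dist K L * ‖u‖ := by
  refine suppFun_le fun x hx => ?_
  obtain ⟨y, hy, hxy⟩ := L.isCompact.exists_infDist_eq_dist L.nonempty x
  have h1 : Metric.infDist x L ≤ dist K L :=
    Metric.infDist_le_hausdorffDist_of_mem hx ConvexBody.hausdorffEDist_ne_top
  have h2 : (inner ℝ x u : ℝ) = inner ℝ y u + inner ℝ (x - y) u := by
    rw [inner_sub_left]; ring
  have h3 := real_inner_le_norm (x - y) u
  have h4 := inner_le_suppFun hy u
  rw [hxy, dist_eq_norm] at h1
  have := mul_le_mul_of_nonneg_right h1 (norm_nonneg u)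
  linarith

lemma dist_le_of_suppFun_le {n : ℕ} {K L : ConvexBody (Eucl n)} {ε : ℝ} (hε : 0 ≤ ε)
    (h1 : ∀ u, suppFun K u ≤ suppFun L u + ε * ‖u‖)
    (h2 : ∀ u, suppFun L u ≤ suppFun K u + ε * ‖u‖) : dist K L ≤ ε := by
  refine Metric.hausdorffDist_le_of_mem_dist hε (fun x hx => ?_) (fun x hx => ?_)
  · exact exists_dist_le_of_inner_le (fun u => (inner_le_suppFun hx u).trans (h1 u)) hε
  · exact exists_dist_le_of_inner_le (fun u => (inner_le_suppFun hx u).trans (h2 u)) hε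

lemma suppFun_zero {n : ℕ} (K : ConvexBody (Eucl n)) : suppFun K 0 = 0 := by
  obtain ⟨x, _, h⟩ := exists_inner_eq_suppFun K 0
  simpa using h.symm

lemma exists_suppFun_le_norm {n : ℕ} (K : ConvexBody (Eucl n)) :
    ∃ C, 0 ≤ C ∧ ∀ u, suppFun K u ≤ C * ‖u‖ := by
  obtain ⟨C, hC⟩ := K.isBounded.exists_norm_le
  refine ⟨max C 0, le_max_right _ _, fun u => suppFun_le fun x hx => ?_⟩
  refine (real_inner_le_norm x u).trans ?_
  gcongr
  exact (hC x hx).trans (le_max_left _ _)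

lemma continuous_suppFun {n : ℕ} :
    Continuous fun x : ConvexBody (Eucl n) × Eucl n => suppFun x.1 x.2 := by
  rw [continuous_iff_continuousAt]
  rintro ⟨L, v⟩
  obtain ⟨C, hC0, hC⟩ := exists_suppFun_le_norm L
  have hb : Tendsto (fun x : ConvexBody (Eucl n) × Eucl n =>
      dist x.1 L * ‖x.2‖ + C * ‖x.2 - v‖) (𝓝 (L, v)) (𝓝 0) := by
    have : Continuous (fun x : ConvexBody (Eucl n) × Eucl n =>
      dist x.1 L * ‖x.2‖ + C * ‖x.2 - v‖) := by fun_prop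
    have := this.tendsto (L, v)
    simpa using this
  rw [ContinuousAt, tendsto_iff_dist_tendsto_zero]
  refine squeeze_zero (fun _ => dist_nonneg) (fun x => ?_) hb
  rw [Real.dist_eq, abs_le]
  have h1 := suppFun_le_add_dist x.1 L x.2
  have h2 := suppFun_le_add_dist L x.1 x.2
  have h3 := suppFun_add_le L v (x.2 - v)
  have h4 := suppFun_add_le L x.2 (v - x.2)
  have h5 := hC (x.2 - v)
  have h6 := hC (v - x.2)
  rw [norm_sub_rev] at h6
  rw [dist_comm] at h2
  simp only [add_sub_cancel] at h3 h4
  constructor <;> linarith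

/-- A body operator is continuous as soon as its support functions are jointly continuous. -/
lemma continuous_of_suppFun {n : ℕ} {X : Type*} [TopologicalSpace X] {Ψ : X → ConvexBody (Eucl n)}
    (h : Continuous fun x : X × Eucl n => suppFun (Ψ x.1) x.2) : Continuous Ψ := by
  rw [continuous_iff_continuousAt]
  intro K
  rw [ContinuousAt, Metric.tendsto_nhds]
  intro ε hε
  have hU : ∀ u ∈ Metric.sphere (0 : Eucl n) 1, ∀ᶠ x : X × Eucl n in 𝓝 K ×ˢ 𝓝 u,
      |suppFun (Ψ x.1) x.2 - suppFun (Ψ K) x.2| < ε / 2 := by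
    intro u _
    have hc : Continuous fun x : X × Eucl n =>
        |suppFun (Ψ x.1) x.2 - suppFun (Ψ K) x.2| := by
      refine (h.sub ?_).abs
      exact h.comp (f := fun x : X × Eucl n => (K, x.2)) (by fun_prop)
    have := hc.tendsto (K, u)
    rw [← nhds_prod_eq]
    refine this.eventually_lt_const ?_
    simpa using hε
  -- Compactness of the unit sphere makes the convergence uniform in unit directions; homogeneity
  -- then gives the estimate for all u.
  have hev := (isCompact_sphere (0 : Eucl n) 1).eventually_forall_of_forall_eventually
    (P := fun (x : X) u => |suppFun (Ψ x) u - suppFun (Ψ K) u| < ε / 2) (x₀ := K)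
    (by intro u hu; rw [nhds_prod_eq]; exact hU u hu)
  filter_upwards [hev] with x hx
  have key : ∀ u, |suppFun (Ψ x) u - suppFun (Ψ K) u| ≤ ε / 2 * ‖u‖ := by
    intro u
    rcases eq_or_ne u 0 with rfl | hu
    · simp [suppFun_zero]
    · have hn : 0 < ‖u‖ := norm_pos_iff.2 hu
      have h1 := hx (‖u‖⁻¹ • u) (by simp [norm_smul, hn.ne'])
      rw [suppFun_smul _ (inv_pos.2 hn), suppFun_smul _ (inv_pos.2 hn), ← mul_sub, abs_mul,
        abs_of_pos (inv_pos.2 hn), inv_mul_lt_iff₀ hn] at h1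
      linarith
  refine lt_of_le_of_lt (dist_le_of_suppFun_le (ε := ε / 2) (by positivity) (fun u => ?_)
    fun u => ?_) (half_lt_self hε)
  · linarith [(abs_le.1 (key u)).2]
  · linarith [(abs_le.1 (key u)).1]

lemma suppFun_slImage {n : ℕ} (φ : Matrix.SpecialLinearGroup (Fin n) ℝ) (K : ConvexBody (Eucl n))
    {u u' : Eucl n}
    (h : ∀ x, inner ℝ (Matrix.toEuclideanCLM (𝕜 := ℝ) φ.1 x) u' = (inner ℝ x u : ℝ)) :
    suppFun (slImage φ K) u' = suppFun K u := by
  unfold suppFun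
  congr 1
  change _ '' (_ '' _) = _
  rw [image_image]
  exact image_congr fun x _ => h x

lemma exists_adjoint {n : ℕ} (A : Matrix (Fin n) (Fin n) ℝ) (u : Eucl n) :
    ∃ w : Eucl n, ∀ x, inner ℝ (Matrix.toEuclideanCLM (𝕜 := ℝ) A x) u = (inner ℝ x w : ℝ) :=
  ⟨(ContinuousLinearMap.adjoint (Matrix.toEuclideanCLM (𝕜 := ℝ) A)) u, fun x => by
    rw [ContinuousLinearMap.adjoint_inner_right]⟩

/-! ### Real-valued valuations attached to operators. -/

/-- The properties of `(K, u) ↦ h(Φ K, u) ^ p` for a continuous `SL(n)`-covariant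
`L_p`-Minkowski valuation `Φ` that are stable under linear combinations. -/
structure IsLpVal {n : ℕ} (p : ℝ) (G : ConvexBody (Eucl n) → Eucl n → ℝ) : Prop where
  cont : Continuous fun x : ConvexBody (Eucl n) × Eucl n => G x.1 x.2
  homog : ∀ K u (t : ℝ), 0 < t → G K (t • u) = t ^ p * G K u
  covar : ∀ (φ : Matrix.SpecialLinearGroup (Fin n) ℝ) K u u',
    (∀ x, inner ℝ (Matrix.toEuclideanCLM (𝕜 := ℝ) φ.1 x) u' = (inner ℝ x u : ℝ)) →
    G (slImage φ K) u' = G K u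
  val : ∀ K L U I : ConvexBody (Eucl n), (U : Set (Eucl n)) = (K : Set (Eucl n)) ∪ L →
    (I : Set (Eucl n)) = (K : Set (Eucl n)) ∩ L → ∀ u, G U u + G I u = G K u + G L u

namespace IsLpVal
variable {n : ℕ} {p : ℝ} {G H : ConvexBody (Eucl n) → Eucl n → ℝ}

lemma add (hG : IsLpVal p G) (hH : IsLpVal p H) : IsLpVal p (fun K u => G K u + H K u) where
  cont := hG.cont.add hH.cont
  homog K u t ht := by rw [hG.homog K u t ht, hH.homog K u t ht]; ring
  covar φ K u u' h := by rw [hG.covar φ K u u' h, hH.covar φ K u u' h]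
  val K L U I h1 h2 u := by linarith [hG.val K L U I h1 h2 u, hH.val K L U I h1 h2 u]

lemma const_mul (hG : IsLpVal p G) (c : ℝ) : IsLpVal p (fun K u => c * G K u) where
  cont := hG.cont.const_mul c
  homog K u t ht := by rw [hG.homog K u t ht]; ring
  covar φ K u u' h := by rw [hG.covar φ K u u' h]
  val K L U I h1 h2 u := by rw [← mul_add, hG.val K L U I h1 h2 u]; ring

lemma sub (hG : IsLpVal p G) (hH : IsLpVal p H) : IsLpVal p (fun K u => G K u - H K u) := by
  simpa [sub_eq_add_neg] using hG.add (hH.const_mul (-1))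

lemma refl (hG : IsLpVal p G) : IsLpVal p (fun K u => G K (-u)) where
  cont := hG.cont.comp (f := fun x : ConvexBody (Eucl n) × Eucl n => (x.1, -x.2)) (by fun_prop)
  homog K u t ht := by rw [← smul_neg, hG.homog K _ t ht]
  covar φ K u u' h := hG.covar φ K _ _ fun x => by rw [inner_neg_right, inner_neg_right, h]
  val K L U I h1 h2 u := hG.val K L U I h1 h2 _

lemma cont_body (hG : IsLpVal p G) (u : Eucl n) : Continuous fun K => G K u :=
  hG.cont.comp (f := fun K : ConvexBody (Eucl n) => (K, u)) (by fun_prop)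

lemma cont_dir (hG : IsLpVal p G) (K : ConvexBody (Eucl n)) : Continuous fun u => G K u :=
  hG.cont.comp (f := fun u : Eucl n => (K, u)) (by fun_prop)

end IsLpVal

/-- The three properties of an operator in terms of its support functions. -/
lemma isLpVal_suppFun_iff {n : ℕ} {p : ℝ} (hp : 1 ≤ p) (Φ : ConvexBody (Eucl n) → BodyO n) :
    (Continuous Φ ∧ IsSLCovariant Φ ∧ IsLpMinkowskiValuation p Φ) ↔
      IsLpVal p fun K u => suppFun (Φ K).1 u ^ p := by
  have hp0 : 0 < p := by linarith
  constructor
  · rintro ⟨h1, h2, h3⟩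
    refine ⟨?_, fun K u t ht => ?_, fun φ K u u' h => ?_, fun K L U I hU hI u => ?_⟩
    · refine Continuous.rpow_const (continuous_suppFun.comp
        (f := fun x : ConvexBody (Eucl n) × Eucl n => ((Φ x.1).1, x.2)) (by fun_prop))
        fun _ => Or.inr hp0.le
    · rw [suppFun_smul _ ht, Real.mul_rpow ht.le (suppFun_nonneg _ _)]
    · simp only [h2 φ K, suppFun_slImage φ _ h]
    · simp only [← suppFun_lpAdd hp, h3 K L U I hU hI]
  · intro h
    have inj : ∀ {K L : BodyO n}, (∀ u, suppFun K.1 u ^ p = suppFun L.1 u ^ p) → K.1 = L.1 :=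
      fun {K L} hKL => suppFun_ext fun u =>
        (Real.rpow_left_inj (suppFun_nonneg K u) (suppFun_nonneg L u) hp0.ne').1 (hKL u)
    refine ⟨?_, fun φ K => ?_, fun K L U I hU hI => ?_⟩
    · refine Continuous.subtype_mk (f := fun K => (Φ K).1) (continuous_of_suppFun ?_) _
      have := h.cont.rpow_const (p := 1 / p) fun _ => Or.inr (by positivity)
      refine this.congr fun x => ?_
      rw [← Real.rpow_mul (suppFun_nonneg _ _), mul_one_div_cancel hp0.ne', Real.rpow_one]
    · refine suppFun_ext fun u' => ?_
      obtain ⟨u, hu⟩ := exists_adjoint φ.1 u'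
      rw [suppFun_slImage φ _ hu]
      exact (Real.rpow_left_inj (suppFun_nonneg _ u') (suppFun_nonneg _ u) hp0.ne').1
        (h.covar φ K u u' hu)
    · refine Subtype.ext (inj fun u => ?_)
      rw [suppFun_lpAdd hp, suppFun_lpAdd hp]
      exact h.val K L U I hU hI u

/-! ### The basic valuations. -/

lemma exists_mem_segment_inter {E : Type*} [AddCommGroup E] [Module ℝ E] [TopologicalSpace E]
    [ContinuousAdd E] [ContinuousSMul ℝ E] {A B : Set E} (hA : IsClosed A)
    (hB : IsClosed B) {x y : E} (hx : x ∈ A) (hy : y ∈ B) (h : segment ℝ x y ⊆ A ∪ B) :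
    ∃ z ∈ segment ℝ x y, z ∈ A ∩ B :=
  isPreconnected_closed_iff.1 (convex_segment x y).isPreconnected A B hA hB h
    ⟨x, left_mem_segment ℝ x y, hx⟩ ⟨y, right_mem_segment ℝ x y, hy⟩

lemma suppFun_mono {n : ℕ} {K L : ConvexBody (Eucl n)} (h : (K : Set (Eucl n)) ⊆ L) (u : Eucl n) :
    suppFun K u ≤ suppFun L u :=
  suppFun_le fun _ hx => inner_le_suppFun (h hx) u

lemma suppFun_union {n : ℕ} {K L U : ConvexBody (Eucl n)}
    (hU : (U : Set (Eucl n)) = (K : Set (Eucl n)) ∪ L) (u : Eucl n) :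
    suppFun U u = max (suppFun K u) (suppFun L u) := by
  refine le_antisymm (suppFun_le fun x hx => ?_) (max_le (suppFun_mono ?_ u) (suppFun_mono ?_ u))
  · rcases (hU ▸ hx : x ∈ (K : Set (Eucl n)) ∪ L) with h | h
    · exact (inner_le_suppFun h u).trans (le_max_left _ _)
    · exact (inner_le_suppFun h u).trans (le_max_right _ _)
  · rw [hU]; exact subset_union_left
  · rw [hU]; exact subset_union_right

/-- A segment joining a maximiser in K to a maximiser in L stays in the convex union K ∪ L. By
connectedness it meets K ∩ L, and every point of it has height at least the smaller of the two
maxima. -/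
lemma suppFun_inter {n : ℕ} {K L U I : ConvexBody (Eucl n)}
    (hU : (U : Set (Eucl n)) = (K : Set (Eucl n)) ∪ L)
    (hI : (I : Set (Eucl n)) = (K : Set (Eucl n)) ∩ L) (u : Eucl n) :
    suppFun I u = min (suppFun K u) (suppFun L u) := by
  refine le_antisymm (le_min (suppFun_mono ?_ u) (suppFun_mono ?_ u)) ?_
  · rw [hI]; exact inter_subset_left
  · rw [hI]; exact inter_subset_right
  · obtain ⟨x, hx, hxu⟩ := exists_inner_eq_suppFun K u
    obtain ⟨y, hy, hyu⟩ := exists_inner_eq_suppFun L u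
    have hxU : x ∈ (U : Set (Eucl n)) := by rw [hU]; exact Or.inl hx
    have hyU : y ∈ (U : Set (Eucl n)) := by rw [hU]; exact Or.inr hy
    obtain ⟨z, hz, hzI⟩ := exists_mem_segment_inter K.isClosed L.isClosed hx hy
      (hU ▸ U.convex.segment_subset hxU hyU)
    rw [← hI] at hzI
    refine le_trans ?_ (inner_le_suppFun hzI u)
    obtain ⟨a, b, ha, hb, hab, rfl⟩ := hz
    rw [inner_add_left, real_inner_smul_left, real_inner_smul_left, hxu, hyu]
    have h1 := min_le_left (suppFun K u) (suppFun L u)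
    have h2 := min_le_right (suppFun K u) (suppFun L u)
    calc min (suppFun K u) (suppFun L u)
        = a * min (suppFun K u) (suppFun L u) + b * min (suppFun K u) (suppFun L u) := by
          rw [← add_mul, hab, one_mul]
      _ ≤ _ := by gcongr

/-- `max (0, h(K, u)) ^ p`. -/
noncomputable def suppPos {n : ℕ} (p : ℝ) (K : ConvexBody (Eucl n)) (u : Eucl n) : ℝ :=
  max 0 (suppFun K u) ^ p

/-- `max (0, min_{x ∈ K} ⟨x, u⟩) ^ p`. -/
noncomputable def minPos {n : ℕ} (p : ℝ) (K : ConvexBody (Eucl n)) (u : Eucl n) : ℝ :=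
  max 0 (-suppFun K (-u)) ^ p

/-- `∫_K ⟨x, u⟩₊ ^ p dx`. -/
noncomputable def momFun {n : ℕ} (p : ℝ) (K : ConvexBody (Eucl n)) (u : Eucl n) : ℝ :=
  ∫ x in (K : Set (Eucl n)), max 0 (inner ℝ x u : ℝ) ^ p

lemma isLpVal_suppPos {n : ℕ} {p : ℝ} (hp : 0 ≤ p) : IsLpVal (n := n) p (suppPos p) where
  cont := (continuous_const.max continuous_suppFun).rpow_const fun _ => Or.inr hp
  homog K u t ht := by
    rw [suppPos, suppPos, suppFun_smul _ ht, ← Real.mul_rpow ht.le (le_max_left _ _),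
      mul_max_of_nonneg _ _ ht.le, mul_zero]
  covar φ K u u' h := by rw [suppPos, suppPos, suppFun_slImage φ K h]
  val K L U I hU hI u := by
    rw [suppPos, suppPos, suppFun_union hU, suppFun_inter hU hI]
    rcases le_total (suppFun K u) (suppFun L u) with h | h
    · rw [max_eq_right h, min_eq_left h, add_comm]; rfl
    · rw [max_eq_left h, min_eq_right h]; rfl

/-- This valuation has no counterpart in the classification. It is needed to span all solutions, and
is excluded only later by convexity in u. -/
lemma isLpVal_minPos {n : ℕ} {p : ℝ} (hp : 0 ≤ p) : IsLpVal (n := n) p (minPos p) where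
  cont := (continuous_const.max (continuous_suppFun.comp
    (f := fun x : ConvexBody (Eucl n) × Eucl n => (x.1, -x.2)) (by fun_prop)).neg).rpow_const
      fun _ => Or.inr hp
  homog K u t ht := by
    rw [minPos, minPos, ← smul_neg, suppFun_smul _ ht, ← Real.mul_rpow ht.le (le_max_left _ _),
      mul_max_of_nonneg _ _ ht.le, mul_zero, mul_neg]
  covar φ K u u' h := by
    rw [minPos, minPos, suppFun_slImage φ K (u := -u)]
    intro x
    rw [inner_neg_right, inner_neg_right, h]
  val K L U I hU hI u := by
    rw [minPos, minPos, suppFun_union hU, suppFun_inter hU hI]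
    rcases le_total (suppFun K (-u)) (suppFun L (-u)) with h | h
    · rw [max_eq_right h, min_eq_left h, add_comm]; rfl
    · rw [max_eq_left h, min_eq_right h]; rfl

lemma eventually_not_mem {n : ℕ} {K : ConvexBody (Eucl n)} {y : Eucl n} (hy : y ∉ K) :
    ∀ᶠ L in 𝓝 K, y ∉ L := by
  have : ∃ u, suppFun K u < inner ℝ y u := by
    by_contra! h
    exact hy (mem_of_inner_le h)
  obtain ⟨u, hu⟩ := this
  have hc : Continuous fun L : ConvexBody (Eucl n) => suppFun L u :=
    continuous_suppFun.comp (f := fun L : ConvexBody (Eucl n) => (L, u)) (by fun_prop)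
  filter_upwards [(hc.tendsto K).eventually_lt_const hu] with L hL hyL
  exact absurd (inner_le_suppFun hyL u) (not_le.2 hL)

/-- A ball of radius r around y inside K gives h(K, u) ≥ ⟨y, u⟩ + r ‖u‖, and a perturbation of K by
less than r loses at most r ‖u‖. -/
lemma eventually_mem {n : ℕ} {K : ConvexBody (Eucl n)} {y : Eucl n}
    (hy : y ∈ interior (K : Set (Eucl n))) : ∀ᶠ L in 𝓝 K, y ∈ L := by
  obtain ⟨r, hr, hb⟩ := Metric.nhds_basis_closedBall.mem_iff.1 (mem_interior_iff_mem_nhds.1 hy)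
  filter_upwards [Metric.ball_mem_nhds K hr] with L hL
  refine mem_of_inner_le fun u => ?_
  have h2 : suppFun K u ≤ suppFun L u + dist K L * ‖u‖ := suppFun_le_add_dist K L u
  have h3 : inner ℝ y u + r * ‖u‖ ≤ suppFun K u := by
    rcases eq_or_ne u 0 with rfl | hu
    · simp [suppFun_zero]
    · have hn := norm_pos_iff.2 hu
      have hm : y + (r * ‖u‖⁻¹) • u ∈ K := hb (by
        simp [norm_smul, abs_of_pos hr, hn.ne'])
      have := inner_le_suppFun hm u
      rw [inner_add_left, real_inner_smul_left, real_inner_self_eq_norm_mul_norm] at this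
      field_simp at this
      linarith
  have h4 : dist K L ≤ r := by rw [dist_comm]; exact (Metric.mem_ball.1 hL).le
  have := mul_le_mul_of_nonneg_right h4 (norm_nonneg u)
  linarith

lemma integrableOn_max_inner_rpow {n : ℕ} {p : ℝ} (hp : 0 ≤ p) (K : ConvexBody (Eucl n))
    (u : Eucl n) : IntegrableOn (fun x : Eucl n => max 0 (inner ℝ x u : ℝ) ^ p) K := by
  refine ContinuousOn.integrableOn_compact K.isCompact (Continuous.continuousOn ?_)
  exact Continuous.rpow_const (by fun_prop) fun _ => Or.inr hp

/-- Dominated convergence: the indicator functions of the bodies converge at every point off the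
boundary of K, and the boundary of a convex set is a null set, also when K has empty interior. -/
lemma continuous_momFun {n : ℕ} {p : ℝ} (hp : 0 ≤ p) :
    Continuous fun x : ConvexBody (Eucl n) × Eucl n => momFun p x.1 x.2 := by
  rw [continuous_iff_continuousAt]
  rintro ⟨K, u⟩
  have hcp : Continuous fun x : Eucl n × Eucl n => max 0 (inner ℝ x.1 x.2 : ℝ) ^ p :=
    Continuous.rpow_const (by fun_prop) fun _ => Or.inr hp
  simp only [momFun, ← integral_indicator (ConvexBody.isClosed _).measurableSet]
  obtain ⟨R, hR⟩ := K.isBounded.exists_norm_le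
  have hR' : 0 ≤ |R| + 1 := by positivity
  refine continuousAt_of_dominated (bound := (Metric.closedBall (0 : Eucl n) (|R| + 1)).indicator
    fun _ => ((|R| + 1) * (‖u‖ + 1)) ^ p) ?_ ?_ ?_ ?_
  · refine Eventually.of_forall fun x => ?_
    refine (StronglyMeasurable.indicator ?_ (ConvexBody.isClosed _).measurableSet).aestronglyMeasurable
    exact (hcp.comp (f := fun y : Eucl n => (y, x.2)) (by fun_prop)).stronglyMeasurable
  · have h1 : ∀ᶠ x : ConvexBody (Eucl n) × Eucl n in 𝓝 (K, u), dist x.1 K < 1 ∧ ‖x.2‖ < ‖u‖ + 1 := by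
      have c1 : Continuous fun x : ConvexBody (Eucl n) × Eucl n => dist x.1 K := by fun_prop
      have c2 : Continuous fun x : ConvexBody (Eucl n) × Eucl n => ‖x.2‖ := by fun_prop
      exact (c1.continuousAt.eventually_lt_const (by simp)).and
        (c2.continuousAt.eventually_lt_const (by simp))
    filter_upwards [h1] with x hx
    refine Eventually.of_forall fun y => ?_
    by_cases hy : y ∈ (x.1 : Set (Eucl n))
    · have hyR : ‖y‖ ≤ |R| + 1 := by
        obtain ⟨z, hz, hyz⟩ := Metric.exists_dist_lt_of_hausdorffDist_lt hy hx.1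
          ConvexBody.hausdorffEDist_ne_top
        have := norm_le_norm_add_norm_sub' y z
        rw [← dist_eq_norm] at this
        linarith [hR z hz, le_abs_self R]
      rw [indicator_of_mem hy, indicator_of_mem (by simpa using hyR),
        Real.norm_of_nonneg (by positivity)]
      refine Real.rpow_le_rpow (le_max_left _ _) (max_le (by positivity) ?_) hp
      refine (real_inner_le_norm _ _).trans ?_
      gcongr
      exact hx.2.le
    · rw [indicator_of_notMem hy, norm_zero]
      exact indicator_nonneg (fun _ _ => by positivity) _
  · rw [integrable_indicator_iff measurableSet_closedBall]
    exact integrableOn_const (isCompact_closedBall _ _).measure_lt_top.ne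
  · have hfr := K.convex.addHaar_frontier volume
    rw [measure_eq_zero_iff_ae_notMem] at hfr
    filter_upwards [hfr] with y hy
    by_cases hyK : y ∈ K
    · have hi : y ∈ interior (K : Set (Eucl n)) := by
        by_contra hi
        exact hy ⟨subset_closure hyK, hi⟩
      have he : ∀ᶠ x : ConvexBody (Eucl n) × Eucl n in 𝓝 (K, u), y ∈ x.1 :=
        (continuous_fst.tendsto (K, u)).eventually (eventually_mem hi)
      refine ContinuousAt.congr (f := fun x : ConvexBody (Eucl n) × Eucl n =>
        max 0 (inner ℝ y x.2 : ℝ) ^ p) ?_ ?_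
      · exact (hcp.comp (f := fun x : ConvexBody (Eucl n) × Eucl n => (y, x.2))
          (by fun_prop)).continuousAt
      · filter_upwards [he] with x hx
        exact (indicator_of_mem (s := (x.1 : Set (Eucl n))) hx
          fun z : Eucl n => max 0 (inner ℝ z x.2 : ℝ) ^ p).symm
    · have he : ∀ᶠ x : ConvexBody (Eucl n) × Eucl n in 𝓝 (K, u), y ∉ x.1 :=
        (continuous_fst.tendsto (K, u)).eventually (eventually_not_mem hyK)
      refine ContinuousAt.congr (f := fun _ => (0 : ℝ)) continuousAt_const ?_
      filter_upwards [he] with x hx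
      exact (indicator_of_notMem (s := (x.1 : Set (Eucl n))) hx _).symm

lemma det_toEuclideanCLM {n : ℕ} (A : Matrix (Fin n) (Fin n) ℝ) :
    (Matrix.toEuclideanCLM (𝕜 := ℝ) A).det = A.det := by
  rw [ContinuousLinearMap.det, Matrix.coe_toEuclideanCLM_eq_toEuclideanLin,
    Matrix.toEuclideanLin_eq_toLin_orthonormal, LinearMap.det_toLin]

lemma isLpVal_momFun {n : ℕ} {p : ℝ} (hp : 0 ≤ p) : IsLpVal (n := n) p (momFun p) where
  cont := continuous_momFun hp
  homog K u t ht := by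
    rw [momFun, momFun, ← integral_const_mul]
    congr 1
    ext x
    rw [real_inner_smul_right, ← Real.mul_rpow ht.le (le_max_left _ _),
      mul_max_of_nonneg _ _ ht.le, mul_zero]
  covar φ K u u' h := by
    set A := Matrix.toEuclideanCLM (𝕜 := ℝ) φ.1 with hA
    have hd : A.det = 1 := by rw [hA, det_toEuclideanCLM]; exact φ.2
    have hinj : Function.Injective A := by
      have : IsUnit (LinearMap.det (A : Eucl n →ₗ[ℝ] Eucl n)) := by
        change IsUnit A.det
        rw [hd]; exact isUnit_one
      exact (LinearMap.isUnit_iff_ker_eq_bot _).1 ((LinearMap.isUnit_iff_isUnit_det _).2 this) |> LinearMap.ker_eq_bot.1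
    have := integral_image_eq_integral_abs_det_fderiv_smul volume K.isClosed.measurableSet
      (f := A) (f' := fun _ => A) (fun x _ => A.hasFDerivAt.hasFDerivWithinAt) hinj.injOn
      (fun x : Eucl n => max 0 (inner ℝ x u' : ℝ) ^ p)
    simp only [hd, abs_one, one_smul, h] at this
    exact this
  val K L U I hU hI u := by
    simp only [momFun]
    rw [hU, hI]
    have h1 := integrableOn_max_inner_rpow hp K u
    have h2 := integrableOn_max_inner_rpow hp L u
    have h3 : (K : Set (Eucl n)) ∪ L = ((K : Set (Eucl n)) \ L) ∪ L := by simp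
    rw [h3, setIntegral_union disjoint_sdiff_left L.isClosed.measurableSet
      (h1.mono_set sdiff_subset) h2, ← integral_inter_add_sdiff L.isClosed.measurableSet h1]
    ring

lemma mem_hullO {n : ℕ} {K : ConvexBody (Eucl n)} {x : Eucl n} :
    x ∈ (hullO K).1 ↔ ∃ t ∈ Icc (0 : ℝ) 1, ∃ y ∈ K, t • y = x := by
  change x ∈ convexHull ℝ (insert 0 (K : Set (Eucl n))) ↔ _
  rw [convexHull_insert K.nonempty, K.convex.convexHull_eq]
  simp only [convexJoin_singleton_left, mem_iUnion, segment_eq_image, mem_image, smul_zero,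
    zero_add]
  constructor
  · rintro ⟨y, hy, t, ht, rfl⟩
    exact ⟨t, ht, y, hy, rfl⟩
  · rintro ⟨t, ht, y, hy, rfl⟩
    exact ⟨y, hy, t, ht, rfl⟩

lemma subset_hullO {n : ℕ} (K : ConvexBody (Eucl n)) :
    (K : Set (Eucl n)) ⊆ ((hullO K).1 : Set (Eucl n)) :=
  (subset_insert _ _).trans (subset_convexHull ℝ _)

lemma suppFun_hullO {n : ℕ} (K : ConvexBody (Eucl n)) (u : Eucl n) :
    suppFun (hullO K).1 u = max 0 (suppFun K u) := by
  refine le_antisymm (suppFun_le fun x hx => ?_) (max_le (suppFun_nonneg _ _)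
    (suppFun_mono (subset_hullO K) u))
  obtain ⟨t, ht, y, hy, rfl⟩ := mem_hullO.1 hx
  rw [real_inner_smul_left]
  have h1 := inner_le_suppFun hy u
  have h2 := le_max_left 0 (suppFun K u)
  have h3 := le_max_right 0 (suppFun K u)
  nlinarith [ht.1, ht.2]

lemma continuous_hullO {n : ℕ} : Continuous fun K : ConvexBody (Eucl n) => (hullO K).1 := by
  refine continuous_of_suppFun ?_
  simp only [suppFun_hullO]
  exact continuous_const.max continuous_suppFun

/-- The map K ↦ K_o respects unions, and respects the intersections in question because max(0, ·)
distributes over the minimum of two support functions. It also commutes with SL(n), so composing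
with it preserves all four properties. -/
lemma isLpVal_comp_hullO {n : ℕ} {p : ℝ} {G : ConvexBody (Eucl n) → Eucl n → ℝ}
    (hG : IsLpVal p G) : IsLpVal p fun K u => G (hullO K).1 u where
  cont := hG.cont.comp (f := fun x : ConvexBody (Eucl n) × Eucl n => ((hullO x.1).1, x.2))
    ((continuous_hullO.comp continuous_fst).prodMk continuous_snd)
  homog K u t ht := hG.homog _ u t ht
  covar φ K u u' h := by
    have : (hullO (slImage φ K)).1 = slImage φ (hullO K).1 := by
      refine suppFun_ext fun w' => ?_
      obtain ⟨w, hw⟩ := exists_adjoint φ.1 w'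
      rw [suppFun_slImage φ _ hw, suppFun_hullO, suppFun_hullO, suppFun_slImage φ _ hw]
    rw [this, hG.covar φ _ u u' h]
  val K L U I hU hI u := by
    have hU' : ((hullO U).1 : Set (Eucl n)) = ((hullO K).1 : Set (Eucl n)) ∪ (hullO L).1 := by
      ext x
      simp only [mem_union, SetLike.mem_coe, mem_hullO]
      have hm : ∀ y, y ∈ U ↔ y ∈ K ∨ y ∈ L := fun y => by
        rw [← SetLike.mem_coe, hU]; rfl
      simp only [hm]
      grind
    have hne : (((hullO K).1 : Set (Eucl n)) ∩ (hullO L).1).Nonempty :=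
      ⟨0, (hullO K).2, (hullO L).2⟩
    let J : ConvexBody (Eucl n) := ⟨((hullO K).1 : Set (Eucl n)) ∩ (hullO L).1,
      (hullO K).1.convex.inter (hullO L).1.convex,
      (hullO K).1.isCompact.inter_right (hullO L).1.isClosed, hne⟩
    have hJ : (hullO I).1 = J := by
      refine suppFun_ext fun w => ?_
      rw [suppFun_inter hU' (I := J) rfl, suppFun_hullO, suppFun_hullO, suppFun_hullO,
        suppFun_inter hU hI, max_min_distrib_left]
    exact hG.val _ _ _ _ hU' (by rw [hJ]; rfl) u

lemma suppFun_smul_body {n : ℕ} {c : ℝ} (hc : 0 ≤ c) (K : BodyO n) (u : Eucl n) :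
    suppFun (c • K).1 u = c * suppFun K.1 u := by
  have h : (fun x : Eucl n => (inner ℝ x u : ℝ)) '' ((c • K).1 : Set (Eucl n)) =
      c • ((fun x : Eucl n => (inner ℝ x u : ℝ)) '' (K.1 : Set (Eucl n))) := by
    change _ '' (c • (K.1 : Set (Eucl n))) = _
    ext y
    simp [Set.mem_smul_set, inner_smul_left]
  rw [suppFun, h, Real.sSup_smul_of_nonneg hc, smul_eq_mul, suppFun]

lemma suppFun_neg_body {n : ℕ} (K : BodyO n) (u : Eucl n) :
    suppFun (-K).1 u = suppFun K.1 (-u) := by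
  have h : (fun x : Eucl n => (inner ℝ x u : ℝ)) '' ((-K).1 : Set (Eucl n)) =
      (fun x : Eucl n => (inner ℝ x (-u) : ℝ)) '' (K.1 : Set (Eucl n)) := by
    change _ '' (-(K.1 : Set (Eucl n))) = _
    rw [← image_neg_eq_neg, image_image]
    simp
  rw [suppFun, h, suppFun]

lemma setIntegral_hullO_diff {n : ℕ} {p : ℝ} (hp : 0 ≤ p) (K : ConvexBody (Eucl n)) (u : Eucl n) :
    ∫ x in ((hullO K).1 : Set (Eucl n)) \ K, max 0 (inner ℝ x u : ℝ) ^ p =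
      momFun p (hullO K).1 u - momFun p K u := by
  rw [momFun, momFun, setIntegral_sdiff K.isClosed.measurableSet
    (integrableOn_max_inner_rpow hp _ u) (subset_hullO K)]

/-- The support function of the right-hand side of the classification. -/
lemma suppFun_classification {n : ℕ} {p : ℝ} (hp : 1 ≤ p) {c₁ c₂ c₃ c₄ c₅ c₆ : ℝ}
    (h₁ : 0 ≤ c₁) (h₂ : 0 ≤ c₂) (h₃ : 0 ≤ c₃) (h₄ : 0 ≤ c₄) (h₅ : 0 ≤ c₅) (h₆ : 0 ≤ c₆)
    (K : ConvexBody (Eucl n)) (u : Eucl n) :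
    suppFun (lpAdd p (lpAdd p (lpAdd p (lpAdd p (lpAdd p
      (c₁ • MPos p K) (c₂ • MNeg p K)) (c₃ • MPosStar p K)) (c₄ • MNegStar p K))
      (c₅ • hullO K)) (c₆ • (-hullO K))).1 u ^ p =
    c₁ ^ p * momFun p K u + c₂ ^ p * momFun p K (-u) +
      c₃ ^ p * (momFun p (hullO K).1 u - momFun p K u) +
      c₄ ^ p * (momFun p (hullO K).1 (-u) - momFun p K (-u)) +
      c₅ ^ p * suppPos p K u + c₆ ^ p * suppPos p K (-u) := by
  have hp0 : 0 ≤ p := by linarith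
  have hd : Bornology.IsBounded (((hullO K).1 : Set (Eucl n)) \ K) :=
    (hullO K).1.isBounded.subset sdiff_subset
  simp only [suppFun_lpAdd hp]
  rw [suppFun_smul_body h₁, suppFun_smul_body h₂, suppFun_smul_body h₃, suppFun_smul_body h₄,
    suppFun_smul_body h₅, suppFun_smul_body h₆, Real.mul_rpow h₁ (suppFun_nonneg _ _),
    Real.mul_rpow h₂ (suppFun_nonneg _ _), Real.mul_rpow h₃ (suppFun_nonneg _ _),
    Real.mul_rpow h₄ (suppFun_nonneg _ _), Real.mul_rpow h₅ (suppFun_nonneg _ _),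
    Real.mul_rpow h₆ (suppFun_nonneg _ _), MPos, MNeg, MPosStar, MNegStar,
    suppFun_momentPos hp K.isBounded, suppFun_momentNeg hp K.isBounded, suppFun_momentPos hp hd,
    suppFun_momentNeg hp hd, suppFun_neg_body, suppFun_hullO, suppFun_hullO,
    setIntegral_hullO_diff hp0, ← setIntegral_hullO_diff hp0 K (-u)]
  simp only [inner_neg_right, momFun, suppPos]

/-- The function of `(K, u)` with the coefficients of the classification is an `L_p`-valuation. -/
lemma isLpVal_classification {n : ℕ} {p : ℝ} (hp : 0 ≤ p) (C₁ C₂ C₃ C₄ C₅ C₆ : ℝ) :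
    IsLpVal (n := n) p fun K u => C₁ * momFun p K u + C₂ * momFun p K (-u) +
      C₃ * (momFun p (hullO K).1 u - momFun p K u) +
      C₄ * (momFun p (hullO K).1 (-u) - momFun p K (-u)) +
      C₅ * suppPos p K u + C₆ * suppPos p K (-u) := by
  have h1 := isLpVal_momFun (n := n) hp
  have h2 := isLpVal_comp_hullO h1
  have h3 := isLpVal_suppPos (n := n) hp
  exact ((((((h1.const_mul C₁).add (h1.refl.const_mul C₂)).add ((h2.sub h1).const_mul C₃)).add
    ((h2.refl.sub h1.refl).const_mul C₄)).add (h3.const_mul C₅)).add (h3.refl.const_mul C₆))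

/-! ### Extension to sets, and cutting of simplices. -/

open Classical in
/-- Extension of a function on convex bodies to sets, with value `0` on sets that are not bodies;
in particular on the empty set. -/
noncomputable def evalSet {n : ℕ} (G : ConvexBody (Eucl n) → Eucl n → ℝ) (A : Set (Eucl n))
    (u : Eucl n) : ℝ :=
  if h : Convex ℝ A ∧ IsCompact A ∧ A.Nonempty then G ⟨A, h.1, h.2.1, h.2.2⟩ u else 0

section evalSet
variable {n : ℕ} {p : ℝ} {G : ConvexBody (Eucl n) → Eucl n → ℝ}

lemma evalSet_coe (G : ConvexBody (Eucl n) → Eucl n → ℝ) (K : ConvexBody (Eucl n)) (u : Eucl n) :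
    evalSet G K u = G K u := by
  rw [evalSet, dif_pos ⟨K.convex, K.isCompact, K.nonempty⟩]
  rfl

lemma evalSet_empty (u : Eucl n) : evalSet G ∅ u = 0 := by
  rw [evalSet, dif_neg]
  simp

lemma evalSet_mk {A : Set (Eucl n)} (h1 : Convex ℝ A) (h2 : IsCompact A) (h3 : A.Nonempty)
    (u : Eucl n) : evalSet G A u = G ⟨A, h1, h2, h3⟩ u :=
  dif_pos ⟨h1, h2, h3⟩

/-- With the value 0 on the empty set, the pieces of a cut need not be checked for being nonempty.
If both are nonempty, their intersection is too, since the union is convex. -/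
lemma evalSet_union (hG : IsLpVal p G) {A B : Set (Eucl n)} (hA : Convex ℝ A) (hA' : IsCompact A)
    (hB : Convex ℝ B) (hB' : IsCompact B) (hU : Convex ℝ (A ∪ B)) (u : Eucl n) :
    evalSet G (A ∪ B) u + evalSet G (A ∩ B) u = evalSet G A u + evalSet G B u := by
  rcases A.eq_empty_or_nonempty with rfl | hAn
  · rw [empty_union, empty_inter, add_comm]
  rcases B.eq_empty_or_nonempty with rfl | hBn
  · rw [union_empty, inter_empty]
  obtain ⟨x, hx⟩ := hAn
  obtain ⟨y, hy⟩ := hBn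
  obtain ⟨z, -, hz⟩ := exists_mem_segment_inter hA'.isClosed hB'.isClosed hx hy
    (hU.segment_subset (Or.inl hx) (Or.inr hy))
  rw [evalSet_mk hU (hA'.union hB') ⟨x, Or.inl hx⟩,
    evalSet_mk (hA.inter hB) (hA'.inter hB') ⟨z, hz⟩, evalSet_mk hA hA' ⟨x, hx⟩,
    evalSet_mk hB hB' ⟨y, hy⟩]
  exact hG.val _ _ _ _ rfl rfl u

lemma evalSet_image (hG : IsLpVal p G) (φ : Matrix.SpecialLinearGroup (Fin n) ℝ)
    {A : Set (Eucl n)} (hA : Convex ℝ A) (hA' : IsCompact A) {u u' : Eucl n}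
    (h : ∀ x, inner ℝ (Matrix.toEuclideanCLM (𝕜 := ℝ) φ.1 x) u' = (inner ℝ x u : ℝ)) :
    evalSet G (Matrix.toEuclideanCLM (𝕜 := ℝ) φ.1 '' A) u' = evalSet G A u := by
  rcases A.eq_empty_or_nonempty with rfl | hAn
  · rw [image_empty, evalSet_empty, evalSet_empty]
  rw [evalSet_mk hA hA' hAn, ← hG.covar φ _ u u' h, ← evalSet_coe G]
  rfl

lemma evalSet_continuous_dir (hG : IsLpVal p G) (A : Set (Eucl n)) :
    Continuous fun u => evalSet G A u := by
  unfold evalSet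
  split_ifs with h
  · exact hG.cont_dir _
  · exact continuous_const

lemma evalSet_homog (hG : IsLpVal p G) (A : Set (Eucl n)) (u : Eucl n) {t : ℝ} (ht : 0 < t) :
    evalSet G A (t • u) = t ^ p * evalSet G A u := by
  unfold evalSet
  split_ifs with h
  · exact hG.homog _ u t ht
  · rw [mul_zero]

end evalSet

/-- The convex hull of the points `P k`, `k ∈ J`. -/
def hullOn {ι E : Type*} [AddCommGroup E] [Module ℝ E] (P : ι → E) (J : Finset ι) : Set E :=
  convexHull ℝ (P '' (J : Set ι))

section hullOn
variable {ι E : Type*} [AddCommGroup E] [Module ℝ E]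

lemma convex_hullOn (P : ι → E) (J : Finset ι) : Convex ℝ (hullOn P J) := convex_convexHull ℝ _

lemma hullOn_congr {P Q : ι → E} {J : Finset ι} (h : ∀ k ∈ J, P k = Q k) :
    hullOn P J = hullOn Q J := by
  rw [hullOn, hullOn, image_congr (fun k hk => h k hk)]

lemma hullOn_nonempty (P : ι → E) {J : Finset ι} (h : J.Nonempty) : (hullOn P J).Nonempty :=
  convexHull_nonempty_iff.2 ((Finset.coe_nonempty.2 h).image P)

lemma isCompact_hullOn [TopologicalSpace E] [IsTopologicalAddGroup E] [ContinuousSMul ℝ E]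
    (P : ι → E) (J : Finset ι) : IsCompact (hullOn P J) :=
  (J.finite_toSet.image P).isCompact_convexHull (𝕜 := ℝ)

lemma mem_hullOn [Fintype ι] {P : ι → E} {J : Finset ι} {x : E} :
    x ∈ hullOn P J ↔ ∃ t : ι → ℝ, (∀ k, 0 ≤ t k) ∧ (∀ k ∉ J, t k = 0) ∧ ∑ k, t k = 1 ∧
      ∑ k, t k • P k = x := by
  classical
  constructor
  · intro hx
    let C : Set E := {x | ∃ t : ι → ℝ, (∀ k, 0 ≤ t k) ∧ (∀ k ∉ J, t k = 0) ∧ ∑ k, t k = 1 ∧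
      ∑ k, t k • P k = x}
    have hC : Convex ℝ C := by
      rintro _ ⟨t, h1, h2, h3, rfl⟩ _ ⟨s, k1, k2, k3, rfl⟩ a b ha hb hab
      refine ⟨fun k => a * t k + b * s k, fun k => ?_, fun k hk => ?_, ?_, ?_⟩
      · have := h1 k
        have := k1 k
        positivity
      · simp [h2 k hk, k2 k hk]
      · rw [Finset.sum_add_distrib, ← Finset.mul_sum, ← Finset.mul_sum, h3, k3]
        simpa using hab
      · simp only [add_smul, mul_smul, Finset.sum_add_distrib, Finset.smul_sum]
    refine convexHull_min ?_ hC hx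
    rintro _ ⟨k, hk, rfl⟩
    refine ⟨Pi.single k 1, fun l => ?_, fun l hl => ?_, ?_, ?_⟩
    · by_cases h : l = k <;> simp [h]
    · have : l ≠ k := fun h => hl (h ▸ hk)
      simp [this]
    · simp
    · simp [Pi.single_apply]
  · rintro ⟨t, h1, h2, h3, rfl⟩
    have e1 : ∑ k ∈ J, t k = 1 := by
      rw [← h3]
      exact Finset.sum_subset (Finset.subset_univ _) fun k _ hk => h2 k hk
    have e2 : ∑ k, t k • P k = ∑ k ∈ J, t k • P k :=
      (Finset.sum_subset (Finset.subset_univ _) fun k _ hk => by rw [h2 k hk, zero_smul]).symm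
    rw [e2]
    exact (convex_hullOn P J).sum_mem (fun k _ => h1 k) e1 fun k hk =>
      subset_convexHull ℝ _ (mem_image_of_mem P hk)

lemma hullOn_subset {P : ι → E} {J : Finset ι} {A : Set E} (hA : Convex ℝ A)
    (h : ∀ k ∈ J, P k ∈ A) : hullOn P J ⊆ A := by
  refine convexHull_min ?_ hA
  rintro _ ⟨k, hk, rfl⟩
  exact h k hk

lemma mem_hullOn_of_mem {P : ι → E} {J : Finset ι} {k : ι} (hk : k ∈ J) : P k ∈ hullOn P J :=
  subset_convexHull ℝ _ (mem_image_of_mem P hk)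

/-- Write c for the new point and substitute P j = (c - (1 - r) P i) / r. The weight of c becomes t
j / r and that of P i becomes t i - (1 - r) t j / r, which is nonnegative exactly by `hle`. -/
lemma mem_hullOn_update [Fintype ι] [DecidableEq ι] {P : ι → E} {J : Finset ι} {i j : ι}
    (hij : i ≠ j) (hi : i ∈ J) (hj : j ∈ J) {r : ℝ} (h0 : 0 < r) {t : ι → ℝ}
    (ht : ∀ k, 0 ≤ t k) (htJ : ∀ k ∉ J, t k = 0) (hs : ∑ k, t k = 1)
    (hle : (1 - r) * t j ≤ r * t i) :
    ∑ k, t k • P k ∈ hullOn (Function.update P j ((1 - r) • P i + r • P j)) J := by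
  have hc : ∀ k, Function.update P j ((1 - r) • P i + r • P j) k =
      P k + if k = j then (1 - r) • P i + (r - 1) • P j else 0 := by
    intro k
    by_cases h : k = j
    · subst h
      simp only [Function.update_self, if_true, sub_smul, one_smul]
      abel
    · simp [h]
  refine mem_hullOn.2 ⟨fun k => t k + (if k = i then (1 - 1 / r) * t j else 0) +
    (if k = j then (1 / r - 1) * t j else 0), fun k => ?_, fun k hk => ?_, ?_, ?_⟩
  · have e : (1 - r) * t j / r ≤ t i := by rw [div_le_iff₀ h0]; linarith
    by_cases h1 : k = i
    · subst h1
      have : t k + (1 - 1 / r) * t j = t k - (1 - r) * t j / r := by field_simp; ring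
      simp only [if_true, hij, if_false, add_zero, this]
      linarith
    · by_cases h2 : k = j
      · subst h2
        have : t k + (1 / r - 1) * t k = t k / r := by field_simp; ring
        simp only [h1, if_false, add_zero, if_true, this]
        exact div_nonneg (ht k) h0.le
      · simpa [h1, h2] using ht k
  · have h1 : k ≠ i := fun h => hk (h ▸ hi)
    have h2 : k ≠ j := fun h => hk (h ▸ hj)
    simp [h1, h2, htJ k hk]
  · simp only [Finset.sum_add_distrib, hs, Finset.sum_ite_eq', Finset.mem_univ, if_true]
    ring
  · simp only [hc, add_smul, smul_add, Finset.sum_add_distrib, ite_smul, zero_smul, smul_ite,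
      smul_zero, Finset.sum_ite_eq', Finset.mem_univ, if_true, if_false, hij.symm]
    match_scalars <;> field_simp <;> ring

/-- A simplex is cut into two by a point on an edge. -/
lemma hullOn_eq_union [Fintype ι] [DecidableEq ι] (P : ι → E) {J : Finset ι} {i j : ι}
    (hij : i ≠ j) (hi : i ∈ J) (hj : j ∈ J) {r : ℝ} (h0 : 0 < r) (h1 : r < 1) :
    hullOn P J = hullOn (Function.update P i ((1 - r) • P i + r • P j)) J ∪
      hullOn (Function.update P j ((1 - r) • P i + r • P j)) J := by
  have hc : (1 - r) • P i + r • P j ∈ hullOn P J :=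
    convex_hullOn P J (mem_hullOn_of_mem hi) (mem_hullOn_of_mem hj) (by linarith) h0.le (by ring)
  have hsub : ∀ l, hullOn (Function.update P l ((1 - r) • P i + r • P j)) J ⊆ hullOn P J := by
    intro l
    refine hullOn_subset (convex_hullOn P J) fun k hk => ?_
    by_cases h : k = l
    · subst h; simpa using hc
    · simpa [h] using mem_hullOn_of_mem hk
  refine Subset.antisymm (fun x hx => ?_) (union_subset (hsub i) (hsub j))
  obtain ⟨t, ht, htJ, hs, rfl⟩ := mem_hullOn.1 hx
  rcases le_total ((1 - r) * t j) (r * t i) with h | h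
  · exact Or.inr (mem_hullOn_update hij hi hj h0 ht htJ hs h)
  · left
    have := mem_hullOn_update (P := P) hij.symm hj hi (r := 1 - r) (by linarith) ht htJ hs
      (by linarith)
    rwa [sub_sub_cancel, add_comm] at this

/-- The functional l vanishes at the cut point and at all vertices other than P i and P j. So l ≤ 0
on the first piece and l ≥ 0 on the second; on the intersection l = 0, which forces the weight of P
j to be zero. -/
lemma hullOn_inter [Fintype ι] [DecidableEq ι] (P : ι → E) {J : Finset ι} {i j : ι}
    (hij : i ≠ j) (hj : j ∈ J) {r : ℝ} (h0 : 0 < r) (h1 : r < 1) (l : E →ₗ[ℝ] ℝ)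
    (hl : ∀ k, k ≠ i → k ≠ j → l (P k) = 0) (hli : l (P i) = r) (hlj : l (P j) = -(1 - r)) :
    hullOn (Function.update P i ((1 - r) • P i + r • P j)) J ∩
      hullOn (Function.update P j ((1 - r) • P i + r • P j)) J =
      hullOn (Function.update P i ((1 - r) • P i + r • P j)) (J.erase j) := by
  have hlc : l ((1 - r) • P i + r • P j) = 0 := by
    rw [map_add, map_smul, map_smul, hli, hlj, smul_eq_mul, smul_eq_mul]; ring
  refine Subset.antisymm ?_ ?_
  · rintro x ⟨hx1, hx2⟩
    obtain ⟨t, ht, htJ, hs, rfl⟩ := mem_hullOn.1 hx1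
    obtain ⟨s, hs', -, -, hsx⟩ := mem_hullOn.1 hx2
    have e1 : l (∑ k, t k • Function.update P i ((1 - r) • P i + r • P j) k) = t j * -(1 - r) := by
      rw [map_sum, Finset.sum_eq_single j]
      · rw [map_smul, Function.update_of_ne hij.symm, hlj, smul_eq_mul]
      · intro k _ hk
        rw [map_smul]
        by_cases hki : k = i
        · subst hki; simp [hlc]
        · rw [Function.update_of_ne hki, hl k hki hk, smul_zero]
      · simp
    have e2 : l (∑ k, s k • Function.update P j ((1 - r) • P i + r • P j) k) = s i * r := by
      rw [map_sum, Finset.sum_eq_single i]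
      · rw [map_smul, Function.update_of_ne hij, hli, smul_eq_mul]
      · intro k _ hk
        rw [map_smul]
        by_cases hkj : k = j
        · subst hkj; simp [hlc]
        · rw [Function.update_of_ne hkj, hl k hk hkj, smul_zero]
      · simp
    have htj : t j = 0 := by
      rw [hsx, e1] at e2
      nlinarith [ht j, hs' i, mul_nonneg (hs' i) h0.le, mul_nonneg (ht j) (sub_nonneg.2 h1.le)]
    refine mem_hullOn.2 ⟨t, ht, fun k hk => ?_, hs, rfl⟩
    by_cases h : k = j
    · rw [h, htj]
    · exact htJ k fun hkJ => hk (Finset.mem_erase.2 ⟨h, hkJ⟩)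
  · refine subset_inter (convexHull_mono (image_mono (by simp))) ?_
    refine hullOn_subset (convex_hullOn _ _) fun k hk => ?_
    obtain ⟨hkj, hkJ⟩ := Finset.mem_erase.1 hk
    by_cases hki : k = i
    · subst hki
      rw [Function.update_self]
      simpa using mem_hullOn_of_mem (P := Function.update P j ((1 - r) • P k + r • P j)) hj
    · rw [Function.update_of_ne hki]
      have := mem_hullOn_of_mem (P := Function.update P j ((1 - r) • P i + r • P j)) hkJ
      rwa [Function.update_of_ne hkj] at this

end hullOn

/-! ### Simplices with a frame of n vectors, and the action of SL(n). -/

section simplex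
variable {n : ℕ} {p : ℝ} {G : ConvexBody (Eucl n) → Eucl n → ℝ}

/-- The points `v i` together with the origin. -/
def withOrigin {n : ℕ} (v : Fin n → Eucl n) : Option (Fin n) → Eucl n := fun o => o.elim 0 v

@[simp] lemma withOrigin_none (v : Fin n → Eucl n) : withOrigin v none = 0 := rfl

@[simp] lemma withOrigin_some (v : Fin n → Eucl n) (i : Fin n) : withOrigin v (some i) = v i := rfl

lemma withOrigin_update (v : Fin n → Eucl n) (i : Fin n) (c : Eucl n) :
    withOrigin (Function.update v i c) = Function.update (withOrigin v) (some i) c := by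
  ext1 k
  rcases k with _ | k
  · simp
  · by_cases h : k = i
    · subst h; simp
    · simp [h]

/-- The determinant of `n` vectors. -/
noncomputable def vdet {n : ℕ} : Eucl n [⋀^Fin n]→ₗ[ℝ] ℝ :=
  Matrix.detRowAlternating.compLinearMap (WithLp.linearEquiv 2 ℝ (Fin n → ℝ)).toLinearMap

lemma vdet_apply (v : Fin n → Eucl n) : vdet v = (Matrix.of fun i j => v i j).det := rfl

/-- The standard basis. -/
noncomputable def stdv {n : ℕ} (i : Fin n) : Eucl n := EuclideanSpace.single i 1

lemma vdet_stdv : vdet (stdv (n := n)) = 1 := by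
  rw [vdet_apply]
  convert Matrix.det_one (R := ℝ) (n := Fin n)
  ext i j
  simp [stdv, Matrix.one_apply, eq_comm]

lemma inner_stdv (i : Fin n) (u : Eucl n) : inner ℝ (stdv i) u = u i := by
  simp [stdv, EuclideanSpace.inner_single_left]

lemma vdet_update_comb (v : Fin n → Eucl n) {i j : Fin n} (h : i ≠ j) (a b : ℝ) :
    vdet (Function.update v i (a • v i + b • v j)) = a * vdet v := by
  rw [AlternatingMap.map_update_add, AlternatingMap.map_update_smul,
    AlternatingMap.map_update_smul, Function.update_eq_self, AlternatingMap.map_update_self _ _ h,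
    smul_zero, add_zero, smul_eq_mul]

lemma vdet_update_smul (v : Fin n → Eucl n) (i : Fin n) (a : ℝ) :
    vdet (Function.update v i (a • v i)) = a * vdet v := by
  rw [AlternatingMap.map_update_smul, Function.update_eq_self, smul_eq_mul]

lemma inner_eq_mulVec (v : Fin n → Eucl n) (u : Eucl n) (i : Fin n) :
    (inner ℝ (v i) u : ℝ) = ((Matrix.of fun i j => v i j).mulVec u.ofLp) i := by
  rw [EuclideanSpace.inner_eq_star_dotProduct, dotProduct_comm]
  rfl

lemma exists_inner_eq {v : Fin n → Eucl n} (hv : vdet v ≠ 0) (a : Fin n → ℝ) :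
    ∃ u, ∀ i, inner ℝ (v i) u = a i := by
  have hd : IsUnit (Matrix.of fun i j => v i j).det := isUnit_iff_ne_zero.2 hv
  refine ⟨WithLp.toLp 2 ((Matrix.of fun i j => v i j)⁻¹.mulVec a), fun i => ?_⟩
  rw [inner_eq_mulVec, Matrix.mulVec_mulVec, Matrix.mul_nonsing_inv _ hd, Matrix.one_mulVec]

lemma eq_of_inner_eq {v : Fin n → Eucl n} (hv : vdet v ≠ 0) {u u' : Eucl n}
    (h : ∀ i, (inner ℝ (v i) u : ℝ) = inner ℝ (v i) u') : u = u' := by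
  have : (Matrix.of fun i j => v i j).mulVec u.ofLp = (Matrix.of fun i j => v i j).mulVec u'.ofLp :=
    funext fun i => by rw [← inner_eq_mulVec, ← inner_eq_mulVec, h]
  have hinj := Matrix.mulVec_injective_iff_isUnit.2
    ((Matrix.isUnit_iff_isUnit_det _).2 (isUnit_iff_ne_zero.2 hv))
  exact WithLp.ofLp_injective 2 (hinj this)

lemma exists_sl {v w : Fin n → Eucl n} (hv : vdet v ≠ 0) (h : vdet w = vdet v) :
    ∃ φ : Matrix.SpecialLinearGroup (Fin n) ℝ,
      ∀ i, Matrix.toEuclideanCLM (𝕜 := ℝ) φ.1 (v i) = w i := by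
  set V : Matrix (Fin n) (Fin n) ℝ := Matrix.of fun i j => v i j with hV
  set W : Matrix (Fin n) (Fin n) ℝ := Matrix.of fun i j => w i j with hW
  have hVd : IsUnit V.transpose.det := by
    rw [Matrix.det_transpose]; exact isUnit_iff_ne_zero.2 hv
  refine ⟨⟨W.transpose * V.transpose⁻¹, ?_⟩, fun i => ?_⟩
  · rw [Matrix.det_mul, Matrix.det_nonsing_inv, Matrix.det_transpose,
      show W.det = V.det from h, ← Matrix.det_transpose V, Ring.mul_inverse_cancel _ hVd]
  · have e1 : (v i).ofLp = V.transpose.mulVec (Pi.single i 1) := by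
      rw [Matrix.mulVec_single_one]; rfl
    have e2 : (w i).ofLp = W.transpose.mulVec (Pi.single i 1) := by
      rw [Matrix.mulVec_single_one]; rfl
    refine WithLp.ofLp_injective 2 ?_
    rw [Matrix.ofLp_toEuclideanCLM, e1, e2, Matrix.mulVec_mulVec]
    simp only [Matrix.mul_assoc, Matrix.nonsing_inv_mul _ hVd, Matrix.mul_one]

/-- The value of `G` on the simplex with vertices `v i`, `some i ∈ J`, and `0` if `none ∈ J`. -/
noncomputable def simplexVal {n : ℕ} (G : ConvexBody (Eucl n) → Eucl n → ℝ)
    (J : Finset (Option (Fin n))) (v : Fin n → Eucl n) (u : Eucl n) : ℝ :=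
  evalSet G (hullOn (withOrigin v) J) u

lemma simplexVal_congr {J : Finset (Option (Fin n))} {v w : Fin n → Eucl n}
    (h : ∀ i, some i ∈ J → v i = w i) (u : Eucl n) : simplexVal G J v u = simplexVal G J w u := by
  unfold simplexVal
  rw [hullOn_congr]
  rintro (_ | i) hk
  · rfl
  · exact h i hk

lemma simplexVal_update {J : Finset (Option (Fin n))} {v : Fin n → Eucl n} {i : Fin n}
    (hi : some i ∉ J) (c u : Eucl n) :
    simplexVal G J (Function.update v i c) u = simplexVal G J v u :=
  simplexVal_congr (fun k hk => Function.update_of_ne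
    (fun h : k = i => hi (by rw [← h]; exact hk)) c v) u

lemma simplexVal_empty (v : Fin n → Eucl n) (u : Eucl n) : simplexVal G ∅ v u = 0 := by
  simp [simplexVal, hullOn, evalSet_empty]

/-- Two frames of equal nonzero determinant differ by an element of SL(n), and a direction is
determined by its inner products with a frame. So the value depends only on the determinant and the
inner products. -/
lemma simplexVal_eq_of_vdet_eq (hG : IsLpVal p G) (J : Finset (Option (Fin n)))
    {v w : Fin n → Eucl n} (hv : vdet v ≠ 0) (h : vdet w = vdet v) {u u' : Eucl n}
    (hu : ∀ i, (inner ℝ (v i) u : ℝ) = inner ℝ (w i) u') :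
    simplexVal G J v u = simplexVal G J w u' := by
  obtain ⟨φ, hφ⟩ := exists_sl hv h
  obtain ⟨u'', hu''⟩ := exists_adjoint φ.1 u'
  have : u'' = u := eq_of_inner_eq hv fun i => by rw [← hu'', hφ, hu]
  subst this
  rw [simplexVal, simplexVal, ← evalSet_image hG φ (convex_hullOn _ _) (isCompact_hullOn _ _) hu'']
  congr 1
  rw [hullOn, hullOn]
  have := (Matrix.toEuclideanCLM (𝕜 := ℝ) φ.1).toLinearMap.image_convexHull
    (withOrigin v '' (J : Set (Option (Fin n))))
  refine Eq.trans this ?_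
  rw [image_image]
  congr 1
  refine image_congr fun k _ => ?_
  rcases k with _ | i
  · exact map_zero _
  · exact hφ i

lemma simplexVal_continuous_dir (hG : IsLpVal p G) (J : Finset (Option (Fin n)))
    (v : Fin n → Eucl n) : Continuous fun u => simplexVal G J v u :=
  evalSet_continuous_dir hG _

lemma simplexVal_homog (hG : IsLpVal p G) (J : Finset (Option (Fin n)))
    (v : Fin n → Eucl n) (u : Eucl n) {t : ℝ} (ht : 0 < t) :
    simplexVal G J v (t • u) = t ^ p * simplexVal G J v u :=
  evalSet_homog hG _ u ht

lemma suppFun_hullOn {ι : Type*} (P : ι → Eucl n) {J : Finset ι} (hJ : J.Nonempty) (u : Eucl n) :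
    suppFun ⟨hullOn P J, convex_hullOn P J, isCompact_hullOn P J, hullOn_nonempty P hJ⟩ u =
      J.sup' hJ fun k => inner ℝ (P k) u := by
  refine le_antisymm (suppFun_le fun x hx => ?_) (Finset.sup'_le _ _ fun k hk =>
    inner_le_suppFun (mem_hullOn_of_mem hk) u)
  have hc : Convex ℝ {x : Eucl n | inner ℝ x u ≤ J.sup' hJ fun k => (inner ℝ (P k) u : ℝ)} :=
    convex_halfSpace_le ⟨fun x y => inner_add_left x y u, fun c x => real_inner_smul_left x u c⟩ _
  exact hullOn_subset hc (fun k hk => Finset.le_sup' (fun k => (inner ℝ (P k) u : ℝ)) hk) hx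

lemma evalSet_hullOn_continuous (hG : IsLpVal p G) {ι X : Type*} [TopologicalSpace X]
    {P : X → ι → Eucl n} (J : Finset ι) (hP : ∀ k ∈ J, Continuous fun x => P x k) (u : Eucl n) :
    Continuous fun x => evalSet G (hullOn (P x) J) u := by
  rcases J.eq_empty_or_nonempty with rfl | hJ
  · simp only [hullOn, Finset.coe_empty, image_empty, convexHull_empty, evalSet_empty]
    exact continuous_const
  · have : ∀ x, evalSet G (hullOn (P x) J) u = G ⟨hullOn (P x) J, convex_hullOn _ J,
        isCompact_hullOn _ J, hullOn_nonempty _ hJ⟩ u := fun x => evalSet_mk _ _ _ u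
    simp only [this]
    refine (hG.cont_body u).comp (continuous_of_suppFun ?_)
    simp only [suppFun_hullOn _ hJ]
    refine Continuous.finset_sup'_apply hJ fun k hk => ?_
    exact ((hP k hk).comp continuous_fst).inner continuous_snd

/-- A simplex is cut into two simplices by a point of an edge, with a common face. -/
lemma hullOn_withOrigin_cut {v : Fin n → Eucl n} (hv : vdet v ≠ 0) {J : Finset (Option (Fin n))}
    {i j : Fin n} (hij : i ≠ j) (hi : some i ∈ J) (hj : some j ∈ J) {r : ℝ} (h0 : 0 < r)
    (h1 : r < 1) :
    hullOn (withOrigin v) J =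
      hullOn (withOrigin (Function.update v i ((1 - r) • v i + r • v j))) J ∪
      hullOn (withOrigin (Function.update v j ((1 - r) • v i + r • v j))) J ∧
    hullOn (withOrigin (Function.update v i ((1 - r) • v i + r • v j))) (J.erase (some j)) =
      hullOn (withOrigin (Function.update v i ((1 - r) • v i + r • v j))) J ∩
      hullOn (withOrigin (Function.update v j ((1 - r) • v i + r • v j))) J := by
  have hij' : some i ≠ some j := fun h => hij (Option.some_injective _ h)
  rw [withOrigin_update, withOrigin_update]
  refine ⟨hullOn_eq_union (withOrigin v) hij' hi hj h0 h1, ?_⟩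
  -- The hyperplane orthogonal to w contains the origin, the cut point and all vectors of the frame
  -- except v i and v j.
  obtain ⟨w, hw⟩ := exists_inner_eq hv (fun k => if k = i then r else if k = j then -(1 - r) else 0)
  replace hw : ∀ k, (innerₗ (Eucl n) w) (v k) =
      if k = i then r else if k = j then -(1 - r) else 0 := fun k => by
    rw [innerₗ_apply_apply, real_inner_comm, hw]
  refine (hullOn_inter (withOrigin v) hij' hj h0 h1 (innerₗ (Eucl n) w) ?_ ?_ ?_).symm
  · rintro (_ | k) h1 h2
    · exact map_zero _
    · have h1' : k ≠ i := fun h => h1 (h ▸ rfl)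
      have h2' : k ≠ j := fun h => h2 (h ▸ rfl)
      simp [hw, h1', h2']
  · simp [hw]
  · simp [hw, hij.symm]

lemma simplexVal_cut (hG : IsLpVal p G) {v : Fin n → Eucl n} (hv : vdet v ≠ 0)
    {J : Finset (Option (Fin n))}
    {i j : Fin n} (hij : i ≠ j) (hi : some i ∈ J) (hj : some j ∈ J) {r : ℝ} (h0 : 0 < r)
    (h1 : r < 1) (u : Eucl n) :
    simplexVal G J v u +
      simplexVal G (J.erase (some j)) (Function.update v i ((1 - r) • v i + r • v j)) u =
    simplexVal G J (Function.update v i ((1 - r) • v i + r • v j)) u +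
      simplexVal G J (Function.update v j ((1 - r) • v i + r • v j)) u := by
  obtain ⟨hU, hI⟩ := hullOn_withOrigin_cut hv hij hi hj h0 h1
  rw [simplexVal, simplexVal, hU, hI]
  exact evalSet_union hG (convex_hullOn _ _) (isCompact_hullOn _ _) (convex_hullOn _ _)
    (isCompact_hullOn _ _) (hU ▸ convex_hullOn _ _) u

end simplex

/-! ### Simplices with fewer than n vertices besides the origin. -/

section lowdim
variable {n : ℕ} {p : ℝ} {G : ConvexBody (Eucl n) → Eucl n → ℝ}

/-- Since v i is not a vertex, it may be replaced by v i + α v j: neither the simplex nor the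
determinant changes, and ⟨v i, u⟩ takes any value as long as ⟨v j, u⟩ ≠ 0. -/
lemma simplexVal_eq_of_inner_eq_of_ne (hn : 2 ≤ n) (hG : IsLpVal p G)
    {J : Finset (Option (Fin n))} {i : Fin n} (hi : some i ∉ J) {v : Fin n → Eucl n}
    (hv : vdet v ≠ 0) {u u' : Eucl n}
    (h : ∀ j, j ≠ i → (inner ℝ (v j) u : ℝ) = inner ℝ (v j) u') :
    simplexVal G J v u = simplexVal G J v u' := by
  have key : ∀ u u' : Eucl n, (∀ j, j ≠ i → (inner ℝ (v j) u : ℝ) = inner ℝ (v j) u') →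
      ∀ j, j ≠ i → (inner ℝ (v j) u : ℝ) ≠ 0 → simplexVal G J v u = simplexVal G J v u' := by
    intro u u' h j hj h0
    set α : ℝ := (inner ℝ (v i) u - inner ℝ (v i) u') / inner ℝ (v j) u with hα
    rw [← simplexVal_update hi ((1 : ℝ) • v i + α • v j) u']
    refine simplexVal_eq_of_vdet_eq hG J hv (by rw [vdet_update_comb v hj.symm, one_mul])
      fun k => ?_
    by_cases hk : k = i
    · subst hk
      rw [Function.update_self, inner_add_left, real_inner_smul_left, real_inner_smul_left,
        ← h j hj, hα, div_mul_cancel₀ _ h0]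
      ring
    · rw [Function.update_of_ne hk, h k hk]
  obtain ⟨j, hj⟩ : ∃ j, j ≠ i := by
    have : Nontrivial (Fin n) := Fin.nontrivial_iff_two_le.2 hn
    exact exists_ne i
  -- Moving u along the vector dual to v j makes ⟨v j, u⟩ nonzero for all but one ε; continuity in
  -- the direction covers the excluded value.
  obtain ⟨w, hw⟩ := exists_inner_eq hv (fun k => if k = j then 1 else 0)
  have hc : ∀ u : Eucl n, Continuous fun ε : ℝ => simplexVal G J v (u + ε • w) := fun u =>
    (simplexVal_continuous_dir hG J v).comp (by fun_prop)
  have hd : Dense ({-inner ℝ (v j) u}ᶜ : Set ℝ) := dense_compl_singleton _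
  have := Continuous.ext_on hd (hc u) (hc u') fun ε hε => key _ _ (fun k hk => by
    rw [inner_add_right, inner_add_right, h k hk]) j hj (by
      rw [inner_add_right, real_inner_smul_right, hw, if_pos rfl, mul_one]
      intro h0
      exact hε (by rw [mem_singleton_iff]; linarith))
  simpa using congrFun this 0

/-- On simplices of lower dimension, `simplexVal` depends only on the inner products of the
vertices with `u`. -/
lemma simplexVal_eq_of_inner_eq (hn : 2 ≤ n) (hG : IsLpVal p G)
    {J : Finset (Option (Fin n))} {i : Fin n} (hi : some i ∉ J) {v w : Fin n → Eucl n}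
    (hv : vdet v ≠ 0) (hw : vdet w ≠ 0) {u u' : Eucl n}
    (h : ∀ j, some j ∈ J → (inner ℝ (v j) u : ℝ) = inner ℝ (w j) u') :
    simplexVal G J v u = simplexVal G J w u' := by
  have step : ∀ D : Finset (Fin n), (∀ k ∈ D, some k ∉ J) → ∀ u u' : Eucl n,
      (∀ k, k ∉ D → (inner ℝ (w k) u : ℝ) = inner ℝ (w k) u') →
      simplexVal G J w u = simplexVal G J w u' := by
    intro D
    induction D using Finset.induction_on with
    | empty =>
      intro _ u u' h
      rw [eq_of_inner_eq hw fun k => h k (Finset.notMem_empty k)]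
    | insert k D hkD ih =>
      intro hD u u' h
      obtain ⟨u₁, hu₁⟩ := exists_inner_eq hw
        (fun l => if l = k then inner ℝ (w l) u' else inner ℝ (w l) u)
      rw [simplexVal_eq_of_inner_eq_of_ne hn hG (hD k (Finset.mem_insert_self k D)) hw
        (u := u) (u' := u₁) fun l hl => by rw [hu₁, if_neg hl]]
      refine ih (fun l hl => hD l (Finset.mem_insert_of_mem hl)) _ _ fun l hl => ?_
      rw [hu₁]
      split_ifs with hlk
      · rfl
      · exact h l fun hl' => (Finset.mem_insert.1 hl').elim hlk hl
  obtain ⟨u₁, hu₁⟩ := exists_inner_eq hv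
    (fun k => if k = i then (vdet v / vdet w)⁻¹ * inner ℝ (v i) u else inner ℝ (v k) u)
  -- The vector w i is not a vertex, so rescaling it adjusts the determinant without changing the
  -- simplex.
  set w' := Function.update w i ((vdet v / vdet w) • w i) with hw'
  have hdw' : vdet w' = vdet v := by rw [hw', vdet_update_smul, div_mul_cancel₀ _ hw]
  obtain ⟨u₂, hu₂⟩ := exists_inner_eq (v := w') (by rwa [hdw']) (fun k => inner ℝ (v k) u)
  rw [simplexVal_eq_of_vdet_eq hG J hv hdw' (u' := u₂) fun k => (hu₂ k).symm, hw',
    simplexVal_update hi]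
  refine step (Finset.univ.filter fun k => some k ∉ J) (fun k hk => (Finset.mem_filter.1 hk).2)
    _ _ fun k hk => ?_
  have hkJ : some k ∈ J := by simpa using hk
  have hki : k ≠ i := fun h => hi (h ▸ hkJ)
  rw [← h k hkJ, ← hu₂, hw', Function.update_of_ne hki]

/-- `simplexVal` at the standard basis. -/
noncomputable def stdVal {n : ℕ} (G : ConvexBody (Eucl n) → Eucl n → ℝ)
    (J : Finset (Option (Fin n))) (a : Fin n → ℝ) : ℝ :=
  simplexVal G J stdv (WithLp.toLp 2 a)

lemma simplexVal_eq_stdVal (hn : 2 ≤ n) (hG : IsLpVal p G)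
    {J : Finset (Option (Fin n))} {i : Fin n} (hi : some i ∉ J) {v : Fin n → Eucl n}
    (hv : vdet v ≠ 0) {u : Eucl n} {a : Fin n → ℝ}
    (h : ∀ j, some j ∈ J → (inner ℝ (v j) u : ℝ) = a j) :
    simplexVal G J v u = stdVal G J a :=
  simplexVal_eq_of_inner_eq hn hG hi hv (by rw [vdet_stdv]; exact one_ne_zero) fun j hj => by
    rw [h j hj, inner_stdv]

lemma inner_update_comb {v : Fin n → Eucl n} {u : Eucl n} {a : Fin n → ℝ}
    (h : ∀ k, inner ℝ (v k) u = a k) (i j l : Fin n) (r : ℝ) (k : Fin n) :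
    inner ℝ (Function.update v l ((1 - r) • v i + r • v j) k) u =
      Function.update a l ((1 - r) * a i + r * a j) k := by
  by_cases hk : k = l
  · subst hk
    rw [Function.update_self, Function.update_self, inner_add_left, real_inner_smul_left,
      real_inner_smul_left, h, h]
  · rw [Function.update_of_ne hk, Function.update_of_ne hk, h]

lemma vdet_update_left (v : Fin n → Eucl n) {i j : Fin n} (hij : i ≠ j) (r : ℝ) :
    vdet (Function.update v i ((1 - r) • v i + r • v j)) = (1 - r) * vdet v :=
  vdet_update_comb v hij _ _

lemma vdet_update_right (v : Fin n → Eucl n) {i j : Fin n} (hij : i ≠ j) (r : ℝ) :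
    vdet (Function.update v j ((1 - r) • v i + r • v j)) = r * vdet v := by
  rw [add_comm, vdet_update_comb v hij.symm]

lemma exists_convex_comb {x y z : ℝ} (h : (x < z ∧ z < y) ∨ (y < z ∧ z < x)) :
    ∃ r : ℝ, 0 < r ∧ r < 1 ∧ (1 - r) * x + r * y = z := by
  have hxy : y - x ≠ 0 := by
    rcases h with h | h
    · exact sub_ne_zero.2 (h.1.trans h.2).ne'
    · exact sub_ne_zero.2 (h.1.trans h.2).ne
  refine ⟨(z - x) / (y - x), ?_, ?_, by field_simp; ring⟩
  · rcases h with h | h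
    · exact div_pos (by linarith) (by linarith)
    · exact div_pos_of_neg_of_neg (by linarith) (by linarith)
  · rcases h with h | h
    · rw [div_lt_one (by linarith)]; linarith
    · rw [div_lt_one_of_neg (by linarith)]; linarith

/-- The two pieces have different determinants, but this does not matter because some vector of the
frame is not a vertex. The common face drops out by `h0`. -/
lemma stdVal_cut (hn : 2 ≤ n) (hG : IsLpVal p G) {J : Finset (Option (Fin n))} {k : Fin n}
    (hk : some k ∉ J) {i j : Fin n} (hij : i ≠ j) (hi : some i ∈ J) (hj : some j ∈ J)
    (h0 : ∀ a, stdVal G (J.erase (some j)) a = 0) {r : ℝ} (hr : 0 < r) (hr1 : r < 1)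
    (a : Fin n → ℝ) :
    stdVal G J a = stdVal G J (Function.update a i ((1 - r) * a i + r * a j)) +
      stdVal G J (Function.update a j ((1 - r) * a i + r * a j)) := by
  have hd : vdet (stdv (n := n)) ≠ 0 := by rw [vdet_stdv]; exact one_ne_zero
  have ha : ∀ k, inner ℝ (stdv k) (WithLp.toLp 2 a) = a k := fun k => inner_stdv k _
  have hc := simplexVal_cut hG hd hij hi hj hr hr1 (WithLp.toLp 2 a)
  have hdi : vdet (Function.update (stdv (n := n)) i ((1 - r) • stdv i + r • stdv j)) ≠ 0 := by
    rw [vdet_update_left _ hij]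
    exact mul_ne_zero (by linarith) hd
  have hdj : vdet (Function.update (stdv (n := n)) j ((1 - r) • stdv i + r • stdv j)) ≠ 0 := by
    rw [vdet_update_right _ hij]
    exact mul_ne_zero hr.ne' hd
  rw [simplexVal_eq_stdVal hn hG hk hdi fun l _ => inner_update_comb ha i j i r l,
    simplexVal_eq_stdVal hn hG hk hdj fun l _ => inner_update_comb ha i j j r l,
    simplexVal_eq_stdVal hn hG (i := k) (fun h => hk (Finset.mem_of_mem_erase h)) hdi
      fun l _ => inner_update_comb ha i j i r l, h0, add_zero] at hc
  exact hc

lemma stdVal_cut_at (hn : 2 ≤ n) (hG : IsLpVal p G) {J : Finset (Option (Fin n))} {k : Fin n}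
    (hk : some k ∉ J) {i j : Fin n} (hij : i ≠ j) (hi : some i ∈ J) (hj : some j ∈ J)
    (h0 : ∀ a, stdVal G (J.erase (some j)) a = 0)
    (a : Fin n → ℝ) {x : ℝ} (hx : (a i < x ∧ x < a j) ∨ (a j < x ∧ x < a i)) :
    stdVal G J a = stdVal G J (Function.update a i x) + stdVal G J (Function.update a j x) := by
  obtain ⟨r, hr, hr1, rfl⟩ := exists_convex_comb hx
  exact stdVal_cut hn hG hk hij hi hj h0 hr hr1 a

/-- If a i = a j, a midpoint cut changes no inner product, so the value equals twice itself. -/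
lemma stdVal_eq_zero_of_eq (hn : 2 ≤ n) (hG : IsLpVal p G) {J : Finset (Option (Fin n))}
    {k : Fin n} (hk : some k ∉ J) {i j : Fin n} (hij : i ≠ j) (hi : some i ∈ J) (hj : some j ∈ J)
    (h0 : ∀ a, stdVal G (J.erase (some j)) a = 0) {a : Fin n → ℝ} (ha : a i = a j) :
    stdVal G J a = 0 := by
  have := stdVal_cut hn hG hk hij hi hj h0 (r := 1 / 2) (by norm_num) (by norm_num) a
  rw [← ha, show (1 - 1 / 2) * a i + 1 / 2 * a i = a i by ring, Function.update_eq_self, ha,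
    Function.update_eq_self] at this
  linarith

/-- The inductive step for simplices with at least three vertices other than the origin. -/
lemma stdVal_eq_zero_of_three (hn : 2 ≤ n) (hG : IsLpVal p G) {J : Finset (Option (Fin n))}
    {k : Fin n} (hk : some k ∉ J) (h0 : ∀ j a, some j ∈ J → stdVal G (J.erase (some j)) a = 0)
    {i j l : Fin n} (hij : i ≠ j) (hjl : j ≠ l) (hil : i ≠ l) (hi : some i ∈ J) (hj : some j ∈ J)
    (hl : some l ∈ J) {a : Fin n → ℝ} (h1 : a i ≤ a j) (h2 : a j ≤ a l) : stdVal G J a = 0 := by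
  rcases h1.eq_or_lt with h1 | h1
  · exact stdVal_eq_zero_of_eq hn hG hk hij hi hj (fun a => h0 j a hj) h1
  rcases h2.eq_or_lt with h2 | h2
  · exact stdVal_eq_zero_of_eq hn hG hk hjl hj hl (fun a => h0 l a hl) h2
  -- The entries of b at i and j agree, so its value is zero. Cutting the edge from j to l at height
  -- a j splits b into a itself and a vector whose entries at i and j still agree.
  set b := Function.update a j (a i) with hb
  have e1 : stdVal G J b = 0 := stdVal_eq_zero_of_eq hn hG hk hij hi hj (fun a => h0 j a hj) (by
    rw [hb, Function.update_of_ne hij, Function.update_self])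
  have e2 := stdVal_cut_at hn hG hk hjl hj hl (fun a => h0 l a hl) b (x := a j) (Or.inl (by
    rw [hb, Function.update_self, Function.update_of_ne hjl.symm]; exact ⟨h1, h2⟩))
  have e3 : stdVal G J (Function.update b l (a j)) = 0 :=
    stdVal_eq_zero_of_eq hn hG hk hij hi hj (fun a => h0 j a hj) (by
      rw [Function.update_of_ne hil, Function.update_of_ne hjl, hb, Function.update_of_ne hij,
        Function.update_self])
  rw [e1, e3, hb, Function.update_idem, Function.update_eq_self] at e2
  linarith

/-- If one of the inner products vanishes, the vertex can be contracted to the origin. -/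
lemma stdVal_eq_of_eq_zero (hn : 2 ≤ n) (hG : IsLpVal p G) {J : Finset (Option (Fin n))}
    {k : Fin n} (hk : some k ∉ J) {j : Fin n} (hj : some j ∈ J) {a : Fin n → ℝ} (ha : a j = 0) :
    stdVal G J a = stdVal G (insert none (J.erase (some j))) a := by
  -- Scaling vertex j by ε ≠ 0 changes no inner product, as the one at j is 0, so the value is
  -- constant in ε. At ε = 0 the vertex has become the origin.
  have hc : Continuous fun ε : ℝ => simplexVal G J (Function.update stdv j (ε • stdv j))
      (WithLp.toLp 2 a) := by
    refine evalSet_hullOn_continuous hG J (fun l _ => ?_) _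
    rcases l with _ | l
    · exact continuous_const
    · by_cases h : l = j
      · subst h
        simp only [withOrigin_some, Function.update_self]
        fun_prop
      · simp only [withOrigin_some, Function.update_of_ne h]
        fun_prop
  have hd : Dense ({0}ᶜ : Set ℝ) := dense_compl_singleton _
  have := Continuous.ext_on hd hc (continuous_const (y := stdVal G J a)) fun ε hε => by
    refine simplexVal_eq_stdVal hn hG hk ?_ fun l _ => ?_
    · rw [vdet_update_smul, vdet_stdv, mul_one]; exact hε
    · by_cases h : l = j
      · subst h
        rw [Function.update_self, real_inner_smul_left, inner_stdv, ha]
        simp [ha]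
      · rw [Function.update_of_ne h, inner_stdv]
  rw [← congrFun this 0, stdVal, simplexVal, simplexVal]
  congr 1
  unfold hullOn
  congr 1
  ext x
  simp only [mem_image, Finset.mem_coe]
  constructor
  · rintro ⟨l, hl, rfl⟩
    rcases l with _ | l
    · exact ⟨none, by simp, rfl⟩
    · by_cases h : l = j
      · subst h
        exact ⟨none, by simp, by simp⟩
      · exact ⟨some l, by simp [h, hl], by simp [h]⟩
  · rintro ⟨l, hl, rfl⟩
    rcases l with _ | l
    · exact ⟨some j, hj, by simp⟩
    · have hlj : l ≠ j := fun h => by simp [h] at hl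
      exact ⟨some l, by simpa [hlj] using hl, by simp [hlj]⟩

lemma stdVal_homog (hG : IsLpVal p G) (J : Finset (Option (Fin n))) (a : Fin n → ℝ) {t : ℝ}
    (ht : 0 < t) : stdVal G J (t • a) = t ^ p * stdVal G J a := by
  rw [stdVal, WithLp.toLp_smul, simplexVal_homog hG J _ _ ht]
  rfl

/-- `G` vanishes on `{0}`. -/
lemma stdVal_singleton_none (hn : 2 ≤ n) (hp : 0 < p) (hG : IsLpVal p G) (a : Fin n → ℝ) :
    stdVal G {none} a = 0 := by
  -- The value on {0} does not depend on the direction, and yet it is multiplied by 2 ^ p when the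
  -- direction is doubled.
  have h1 := stdVal_homog hG {none} a (t := 2) two_pos
  have h2 : stdVal G {none} ((2 : ℝ) • a) = stdVal G {none} a :=
    simplexVal_eq_stdVal hn hG (i := ⟨0, by omega⟩) (by simp)
      (by rw [vdet_stdv]; exact one_ne_zero) (by simp)
  have h3 : (1 : ℝ) < 2 ^ p := Real.one_lt_rpow one_lt_two hp
  rw [h2] at h1
  have : (2 ^ p - 1) * stdVal G {none} a = 0 := by linarith
  exact (mul_eq_zero.1 this).resolve_left (by linarith)

/-- The case of one vertex other than the origin. -/
lemma stdVal_eq_zero_of_one (hn : 2 ≤ n) (hp : 0 < p) (hG : IsLpVal p G) (i₀ : Fin n)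
    {J₀ : Finset (Option (Fin n))} (hJ : J₀ = {some i₀} ∨ J₀ = {none, some i₀})
    (ht : ∀ s : ℝ, (s = 1 ∨ s = -1) → stdVal G J₀ (fun _ => s) = 0) (a : Fin n → ℝ) :
    stdVal G J₀ a = 0 := by
  have : Nontrivial (Fin n) := Fin.nontrivial_iff_two_le.2 hn
  obtain ⟨k, hk⟩ := exists_ne i₀
  have hkJ : some k ∉ J₀ := by rcases hJ with rfl | rfl <;> simp [hk]
  have hdep : ∀ a b : Fin n → ℝ, a i₀ = b i₀ → stdVal G J₀ a = stdVal G J₀ b := fun a b hab =>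
    simplexVal_eq_stdVal hn hG hkJ (by rw [vdet_stdv]; exact one_ne_zero) fun j hj => by
      have : j = i₀ := by rcases hJ with rfl | rfl <;> simpa using hj
      rw [this, inner_stdv, ← hab]
  rcases lt_trichotomy (a i₀) 0 with h | h | h
  · rw [hdep a ((-a i₀) • fun _ => (-1 : ℝ)) (by simp), stdVal_homog hG _ _ (by linarith),
      ht _ (Or.inr rfl), mul_zero]
  · have h1 := hdep a ((2 : ℝ) • a) (by simp [h])
    rw [stdVal_homog hG _ _ two_pos] at h1
    have h3 : (1 : ℝ) < 2 ^ p := Real.one_lt_rpow one_lt_two hp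
    have : (2 ^ p - 1) * stdVal G J₀ a = 0 := by linarith
    exact (mul_eq_zero.1 this).resolve_left (by linarith)
  · rw [hdep a ((a i₀) • fun _ => (1 : ℝ)) (by simp), stdVal_homog hG _ _ h,
      ht _ (Or.inl rfl), mul_zero]

end lowdim

section lowdim
variable {n : ℕ} {p : ℝ} {G : ConvexBody (Eucl n) → Eucl n → ℝ}

lemma simplexVal_comp_perm (σ : Equiv.Perm (Fin n)) (J : Finset (Option (Fin n)))
    (v : Fin n → Eucl n) (u : Eucl n) :
    simplexVal G J (v ∘ σ) u = simplexVal G (J.map (Equiv.optionCongr σ).toEmbedding) v u := by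
  rw [simplexVal, simplexVal, hullOn, hullOn, Finset.coe_map, image_image]
  congr 2
  refine image_congr fun k _ => ?_
  rcases k with _ | k <;> rfl

lemma vdet_comp_perm_ne_zero {v : Fin n → Eucl n} (hv : vdet v ≠ 0) (σ : Equiv.Perm (Fin n)) :
    vdet (v ∘ σ) ≠ 0 := by
  rw [AlternatingMap.map_perm]
  rcases Int.units_eq_one_or (Equiv.Perm.sign σ) with h | h <;> simp [h, hv]

/-- The case of two vertices other than the origin. -/
lemma stdVal_eq_zero_of_two (hn : 2 ≤ n) (hG : IsLpVal p G) {J : Finset (Option (Fin n))}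
    {k : Fin n} (hk : some k ∉ J) (h0 : ∀ j a, some j ∈ J → stdVal G (J.erase (some j)) a = 0)
    {i j : Fin n} (hij : i ≠ j) (hi : some i ∈ J) (hj : some j ∈ J)
    (hi0 : ∀ a : Fin n → ℝ, a i = 0 → stdVal G J a = 0)
    (hj0 : ∀ a : Fin n → ℝ, a j = 0 → stdVal G J a = 0) (a : Fin n → ℝ) : stdVal G J a = 0 := by
  have key : ∀ {i j : Fin n}, i ≠ j → some i ∈ J → some j ∈ J →
      (∀ a : Fin n → ℝ, a i = 0 → stdVal G J a = 0) →
      ((0 < a i ∧ a i < a j) ∨ (a j < a i ∧ a i < 0)) → stdVal G J a = 0 := by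
    intro i j hij hi hj hi0 h
    -- Since a i lies strictly between 0 and a j, the vector with i-th entry 0 can be cut at height
    -- a i. One piece is a; the other has i-th entry 0 again.
    have := stdVal_cut_at hn hG hk hij hi hj (fun a => h0 j a hj) (Function.update a i 0) (x := a i)
      (by rwa [Function.update_self, Function.update_of_ne hij.symm])
    rw [Function.update_idem, Function.update_eq_self,
      hi0 (Function.update a i 0) (Function.update_self ..),
      hi0 (Function.update (Function.update a i 0) j (a i))
        (by rw [Function.update_of_ne hij, Function.update_self])] at this
    linarith
  have opp : ((a i < 0 ∧ 0 < a j) ∨ (a j < 0 ∧ 0 < a i)) → stdVal G J a = 0 := by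
    intro h
    rw [stdVal_cut_at hn hG hk hij hi hj (fun a => h0 j a hj) a h, hi0 _ (Function.update_self ..),
      hj0 _ (Function.update_self ..), add_zero]
  rcases lt_trichotomy (a i) 0 with h1 | h1 | h1
  · rcases lt_trichotomy (a j) 0 with h2 | h2 | h2
    · rcases lt_trichotomy (a i) (a j) with h | h | h
      · exact key hij.symm hj hi hj0 (Or.inr ⟨h, h2⟩)
      · exact stdVal_eq_zero_of_eq hn hG hk hij hi hj (fun a => h0 j a hj) h
      · exact key hij hi hj hi0 (Or.inr ⟨h, h1⟩)
    · exact hj0 a h2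
    · exact opp (Or.inl ⟨h1, h2⟩)
  · exact hi0 a h1
  · rcases lt_trichotomy (a j) 0 with h2 | h2 | h2
    · exact opp (Or.inr ⟨h2, h1⟩)
    · exact hj0 a h2
    · rcases lt_trichotomy (a i) (a j) with h | h | h
      · exact key hij hi hj hi0 (Or.inl ⟨h1, h⟩)
      · exact stdVal_eq_zero_of_eq hn hG hk hij hi hj (fun a => h0 j a hj) h
      · exact key hij.symm hj hi hj0 (Or.inl ⟨h2, h⟩)

lemma stdVal_eq_zero_of_single (hn : 2 ≤ n) (hp : 0 < p) (hG : IsLpVal p G) {i₀ : Fin n}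
    (h₁ : ∀ s : ℝ, (s = 1 ∨ s = -1) → stdVal G {some i₀} (fun _ => s) = 0)
    (h₂ : ∀ s : ℝ, (s = 1 ∨ s = -1) → stdVal G {none, some i₀} (fun _ => s) = 0) (i : Fin n)
    (a : Fin n → ℝ) : stdVal G {some i} a = 0 ∧ stdVal G {none, some i} a = 0 := by
  have : Nontrivial (Fin n) := Fin.nontrivial_iff_two_le.2 hn
  obtain ⟨k, hk⟩ := exists_ne i₀
  have hd : vdet (stdv (n := n)) ≠ 0 := by rw [vdet_stdv]; exact one_ne_zero
  have key : ∀ J₀ : Finset (Option (Fin n)), (J₀ = {some i₀} ∨ J₀ = {none, some i₀}) →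
      (∀ s : ℝ, (s = 1 ∨ s = -1) → stdVal G J₀ (fun _ => s) = 0) →
      stdVal G (J₀.map (Equiv.optionCongr (Equiv.swap i i₀)).toEmbedding) a = 0 := by
    intro J₀ hJ ht
    have hkJ : some k ∉ J₀ := by rcases hJ with rfl | rfl <;> simp [hk]
    rw [stdVal, ← simplexVal_comp_perm, simplexVal_eq_stdVal hn hG hkJ
      (vdet_comp_perm_ne_zero hd _) (a := a ∘ Equiv.swap i i₀) fun j _ => by
        rw [Function.comp_apply, inner_stdv]; rfl]
    exact stdVal_eq_zero_of_one hn hp hG i₀ hJ ht _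
  constructor
  · simpa using key _ (Or.inl rfl) h₁
  · simpa [Equiv.swap_apply_of_ne_of_ne] using key _ (Or.inr rfl) h₂

/-- A valuation that vanishes on points and segments `[0, v]` vanishes on all simplices of lower
dimension considered here. -/
lemma stdVal_eq_zero_of_lower (hn : 2 ≤ n) (hp : 0 < p) (hG : IsLpVal p G) {i₀ : Fin n}
    (h₁ : ∀ s : ℝ, (s = 1 ∨ s = -1) → stdVal G {some i₀} (fun _ => s) = 0)
    (h₂ : ∀ s : ℝ, (s = 1 ∨ s = -1) → stdVal G {none, some i₀} (fun _ => s) = 0)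
    (J : Finset (Option (Fin n))) {k : Fin n} (hk : some k ∉ J) (a : Fin n → ℝ) :
    stdVal G J a = 0 := by
  induction hm : J.card using Nat.strong_induction_on generalizing J a with
  | _ m ih =>
  have hone := stdVal_eq_zero_of_single hn hp hG h₁ h₂
  have h0 : ∀ j a, some j ∈ J → stdVal G (J.erase (some j)) a = 0 := fun j a hj =>
    ih _ (by rw [← hm]; exact Finset.card_erase_lt_of_mem hj) _
      (fun h => hk (Finset.mem_of_mem_erase h)) a rfl
  have hmem : ∀ {i}, i ∈ Finset.eraseNone J ↔ some i ∈ J := Finset.mem_eraseNone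
  have hcases : ∀ s : Finset (Fin n), Finset.eraseNone J = s →
      J = s.map Function.Embedding.some ∨ J = insert none (s.map Function.Embedding.some) := by
    rintro s rfl
    rw [Finset.map_some_eraseNone]
    by_cases h : none ∈ J
    · right; rw [Finset.insert_erase h]
    · left; rw [Finset.erase_eq_of_notMem h]
  rcases lt_or_ge 2 (Finset.eraseNone J).card with h3 | h3
  · obtain ⟨x, hx, y, hy, z, hz, hxy, hxz, hyz⟩ := Finset.two_lt_card.1 h3
    rw [hmem] at hx hy hz
    rcases le_total (a x) (a y) with e1 | e1 <;> rcases le_total (a y) (a z) with e2 | e2 <;>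
      rcases le_total (a x) (a z) with e3 | e3
    · exact stdVal_eq_zero_of_three hn hG hk h0 hxy hyz hxz hx hy hz e1 e2
    · exact stdVal_eq_zero_of_three hn hG hk h0 hxy hyz hxz hx hy hz e1 e2
    · exact stdVal_eq_zero_of_three hn hG hk h0 hxz hyz.symm hxy hx hz hy e3 e2
    · exact stdVal_eq_zero_of_three hn hG hk h0 hxz.symm hxy hyz.symm hz hx hy e3 e1
    · exact stdVal_eq_zero_of_three hn hG hk h0 hxy.symm hxz hyz hy hx hz e1 e3
    · exact stdVal_eq_zero_of_three hn hG hk h0 hyz hxz.symm hxy.symm hy hz hx e2 e3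
    · exact stdVal_eq_zero_of_three hn hG hk h0 hyz.symm hxy.symm hxz.symm hz hy hx e2 e1
    · exact stdVal_eq_zero_of_three hn hG hk h0 hyz.symm hxy.symm hxz.symm hz hy hx e2 e1
  · have hlt : (Finset.eraseNone J).card = 0 ∨ (Finset.eraseNone J).card = 1 ∨
      (Finset.eraseNone J).card = 2 := by omega
    rcases hlt with hc | hc | hc
    · rcases hcases _ (Finset.card_eq_zero.1 hc) with h | h
      · rw [h]; exact simplexVal_empty _ _
      · rw [h]; exact stdVal_singleton_none hn hp hG a
    · obtain ⟨i, hi⟩ := Finset.card_eq_one.1 hc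
      rcases hcases _ hi with h | h
      · rw [h]; simpa using (hone i a).1
      · rw [h]; simpa using (hone i a).2
    · obtain ⟨i, j, hij, hs⟩ := Finset.card_eq_two.1 hc
      have hi : some i ∈ J := hmem.1 (by rw [hs]; simp)
      have hj : some j ∈ J := hmem.1 (by rw [hs]; simp)
      -- If a vertex has inner product 0, contracting it to the origin leaves a segment from the
      -- origin to the other vertex, whether or not the origin was a vertex before.
      refine stdVal_eq_zero_of_two hn hG hk h0 hij hi hj (fun b hb => ?_) (fun b hb => ?_) a
      · rw [stdVal_eq_of_eq_zero hn hG hk hi hb]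
        have : insert none (J.erase (some i)) = {none, some j} := by
          rcases hcases _ hs with h | h <;> rw [h] <;> ext (_ | x) <;> simp <;> grind
        rw [this]; exact (hone j b).2
      · rw [stdVal_eq_of_eq_zero hn hG hk hj hb]
        have : insert none (J.erase (some j)) = {none, some i} := by
          rcases hcases _ hs with h | h <;> rw [h] <;> ext (_ | x) <;> simp <;> grind
        rw [this]; exact (hone i b).2

end lowdim

/-! ### Two functional equations: additivity and averaging. -/

/-- Every x is the difference of the positive numbers max x 0 + 1 and max (-x) 0 + 1. The
corresponding difference of values of f is additive on all of ℝ and continuous, hence linear. -/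
lemma eq_mul_of_additive_on_pos {f : ℝ → ℝ} (hf : Continuous f)
    (hadd : ∀ s t, 0 < s → 0 < t → f (s + t) = f s + f t) {s : ℝ} (hs : 0 < s) :
    f s = s * f 1 := by
  have hL : ∀ x y : ℝ, f (max (x + y) 0 + 1) - f (max (-(x + y)) 0 + 1) =
      (f (max x 0 + 1) - f (max (-x) 0 + 1)) + (f (max y 0 + 1) - f (max (-y) 0 + 1)) := by
    intro x y
    have pos : ∀ z : ℝ, 0 < max z 0 + 1 := fun z => by positivity
    have h1 := hadd _ _ (add_pos (pos (x + y)) (pos (-x))) (pos (-y))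
    have h2 := hadd _ _ (add_pos (pos (-(x + y))) (pos x)) (pos y)
    rw [hadd _ _ (pos _) (pos _)] at h1 h2
    have e : ∀ z : ℝ, max z 0 - max (-z) 0 = z := fun z => by
      rcases le_total z 0 with h | h
      · rw [max_eq_right h, max_eq_left (by linarith)]; ring
      · rw [max_eq_left h, max_eq_right (by linarith)]; ring
    have e3 : max (x + y) 0 + 1 + (max (-x) 0 + 1) + (max (-y) 0 + 1) =
        max (-(x + y)) 0 + 1 + (max x 0 + 1) + (max y 0 + 1) := by
      linarith [e x, e y, e (x + y)]
    rw [e3] at h1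
    linarith
  let L : ℝ →+ ℝ := AddMonoidHom.mk' (fun x => f (max x 0 + 1) - f (max (-x) 0 + 1)) hL
  have hLc : Continuous L := by
    change Continuous fun x => f (max x 0 + 1) - f (max (-x) 0 + 1)
    fun_prop
  have hLs : ∀ x : ℝ, 0 < x → L x = f x := fun x hx => by
    change f (max x 0 + 1) - f (max (-x) 0 + 1) = f x
    rw [max_eq_left hx.le, max_eq_right (by linarith), zero_add, hadd x 1 hx one_pos]
    ring
  have := map_real_smul L hLc s 1
  rwa [smul_eq_mul, mul_one, hLs s hs, hLs 1 one_pos, smul_eq_mul] at this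

lemma sum_update_sq {n : ℕ} (b : Fin n → ℝ) (i : Fin n) (m : ℝ) :
    ∑ k, Function.update b i m k ^ 2 = ∑ k, b k ^ 2 + (m ^ 2 - b i ^ 2) := by
  have : ∀ k, Function.update b i m k ^ 2 = b k ^ 2 + if k = i then m ^ 2 - b i ^ 2 else 0 := by
    intro k
    by_cases h : k = i
    · subst h; simp
    · simp [h]
  simp only [this, Finset.sum_add_distrib, Finset.sum_ite_eq', Finset.mem_univ, if_true]

/-- Among the maximisers on a cube, take one, b, with the least sum of squares. If b i ≠ b j, both
vectors obtained by putting the midpoint in place of one entry are maximisers as well, but their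
sums of squares average to less than that of b. So b is on the diagonal, where f is zero. -/
lemma nonpos_of_midpoint {n : ℕ} {f : (Fin n → ℝ) → ℝ} (hf : Continuous f)
    (hmid : ∀ a i j, i ≠ j → f a = 1 / 2 * f (Function.update a i ((a i + a j) / 2)) +
      1 / 2 * f (Function.update a j ((a i + a j) / 2)))
    (hdiag : ∀ a, (∀ i j, a i = a j) → f a = 0) (a : Fin n → ℝ) : f a ≤ 0 := by
  obtain ⟨c, hc⟩ : ∃ c, a ∈ Icc (fun _ => -c : Fin n → ℝ) (fun _ => c) := by
    refine ⟨∑ k, |a k|, fun i => ?_, fun i => ?_⟩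
    · have := Finset.single_le_sum (f := fun k => |a k|) (fun k _ => abs_nonneg _)
        (Finset.mem_univ i)
      exact (abs_le.1 this).1
    · have := Finset.single_le_sum (f := fun k => |a k|) (fun k _ => abs_nonneg _)
        (Finset.mem_univ i)
      exact (abs_le.1 this).2
  have hK : IsCompact (Icc (fun _ => -c : Fin n → ℝ) (fun _ => c)) := isCompact_Icc
  obtain ⟨m, hm, hmax⟩ := hK.exists_isMaxOn ⟨a, hc⟩ hf.continuousOn
  obtain ⟨b, ⟨hb, hbm⟩, hmin⟩ := (hK.inter_right (isClosed_singleton.preimage hf :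
    IsClosed (f ⁻¹' {f m}))).exists_isMinOn ⟨m, hm, rfl⟩
      (f := fun b : Fin n → ℝ => ∑ k, b k ^ 2) (by fun_prop)
  have hbm : f b = f m := hbm
  have hab : f a ≤ f b := hbm ▸ hmax hc
  by_cases hd : ∀ i j, b i = b j
  · rwa [hdiag b hd] at hab
  · push Not at hd
    obtain ⟨i, j, hij⟩ := hd
    have hne : i ≠ j := fun h => hij (h ▸ rfl)
    have hmem : ∀ l, Function.update b l ((b i + b j) / 2) ∈
        Icc (fun _ => -c : Fin n → ℝ) (fun _ => c) := by
      intro l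
      have h1 := hb.1 i
      have h2 := hb.1 j
      have h3 := hb.2 i
      have h4 := hb.2 j
      simp only at h1 h2 h3 h4
      refine ⟨fun k => ?_, fun k => ?_⟩
      · by_cases h : k = l
        · subst h; simp only [Function.update_self]; linarith
        · simp only [Function.update_of_ne h]; exact hb.1 k
      · by_cases h : k = l
        · subst h; simp only [Function.update_self]; linarith
        · simp only [Function.update_of_ne h]; exact hb.2 k
    have e1 : f (Function.update b i ((b i + b j) / 2)) ≤ f m := hmax (hmem i)
    have e2 : f (Function.update b j ((b i + b j) / 2)) ≤ f m := hmax (hmem j)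
    have e3 := hmid b i j hne
    have k1 : ∑ k, b k ^ 2 ≤ ∑ k, Function.update b i ((b i + b j) / 2) k ^ 2 :=
      hmin ⟨hmem i, show f _ = f m by linarith⟩
    have k2 : ∑ k, b k ^ 2 ≤ ∑ k, Function.update b j ((b i + b j) / 2) k ^ 2 :=
      hmin ⟨hmem j, show f _ = f m by linarith⟩
    rw [sum_update_sq] at k1 k2
    exact absurd (sub_eq_zero.1 (pow_eq_zero_iff two_ne_zero |>.1
      (le_antisymm (by nlinarith) (sq_nonneg (b i - b j))))) hij

/-- The maximum principle for functions that are averages along edges. -/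
lemma eq_zero_of_midpoint {n : ℕ} {f : (Fin n → ℝ) → ℝ} (hf : Continuous f)
    (hmid : ∀ a i j, i ≠ j → f a = 1 / 2 * f (Function.update a i ((a i + a j) / 2)) +
      1 / 2 * f (Function.update a j ((a i + a j) / 2)))
    (hdiag : ∀ a, (∀ i j, a i = a j) → f a = 0) (a : Fin n → ℝ) : f a = 0 := by
  refine le_antisymm (nonpos_of_midpoint hf hmid hdiag a) ?_
  have := nonpos_of_midpoint (f := fun a => -f a) hf.neg (fun a i j hij => by
    rw [hmid a i j hij]; ring) (fun a ha => by rw [hdiag a ha, neg_zero]) a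
  linarith

/-! ### Simplices with n vertices besides the origin. -/

section topdim
variable {n : ℕ} {p : ℝ} {G : ConvexBody (Eucl n) → Eucl n → ℝ}

/-- `simplexVal` in terms of the determinant of the vertices and their inner products. -/
noncomputable def topVal {n : ℕ} (G : ConvexBody (Eucl n) → Eucl n → ℝ)
    (J : Finset (Option (Fin n))) (i₀ : Fin n) (s : ℝ) (a : Fin n → ℝ) : ℝ :=
  simplexVal G J (Function.update stdv i₀ (s • stdv i₀))
    (WithLp.toLp 2 (Function.update a i₀ (s⁻¹ * a i₀)))

lemma inner_topFrame (i₀ : Fin n) {s : ℝ} (hs : s ≠ 0) (a : Fin n → ℝ) (k : Fin n) :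
    inner ℝ (Function.update stdv i₀ (s • stdv i₀) k)
      (WithLp.toLp 2 (Function.update a i₀ (s⁻¹ * a i₀))) = a k := by
  by_cases h : k = i₀
  · subst h
    rw [Function.update_self, real_inner_smul_left, inner_stdv]
    simp [hs]
  · rw [Function.update_of_ne h, inner_stdv]
    simp [h]

lemma vdet_topFrame (i₀ : Fin n) (s : ℝ) :
    vdet (Function.update (stdv (n := n)) i₀ (s • stdv i₀)) = s := by
  rw [vdet_update_smul, vdet_stdv, mul_one]

lemma simplexVal_eq_topVal (hG : IsLpVal p G) (J : Finset (Option (Fin n))) (i₀ : Fin n)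
    {v : Fin n → Eucl n} {s : ℝ} (hs : s ≠ 0) (hv : vdet v = s) {u : Eucl n} {a : Fin n → ℝ}
    (h : ∀ k, inner ℝ (v k) u = a k) : simplexVal G J v u = topVal G J i₀ s a :=
  simplexVal_eq_of_vdet_eq hG J (by rwa [hv]) (by rw [vdet_topFrame, hv]) fun k => by
    rw [h, inner_topFrame i₀ hs]

/-- The cut divides the determinant in the ratio 1 - r to r. The common face has one vertex fewer
and contributes nothing by `hlow`. -/
lemma topVal_cut (hn : 2 ≤ n) (hG : IsLpVal p G) {J : Finset (Option (Fin n))}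
    (hJ : ∀ i, some i ∈ J)
    (hlow : ∀ (J' : Finset (Option (Fin n))) (k : Fin n) (a : Fin n → ℝ), some k ∉ J' →
      stdVal G J' a = 0) (i₀ : Fin n) {s : ℝ} (hs : s ≠ 0) (a : Fin n → ℝ) {i j : Fin n}
    (hij : i ≠ j) {r : ℝ} (hr : 0 < r) (hr1 : r < 1) :
    topVal G J i₀ s a = topVal G J i₀ ((1 - r) * s) (Function.update a i ((1 - r) * a i + r * a j)) +
      topVal G J i₀ (r * s) (Function.update a j ((1 - r) * a i + r * a j)) := by
  set v := Function.update (stdv (n := n)) i₀ (s • stdv i₀) with hv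
  set u : Eucl n := WithLp.toLp 2 (Function.update a i₀ (s⁻¹ * a i₀)) with hu
  have ha : ∀ k, inner ℝ (v k) u = a k := inner_topFrame i₀ hs a
  have hd : vdet v = s := vdet_topFrame i₀ s
  have hd0 : vdet v ≠ 0 := by rwa [hd]
  have hr' : (1 - r) * s ≠ 0 := mul_ne_zero (by linarith) hs
  have hr'' : r * s ≠ 0 := mul_ne_zero hr.ne' hs
  have hdi := vdet_update_left v hij r
  have hdj := vdet_update_right v hij r
  rw [hd] at hdi hdj
  have hc := simplexVal_cut hG hd0 hij (hJ i) (hJ j) hr hr1 u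
  rw [simplexVal_eq_topVal hG J i₀ hr' hdi (inner_update_comb ha i j i r),
    simplexVal_eq_topVal hG J i₀ hr'' hdj (inner_update_comb ha i j j r),
    simplexVal_eq_stdVal hn hG (Finset.notMem_erase (some j) J) (by rwa [hdi])
      fun l _ => inner_update_comb ha i j i r l, hlow _ j _ (Finset.notMem_erase _ _),
    add_zero] at hc
  exact hc

/-- Exchanging the i-th and j-th vertices reverses the sign of the determinant, while the simplex
and, as a i = a j, the list of inner products stay the same. -/
lemma topVal_neg (hG : IsLpVal p G) {J : Finset (Option (Fin n))} (hJ : ∀ i, some i ∈ J)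
    (i₀ : Fin n) {s : ℝ} (hs : s ≠ 0) {a : Fin n → ℝ} {i j : Fin n} (hij : i ≠ j)
    (ha : a i = a j) : topVal G J i₀ (-s) a = topVal G J i₀ s a := by
  have hmap : J.map (Equiv.optionCongr (Equiv.swap i j)).toEmbedding = J := by
    refine Finset.eq_of_subset_of_card_le (fun x hx => ?_) (Finset.card_map _).ge
    rcases x with _ | x
    · obtain ⟨y, hy, hy'⟩ := Finset.mem_map.1 hx
      rcases y with _ | y
      · exact hy
      · exact absurd hy' (Option.some_ne_none _)
    · exact hJ x
  symm
  rw [topVal, ← hmap, ← simplexVal_comp_perm, hmap]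
  refine simplexVal_eq_topVal hG J i₀ (neg_ne_zero.2 hs) ?_ fun k => ?_
  · rw [AlternatingMap.map_swap _ _ hij, vdet_topFrame]
  · rw [Function.comp_apply, inner_topFrame i₀ hs]
    by_cases h1 : k = i
    · subst h1; rw [Equiv.swap_apply_left, ha]
    · by_cases h2 : k = j
      · subst h2; rw [Equiv.swap_apply_right, ha]
      · rw [Equiv.swap_apply_of_ne_of_ne h1 h2]

/-- When a i = a j, cutting the edge from i to j leaves a unchanged and only divides the
determinant. The value is therefore additive in s > 0, and continuity makes it linear. -/
lemma topVal_of_eq (hn : 2 ≤ n) (hG : IsLpVal p G) {J : Finset (Option (Fin n))}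
    (hJ : ∀ i, some i ∈ J)
    (hlow : ∀ (J' : Finset (Option (Fin n))) (k : Fin n) (a : Fin n → ℝ), some k ∉ J' →
      stdVal G J' a = 0) (i₀ : Fin n) {s : ℝ} (hs : s ≠ 0) {a : Fin n → ℝ} {i j : Fin n}
    (hij : i ≠ j) (ha : a i = a j) : topVal G J i₀ s a = |s| * topVal G J i₀ 1 a := by
  have hpos : ∀ s : ℝ, 0 < s → topVal G J i₀ s a = s * topVal G J i₀ 1 a := by
    -- This path of simplices has determinant s and, as a i = a j, constant inner products. It is
    -- continuous on all of ℝ, including the degenerate simplex at s = 0.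
    set f : ℝ → ℝ := fun s => simplexVal G J (Function.update stdv i (s • stdv i + (1 - s) • stdv j))
      (WithLp.toLp 2 a) with hf
    have hfc : Continuous f := by
      refine evalSet_hullOn_continuous hG J (fun l _ => ?_) _
      rcases l with _ | l
      · exact continuous_const
      · by_cases h : l = i
        · subst h
          simp only [withOrigin_some, Function.update_self]
          fun_prop
        · simp only [withOrigin_some, Function.update_of_ne h]
          fun_prop
    have hft : ∀ s : ℝ, 0 < s → f s = topVal G J i₀ s a := by
      intro s hs
      refine simplexVal_eq_topVal hG J i₀ hs.ne' ?_ fun k => ?_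
      · rw [vdet_update_comb _ hij, vdet_stdv, mul_one]
      · by_cases h : k = i
        · subst h
          rw [Function.update_self, inner_add_left, real_inner_smul_left, real_inner_smul_left,
            inner_stdv, inner_stdv]
          simp only [← ha]
          ring
        · rw [Function.update_of_ne h, inner_stdv]
    intro s hs
    rw [← hft s hs, ← hft 1 one_pos]
    refine eq_mul_of_additive_on_pos hfc (fun s t hs ht => ?_) hs
    have hst : 0 < s + t := add_pos hs ht
    rw [hft _ hst, hft _ hs, hft _ ht, topVal_cut hn hG hJ hlow i₀ hst.ne' a hij
      (r := t / (s + t)) (by positivity) (by rw [div_lt_one hst]; linarith)]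
    have e1 : (1 - t / (s + t)) * (s + t) = s := by field_simp; ring
    have e2 : t / (s + t) * (s + t) = t := by field_simp
    have e3 : (1 - t / (s + t)) * a i + t / (s + t) * a j = a i := by rw [← ha]; ring
    rw [e1, e2, e3, Function.update_eq_self, ha, Function.update_eq_self]
  rcases lt_or_gt_of_ne hs with h | h
  · rw [abs_of_neg h, ← hpos (-s) (by linarith), topVal_neg hG hJ i₀ hs hij ha]
  · rw [abs_of_pos h, hpos s h]

/-- Let b be a with its j-th entry replaced by a i. Cutting the edge from j to l of b at height a j
produces a, and the other two vectors in the relation have equal entries at i and j, where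
proportionality to |s| is known. So it holds for a. -/
lemma topVal_eq_of_le (hn : 2 ≤ n) (hG : IsLpVal p G) {J : Finset (Option (Fin n))}
    (hJ : ∀ i, some i ∈ J)
    (hlow : ∀ (J' : Finset (Option (Fin n))) (k : Fin n) (a : Fin n → ℝ), some k ∉ J' →
      stdVal G J' a = 0) (i₀ : Fin n) {s : ℝ} (hs : s ≠ 0) {a : Fin n → ℝ} {i j l : Fin n}
    (hij : i ≠ j) (hjl : j ≠ l) (hil : i ≠ l) (h1 : a i ≤ a j) (h2 : a j ≤ a l) :
    topVal G J i₀ s a = |s| * topVal G J i₀ 1 a := by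
  rcases h1.eq_or_lt with h1 | h1
  · exact topVal_of_eq hn hG hJ hlow i₀ hs hij h1
  rcases h2.eq_or_lt with h2 | h2
  · exact topVal_of_eq hn hG hJ hlow i₀ hs hjl h2
  obtain ⟨r, hr, hr1, hx⟩ := exists_convex_comb (Or.inl ⟨h1, h2⟩)
  set b := Function.update a j (a i) with hb
  have hbij : b i = b j := by rw [hb, Function.update_of_ne hij, Function.update_self]
  have hbl : b l = a l := by rw [hb, Function.update_of_ne hjl.symm]
  have hbj : b j = a i := by rw [hb, Function.update_self]
  have hrec : Function.update b j (a j) = a := by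
    rw [hb, Function.update_idem, Function.update_eq_self]
  have hb' : Function.update b l (a j) i = Function.update b l (a j) j := by
    rw [Function.update_of_ne hil, Function.update_of_ne hjl, hbij]
  have key : ∀ t : ℝ, t ≠ 0 → topVal G J i₀ t a = |t| * ((1 - r)⁻¹ *
      (topVal G J i₀ 1 b - r * topVal G J i₀ 1 (Function.update b l (a j)))) := by
    intro t ht
    have h1r : 0 < 1 - r := by linarith
    have ht' : t / (1 - r) ≠ 0 := div_ne_zero ht h1r.ne'
    have hc := topVal_cut hn hG hJ hlow i₀ ht' b hjl hr hr1
    rw [hbj, hbl, hx, hrec, mul_div_cancel₀ _ h1r.ne', topVal_of_eq hn hG hJ hlow i₀ ht' hij hbij,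
      topVal_of_eq hn hG hJ hlow i₀ (mul_ne_zero hr.ne' ht') hij hb', abs_mul, abs_div,
      abs_of_pos h1r, abs_of_pos hr] at hc
    rw [eq_sub_of_add_eq hc.symm]
    field_simp
  rw [key s hs, key 1 one_ne_zero, abs_one, one_mul]

/-- As n ≥ 3, there are three indices, and they can be ordered by their entries. -/
lemma topVal_eq (hn : 3 ≤ n) (hG : IsLpVal p G) {J : Finset (Option (Fin n))}
    (hJ : ∀ i, some i ∈ J)
    (hlow : ∀ (J' : Finset (Option (Fin n))) (k : Fin n) (a : Fin n → ℝ), some k ∉ J' →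
      stdVal G J' a = 0) (i₀ : Fin n) {s : ℝ} (hs : s ≠ 0) (a : Fin n → ℝ) :
    topVal G J i₀ s a = |s| * topVal G J i₀ 1 a := by
  have hn2 : 2 ≤ n := by omega
  obtain ⟨x, y, z, hxy, hxz, hyz⟩ : ∃ x y z : Fin n, x ≠ y ∧ x ≠ z ∧ y ≠ z :=
    ⟨⟨0, by omega⟩, ⟨1, by omega⟩, ⟨2, by omega⟩, by simp, by simp, by simp⟩
  have key := fun {i j l : Fin n} => topVal_eq_of_le hn2 hG hJ hlow i₀ hs (a := a) (i := i) (j := j)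
    (l := l)
  rcases le_total (a x) (a y) with e1 | e1 <;> rcases le_total (a y) (a z) with e2 | e2 <;>
    rcases le_total (a x) (a z) with e3 | e3
  · exact key hxy hyz hxz e1 e2
  · exact key hxy hyz hxz e1 e2
  · exact key hxz hyz.symm hxy e3 e2
  · exact key hxz.symm hxy hyz.symm e3 e1
  · exact key hxy.symm hxz hyz e1 e3
  · exact key hyz hxz.symm hxy.symm e2 e3
  · exact key hyz.symm hxy.symm hxz.symm e2 e1
  · exact key hyz.symm hxy.symm hxz.symm e2 e1

/-- A valuation that vanishes in lower dimensions and at the two test values vanishes on all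
full-dimensional simplices with `n` vertices other than the origin. -/
lemma simplexVal_eq_zero_of_top (hn : 3 ≤ n) (hp : 0 < p) (hG : IsLpVal p G)
    {J : Finset (Option (Fin n))} (hJ : ∀ i, some i ∈ J)
    (hlow : ∀ (J' : Finset (Option (Fin n))) (k : Fin n) (a : Fin n → ℝ), some k ∉ J' →
      stdVal G J' a = 0)
    (ht : ∀ s : ℝ, (s = 1 ∨ s = -1) → stdVal G J (fun _ => s) = 0) {v : Fin n → Eucl n}
    (hv : vdet v ≠ 0) (u : Eucl n) : simplexVal G J v u = 0 := by
  have i₀ : Fin n := ⟨0, by omega⟩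
  have hst : ∀ a, stdVal G J a = topVal G J i₀ 1 a := fun a =>
    simplexVal_eq_topVal hG J i₀ one_ne_zero vdet_stdv fun k => inner_stdv k _
  rw [simplexVal_eq_topVal hG J i₀ hv rfl fun _ => rfl, topVal_eq hn hG hJ hlow i₀ hv, ← hst,
    mul_eq_zero]
  right
  -- Proportionality to the determinant turns the midpoint cut into an average with weights 1/2. On
  -- the diagonal, homogeneity reduces to the two test values.
  refine eq_zero_of_midpoint (f := stdVal G J) ?_ (fun a i j hij => ?_) (fun a ha => ?_) _
  · exact (simplexVal_continuous_dir hG J stdv).comp (by fun_prop)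
  · rw [hst, hst, hst, topVal_cut (by omega) hG hJ hlow i₀ one_ne_zero a hij (r := 1 / 2)
      (by norm_num) (by norm_num), topVal_eq hn hG hJ hlow i₀ (by norm_num),
      topVal_eq hn hG hJ hlow i₀ (s := 1 / 2 * 1) (by norm_num),
      show (1 - 1 / 2) * a i + 1 / 2 * a j = (a i + a j) / 2 by ring]
    norm_num [abs_of_pos]
  · rcases lt_trichotomy (a i₀) 0 with h | h | h
    · rw [show a = (-a i₀) • fun _ => (-1 : ℝ) from funext fun k => by simp [ha k i₀],
        stdVal_homog hG _ _ (by linarith), ht _ (Or.inr rfl), mul_zero]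
    · have h1 := stdVal_homog hG J a (t := 2) two_pos
      rw [show (2 : ℝ) • a = a from funext fun k => by simp [ha k i₀, h]] at h1
      have h3 : (1 : ℝ) < 2 ^ p := Real.one_lt_rpow one_lt_two hp
      have : (2 ^ p - 1) * stdVal G J a = 0 := by linarith
      exact (mul_eq_zero.1 this).resolve_left (by linarith)
    · rw [show a = (a i₀) • fun _ => (1 : ℝ) from funext fun k => by simp [ha k i₀],
        stdVal_homog hG _ _ h, ht _ (Or.inl rfl), mul_zero]

end topdim

/-! ### From simplices to all convex bodies. -/

section density
variable {n : ℕ} {p : ℝ} {G : ConvexBody (Eucl n) → Eucl n → ℝ}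

lemma inner_sum_smul {ι : Type*} [Fintype ι] (t : ι → ℝ) (P : ι → Eucl n) (w : Eucl n) :
    (inner ℝ (∑ k, t k • P k) w : ℝ) = ∑ k, t k * inner ℝ (P k) w := by
  rw [sum_inner]
  exact Finset.sum_congr rfl fun k _ => real_inner_smul_left _ _ _

lemma convex_inner_le (w : Eucl n) (t : ℝ) : Convex ℝ {x : Eucl n | inner ℝ x w ≤ t} :=
  convex_halfSpace_le ⟨fun x y => inner_add_left x y w, fun c x => real_inner_smul_left x w c⟩ t

lemma convex_le_inner (w : Eucl n) (t : ℝ) : Convex ℝ {x : Eucl n | t ≤ inner ℝ x w} :=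
  convex_halfSpace_ge ⟨fun x y => inner_add_left x y w, fun c x => real_inner_smul_left x w c⟩ t

lemma isClosed_inner_le (w : Eucl n) (t : ℝ) : IsClosed {x : Eucl n | inner ℝ x w ≤ t} :=
  isClosed_le (by fun_prop) continuous_const

lemma isClosed_le_inner (w : Eucl n) (t : ℝ) : IsClosed {x : Eucl n | t ≤ inner ℝ x w} :=
  isClosed_le continuous_const (by fun_prop)

lemma hullOn_face {ι : Type*} [Fintype ι] (P : ι → Eucl n) (J : Finset ι) (w : Eucl n) (t : ℝ)
    (h : ∀ k ∈ J, t ≤ inner ℝ (P k) w) : hullOn P J ∩ {x | inner ℝ x w ≤ t} =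
      hullOn P (J.filter fun k => (inner ℝ (P k) w : ℝ) = t) := by
  refine Subset.antisymm ?_ (subset_inter (convexHull_mono (image_mono (by
    intro k hk; exact (Finset.mem_filter.1 hk).1))) ?_)
  · rintro x ⟨hx, hxt⟩
    obtain ⟨c, hc, hcJ, hs, rfl⟩ := mem_hullOn.1 hx
    refine mem_hullOn.2 ⟨c, hc, fun k hk => ?_, hs, rfl⟩
    by_cases hkJ : k ∈ J
    · have hk' : (inner ℝ (P k) w : ℝ) ≠ t := fun h => hk (Finset.mem_filter.2 ⟨hkJ, h⟩)
      rw [mem_ofPred_eq, inner_sum_smul] at hxt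
      have hnn : ∀ l, 0 ≤ c l * (inner ℝ (P l) w - t) := fun l => by
        by_cases hl : l ∈ J
        · exact mul_nonneg (hc l) (sub_nonneg.2 (h l hl))
        · rw [hcJ l hl, zero_mul]
      have hsum : ∑ l, c l * (inner ℝ (P l) w - t) ≤ 0 := by
        simp only [mul_sub, Finset.sum_sub_distrib, ← Finset.sum_mul, hs]
        linarith
      have := (Finset.sum_eq_zero_iff_of_nonneg fun l _ => hnn l).1
        (le_antisymm hsum (Finset.sum_nonneg fun l _ => hnn l)) k (Finset.mem_univ k)
      exact (mul_eq_zero.1 this).resolve_right (sub_ne_zero.2 hk')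
    · exact hcJ k hkJ
  · refine hullOn_subset (convex_inner_le w t) fun k hk => ?_
    exact (Finset.mem_filter.1 hk).2.le

/-- The vertices where the hyperplane `⟨x, w⟩ = 1` meets the rays through the `v i`. -/
noncomputable def truncVertices (J : Finset (Option (Fin n))) (v : Fin n → Eucl n) (w : Eucl n)
    (i : Fin n) : Eucl n :=
  (if some i ∈ J then (inner ℝ (v i) w : ℝ)⁻¹ else 1) • v i

lemma vdet_truncVertices {J : Finset (Option (Fin n))} {v : Fin n → Eucl n} {w : Eucl n}
    (hv : vdet v ≠ 0) (h : ∀ i, some i ∈ J → 1 ≤ (inner ℝ (v i) w : ℝ)) :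
    vdet (truncVertices J v w) ≠ 0 := by
  have := vdet.toMultilinearMap.map_smul_univ
    (fun i => if some i ∈ J then (inner ℝ (v i) w : ℝ)⁻¹ else 1) v
  refine ne_of_eq_of_ne this (mul_ne_zero (Finset.prod_ne_zero_iff.2 fun i _ => ?_) hv)
  split_ifs with hi
  · exact inv_ne_zero (by linarith [h i hi])
  · exact one_ne_zero

lemma inner_truncVertices {J : Finset (Option (Fin n))} {v : Fin n → Eucl n} {w : Eucl n}
    (h : ∀ i, some i ∈ J → 1 ≤ (inner ℝ (v i) w : ℝ)) {i : Fin n} (hi : some i ∈ J) :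
    inner ℝ (truncVertices J v w i) w = (1 : ℝ) := by
  rw [truncVertices, if_pos hi, real_inner_smul_left, inv_mul_cancel₀ (by linarith [h i hi])]

lemma truncVertices_mem {J : Finset (Option (Fin n))} {v : Fin n → Eucl n} {w : Eucl n}
    (hJ : none ∈ J) (h : ∀ i, some i ∈ J → 1 ≤ (inner ℝ (v i) w : ℝ)) {i : Fin n}
    (hi : some i ∈ J) : truncVertices J v w i ∈ hullOn (withOrigin v) J := by
  have h1 := h i hi
  have := (convex_hullOn (withOrigin v) J) (mem_hullOn_of_mem hJ) (mem_hullOn_of_mem hi)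
    (sub_nonneg.2 (inv_le_one_of_one_le₀ h1)) (inv_nonneg.2 (zero_le_one.trans h1))
    (sub_add_cancel _ _)
  simpa [truncVertices, hi] using this

/-- If x is the sum of the t i v i, then it is the sum of t i ⟨v i, w⟩ times v i / ⟨v i, w⟩, and the
remaining weight 1 - ⟨x, w⟩ goes to the origin. The alternative in `hxw` covers both the truncated
simplex and its facet in the hyperplane. -/
lemma mem_hullOn_trunc {J : Finset (Option (Fin n))} {v : Fin n → Eucl n} {w x : Eucl n}
    (h : ∀ i, some i ∈ J → 1 ≤ (inner ℝ (v i) w : ℝ)) {J' : Finset (Option (Fin n))}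
    (hJ' : ∀ i, some i ∈ J → some i ∈ J') (hx : x ∈ hullOn (withOrigin v) J)
    (hxw : (none ∈ J' ∧ inner ℝ x w ≤ (1 : ℝ)) ∨ inner ℝ x w = (1 : ℝ)) :
    x ∈ hullOn (withOrigin (truncVertices J v w)) J' := by
  obtain ⟨t, ht, htJ, hs, rfl⟩ := mem_hullOn.1 hx
  rw [inner_sum_smul, Fintype.sum_option] at hxw
  simp only [withOrigin_none, withOrigin_some, inner_zero_left, mul_zero, zero_add] at hxw
  refine mem_hullOn.2 ⟨fun o => o.elim (1 - ∑ i, t (some i) * inner ℝ (v i) w)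
    fun i => t (some i) * inner ℝ (v i) w, ?_, ?_, ?_, ?_⟩
  · rintro (_ | i)
    · simp only [Option.elim]
      rcases hxw with ⟨_, h1⟩ | h1 <;> linarith
    · simp only [Option.elim]
      by_cases hi : some i ∈ J
      · exact mul_nonneg (ht _) (zero_le_one.trans (h i hi))
      · rw [htJ _ hi, zero_mul]
  · rintro (_ | i) hi
    · simp only [Option.elim]
      rcases hxw with ⟨h1, _⟩ | h1
      · exact absurd h1 hi
      · rw [h1, sub_self]
    · simp only [Option.elim]
      rw [htJ _ fun h => hi (hJ' i h), zero_mul]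
  · rw [Fintype.sum_option]
    simp
  · rw [Fintype.sum_option, Fintype.sum_option]
    simp only [Option.elim, withOrigin_none, withOrigin_some, smul_zero, zero_add]
    refine Finset.sum_congr rfl fun i _ => ?_
    by_cases hi : some i ∈ J
    · have := h i hi
      rw [truncVertices, if_pos hi, smul_smul, mul_assoc, mul_inv_cancel₀ (by linarith), mul_one]
    · rw [htJ _ hi]; simp

lemma hullOn_inter_le_one {J : Finset (Option (Fin n))} {v : Fin n → Eucl n} {w : Eucl n}
    (hJ : none ∈ J) (h : ∀ i, some i ∈ J → 1 ≤ (inner ℝ (v i) w : ℝ)) :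
    hullOn (withOrigin v) J ∩ {x | inner ℝ x w ≤ (1 : ℝ)} =
      hullOn (withOrigin (truncVertices J v w)) J := by
  refine Subset.antisymm (fun x hx => mem_hullOn_trunc h (fun _ h => h) hx.1 (Or.inl ⟨hJ, hx.2⟩))
    (hullOn_subset ((convex_hullOn _ _).inter (convex_inner_le w 1)) ?_)
  rintro (_ | i) hi
  · exact ⟨mem_hullOn_of_mem hJ, by simp⟩
  · exact ⟨truncVertices_mem hJ h hi, (inner_truncVertices h hi).le⟩

lemma hullOn_inter_eq_one {J : Finset (Option (Fin n))} {v : Fin n → Eucl n} {w : Eucl n}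
    (hJ : none ∈ J) (h : ∀ i, some i ∈ J → 1 ≤ (inner ℝ (v i) w : ℝ)) :
    hullOn (withOrigin v) J ∩ ({x | inner ℝ x w ≤ (1 : ℝ)} ∩ {x | (1 : ℝ) ≤ inner ℝ x w}) =
      hullOn (withOrigin (truncVertices J v w)) (J.erase none) := by
  refine Subset.antisymm (fun x hx => mem_hullOn_trunc h (fun i h => by simpa using h) hx.1
    (Or.inr (le_antisymm hx.2.1 hx.2.2))) (hullOn_subset ((convex_hullOn _ _).inter
      ((convex_inner_le w 1).inter (convex_le_inner w 1))) ?_)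
  rintro (_ | i) hi
  · simp at hi
  · have hi' : some i ∈ J := by simpa using hi
    exact ⟨truncVertices_mem hJ h hi', (inner_truncVertices h hi').le,
      (inner_truncVertices h hi').ge⟩

/-- `G` vanishes on the intersections of the set `Q` with all simplices that have `n` linearly
independent potential vertices besides the origin. -/
def VanishesOn (G : ConvexBody (Eucl n) → Eucl n → ℝ) (u : Eucl n) (Q : Set (Eucl n)) : Prop :=
  ∀ (J : Finset (Option (Fin n))) (v : Fin n → Eucl n), vdet v ≠ 0 →
    evalSet G (hullOn (withOrigin v) J ∩ Q) u = 0

/-- The part of the simplex beyond the hyperplane need not be a simplex. Its value comes from the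
whole, the truncated simplex at the origin and the facet between them, and `hV` applies to all
three. -/
lemma VanishesOn.cut (hG : IsLpVal p G) {u : Eucl n} {Q : Set (Eucl n)} (hQ : Convex ℝ Q)
    (hQ' : IsClosed Q) (hV : VanishesOn G u Q) {w : Eucl n} {J : Finset (Option (Fin n))}
    {v : Fin n → Eucl n} (hv : vdet v ≠ 0) (hJ : none ∈ J)
    (h : ∀ i, some i ∈ J → 1 ≤ (inner ℝ (v i) w : ℝ)) :
    evalSet G (hullOn (withOrigin v) J ∩ (Q ∩ {x | (1 : ℝ) ≤ inner ℝ x w})) u = 0 := by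
  set S := hullOn (withOrigin v) J with hS
  have hSc : IsCompact S := isCompact_hullOn _ _
  have hScx : Convex ℝ S := convex_hullOn _ _
  have hun : (S ∩ (Q ∩ {x | inner ℝ x w ≤ (1 : ℝ)})) ∪ (S ∩ (Q ∩ {x | (1 : ℝ) ≤ inner ℝ x w})) =
      S ∩ Q := by
    rw [← inter_union_distrib_left, ← inter_union_distrib_left]
    have : {x : Eucl n | inner ℝ x w ≤ (1 : ℝ)} ∪ {x | (1 : ℝ) ≤ inner ℝ x w} = univ :=
      eq_univ_of_forall fun x => (le_total (inner ℝ x w) (1 : ℝ) :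
        inner ℝ x w ≤ (1 : ℝ) ∨ (1 : ℝ) ≤ inner ℝ x w)
    rw [this, inter_univ]
  have := evalSet_union hG (hScx.inter (hQ.inter (convex_inner_le w 1)))
    (hSc.inter_right (hQ'.inter (isClosed_inner_le w 1)))
    (hScx.inter (hQ.inter (convex_le_inner w 1)))
    (hSc.inter_right (hQ'.inter (isClosed_le_inner w 1))) (by rw [hun]; exact hScx.inter hQ) u
  have e1 : S ∩ (Q ∩ {x | inner ℝ x w ≤ (1 : ℝ)}) =
      hullOn (withOrigin (truncVertices J v w)) J ∩ Q := by
    rw [← hullOn_inter_le_one hJ h, inter_assoc, inter_comm Q]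
  have e2 : S ∩ (Q ∩ {x | inner ℝ x w ≤ (1 : ℝ)}) ∩ (S ∩ (Q ∩ {x | (1 : ℝ) ≤ inner ℝ x w})) =
      hullOn (withOrigin (truncVertices J v w)) (J.erase none) ∩ Q := by
    rw [← hullOn_inter_eq_one hJ h]
    ext x
    simp only [mem_inter_iff]
    tauto
  rw [hun, e2, e1, hV J v hv, hV _ _ (vdet_truncVertices hv h),
    hV _ _ (vdet_truncVertices hv h)] at this
  linarith

/-- Induction on the number of nonzero vertices off the hyperplane: cutting an edge that crosses it
puts a new vertex on the hyperplane in place of one off it. -/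
lemma VanishesOn.inter_halfspace (hG : IsLpVal p G) {u : Eucl n} {Q : Set (Eucl n)}
    (hQ : Convex ℝ Q) (hQ' : IsClosed Q) (hV : VanishesOn G u Q) (w : Eucl n) (t : ℝ) :
    VanishesOn G u (Q ∩ {x | inner ℝ x w ≤ t}) := by
  intro J v hv
  induction hm : (Finset.univ.filter fun i => some i ∈ J ∧ (inner ℝ (v i) w : ℝ) ≠ t).card using
    Nat.strong_induction_on generalizing J v with
  | _ m ih =>
  by_cases hmix : ∃ i j, some i ∈ J ∧ some j ∈ J ∧ inner ℝ (v i) w < t ∧ t < inner ℝ (v j) w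
  · obtain ⟨i, j, hi, hj, hit, hjt⟩ := hmix
    obtain ⟨r, hr, hr1, hx⟩ := exists_convex_comb (Or.inl ⟨hit, hjt⟩)
    have hij : i ≠ j := by rintro rfl; linarith
    obtain ⟨hU, hI⟩ := hullOn_withOrigin_cut hv hij hi hj hr hr1
    have hc : ∀ l k, inner ℝ (Function.update v l ((1 - r) • v i + r • v j) k) w =
        Function.update (fun k => (inner ℝ (v k) w : ℝ)) l t k := by
      intro l k
      rw [inner_update_comb (a := fun k => (inner ℝ (v k) w : ℝ)) (fun _ => rfl), hx]
    have hcard : ∀ (J' : Finset (Option (Fin n))) l, J' ⊆ J → some l ∈ J →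
        (inner ℝ (v l) w : ℝ) ≠ t →
        (Finset.univ.filter fun k => some k ∈ J' ∧
          (inner ℝ (Function.update v l ((1 - r) • v i + r • v j) k) w : ℝ) ≠ t).card < m := by
      intro J' l hJ' hl hlt
      rw [← hm]
      refine Finset.card_lt_card ⟨fun k hk => ?_, fun hsub => ?_⟩
      · simp only [Finset.mem_filter, Finset.mem_univ, true_and, hc] at hk ⊢
        by_cases hkl : k = l
        · subst hkl; simp at hk
        · rw [Function.update_of_ne hkl] at hk
          exact ⟨hJ' hk.1, hk.2⟩
      · have := hsub (show l ∈ _ from Finset.mem_filter.2 ⟨Finset.mem_univ l, hl, hlt⟩)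
        simp [hc] at this
    have hdi : vdet (Function.update v i ((1 - r) • v i + r • v j)) ≠ 0 := by
      rw [vdet_update_left v hij]; exact mul_ne_zero (by linarith) hv
    have hdj : vdet (Function.update v j ((1 - r) • v i + r • v j)) ≠ 0 := by
      rw [vdet_update_right v hij]; exact mul_ne_zero hr.ne' hv
    have hQH : Convex ℝ (Q ∩ {x | inner ℝ x w ≤ t}) := hQ.inter (convex_inner_le w t)
    have hQH' : IsClosed (Q ∩ {x | inner ℝ x w ≤ t}) := hQ'.inter (isClosed_inner_le w t)
    have key := evalSet_union hG ((convex_hullOn (withOrigin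
        (Function.update v i ((1 - r) • v i + r • v j))) J).inter hQH)
      ((isCompact_hullOn _ _).inter_right hQH') ((convex_hullOn (withOrigin
        (Function.update v j ((1 - r) • v i + r • v j))) J).inter hQH)
      ((isCompact_hullOn _ _).inter_right hQH')
      (by rw [← union_inter_distrib_right, ← hU]; exact (convex_hullOn _ _).inter hQH) u
    rw [← union_inter_distrib_right, ← inter_inter_distrib_right, ← hU, ← hI,
      ih _ (hcard J i subset_rfl hi hit.ne) J _ hdi rfl,
      ih _ (hcard J j subset_rfl hj hjt.ne') J _ hdj rfl,
      ih _ (hcard _ i (Finset.erase_subset _ _) hi hit.ne) _ _ hdi rfl] at key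
    linarith
  · have hmix' : (∀ i, some i ∈ J → (inner ℝ (v i) w : ℝ) ≤ t) ∨
        (∀ i, some i ∈ J → t ≤ (inner ℝ (v i) w : ℝ)) := by
      by_contra! hcon
      obtain ⟨⟨j, hj, hjt⟩, i, hi, hit⟩ := hcon
      exact hmix ⟨i, j, hi, hj, hit, hjt⟩
    -- All nonzero vertices are now on one side. Only the origin can be on the other; since it is
    -- not part of the frame, its edges are not cut like the others, and truncation is used instead.
    rcases hmix' with hle | hge
    · by_cases h0 : none ∈ J ∧ t < 0
      · obtain ⟨h0, ht⟩ := h0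
        -- Dividing by t < 0 reverses the inequality, so the half-space becomes the side ⟨x, t⁻¹ w⟩
        -- ≥ 1 away from the origin.
        have h1 : ∀ i, some i ∈ J → 1 ≤ (inner ℝ (v i) (t⁻¹ • w) : ℝ) := fun i hi => by
          rw [real_inner_smul_right, ← div_eq_inv_mul, one_le_div_of_neg ht]
          exact hle i hi
        have := hV.cut hG hQ hQ' (w := t⁻¹ • w) hv h0 h1
        have e : {x : Eucl n | (1 : ℝ) ≤ inner ℝ x (t⁻¹ • w)} = {x | inner ℝ x w ≤ t} := by
          ext x
          rw [mem_ofPred_eq, mem_ofPred_eq, real_inner_smul_right, ← div_eq_inv_mul,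
            one_le_div_of_neg ht]
        rwa [e] at this
      · have hsub : hullOn (withOrigin v) J ⊆ {x | inner ℝ x w ≤ t} := by
          refine hullOn_subset (convex_inner_le w t) ?_
          rintro (_ | i) hi
          · rw [withOrigin_none, mem_ofPred_eq, inner_zero_left]
            by_contra hcon
            exact h0 ⟨hi, not_le.1 hcon⟩
          · exact hle i hi
        rw [inter_comm Q, ← inter_assoc, inter_eq_left.2 hsub]
        exact hV J v hv
    · by_cases h0 : none ∈ J ∧ 0 < t
      · obtain ⟨h0, ht⟩ := h0
        have h1 : ∀ i, some i ∈ J → 1 ≤ (inner ℝ (v i) (t⁻¹ • w) : ℝ) := fun i hi => by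
          rw [real_inner_smul_right, ← div_eq_inv_mul, one_le_div ht]
          exact hge i hi
        have e : {x : Eucl n | inner ℝ x w ≤ t} = {x | inner ℝ x (t⁻¹ • w) ≤ (1 : ℝ)} := by
          ext x
          rw [mem_ofPred_eq, mem_ofPred_eq, real_inner_smul_right, ← div_eq_inv_mul,
            div_le_one ht]
        rw [inter_comm Q, ← inter_assoc, e, hullOn_inter_le_one h0 h1]
        exact hV _ _ (vdet_truncVertices hv h1)
      · rw [inter_comm Q, ← inter_assoc, hullOn_face]
        · exact hV _ v hv
        · rintro (_ | i) hi
          · rw [withOrigin_none, inner_zero_left]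
            by_contra hcon
            exact h0 ⟨hi, not_le.1 hcon⟩
          · exact hge i hi

lemma VanishesOn.finite_inter (hG : IsLpVal p G) {u : Eucl n} (hV : VanishesOn G u univ)
    (f : Eucl n → ℝ) (F : Finset (Eucl n)) :
    VanishesOn G u {x | ∀ w ∈ F, inner ℝ x w ≤ f w} ∧
      Convex ℝ {x : Eucl n | ∀ w ∈ F, inner ℝ x w ≤ f w} ∧
      IsClosed {x : Eucl n | ∀ w ∈ F, inner ℝ x w ≤ f w} := by
  induction F using Finset.induction_on with
  | empty => simpa using ⟨hV, convex_univ⟩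
  | insert w F _ ih =>
    have : {x : Eucl n | ∀ z ∈ insert w F, inner ℝ x z ≤ f z} =
        {x | ∀ w ∈ F, inner ℝ x w ≤ f w} ∩ {x | inner ℝ x w ≤ f w} := by
      ext x
      simp [and_comm]
    rw [this]
    exact ⟨ih.1.inter_halfspace hG ih.2.1 ih.2.2 w (f w), ih.2.1.inter (convex_inner_le _ _),
      ih.2.2.inter (isClosed_inner_le _ _)⟩

/-- A valuation that vanishes on simplices vanishes on the bodies contained in a simplex. -/
lemma eq_zero_of_subset_simplex (hG : IsLpVal p G) {u : Eucl n} (hV : VanishesOn G u univ)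
    {J : Finset (Option (Fin n))} {v : Fin n → Eucl n} (hv : vdet v ≠ 0) {K : ConvexBody (Eucl n)}
    (hK : (K : Set (Eucl n)) ⊆ hullOn (withOrigin v) J) : G K u = 0 := by
  set S := hullOn (withOrigin v) J with hS
  have happ : ∀ ε > 0, ∃ L : ConvexBody (Eucl n), dist L K < ε ∧ G L u = 0 := by
    intro ε hε
    -- Each point of S at distance at least ε / 2 from K is strictly separated from K by a
    -- supporting half-space. By compactness finitely many half-spaces remove all these points.
    have hT : IsCompact (S \ Metric.thickening (ε / 2) (K : Set (Eucl n))) :=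
      IsCompact.diff (isCompact_hullOn _ _) Metric.isOpen_thickening
    obtain ⟨F, hF⟩ := hT.elim_finite_subcover (fun w : Eucl n => {x | suppFun K w < inner ℝ x w})
      (fun w => isOpen_lt continuous_const (by fun_prop)) (fun x hx => by
        have hxK : x ∉ K := fun h => hx.2 (Metric.self_subset_thickening (half_pos hε) _ h)
        rw [mem_iUnion]
        by_contra! hcon
        exact hxK (mem_of_inner_le fun u => not_lt.1 (hcon u)))
    obtain ⟨h1, h2, h3⟩ := hV.finite_inter hG (suppFun K) F
    have hKC : (K : Set (Eucl n)) ⊆ S ∩ {x | ∀ w ∈ F, inner ℝ x w ≤ suppFun K w} :=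
      subset_inter hK fun x hx w _ => inner_le_suppFun hx w
    refine ⟨⟨S ∩ {x | ∀ w ∈ F, inner ℝ x w ≤ suppFun K w}, (convex_hullOn _ _).inter h2,
      (isCompact_hullOn _ _).inter_right h3, K.nonempty.mono hKC⟩, ?_, ?_⟩
    · refine lt_of_le_of_lt (Metric.hausdorffDist_le_of_mem_dist (half_pos hε).le
        (fun x hx => ?_) fun x hx => ⟨x, hKC hx, by simpa using (half_pos hε).le⟩) (half_lt_self hε)
      by_contra! hcon
      have : x ∈ S \ Metric.thickening (ε / 2) (K : Set (Eucl n)) := by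
        refine ⟨hx.1, fun h => ?_⟩
        obtain ⟨y, hy, hxy⟩ := Metric.mem_thickening_iff.1 h
        exact absurd hxy (not_lt.2 (hcon y hy).le)
      obtain ⟨w, hw⟩ := mem_iUnion.1 (hF this)
      obtain ⟨hwF, hw⟩ := mem_iUnion.1 hw
      exact absurd (hx.2 w hwF) (not_le.2 hw)
    · rw [← evalSet_coe G]
      exact h1 J v hv
  by_contra hne
  have hopen : IsOpen {L : ConvexBody (Eucl n) | G L u ≠ 0} :=
    isOpen_ne_fun (hG.cont_body u) continuous_const
  obtain ⟨ε, hε, hb⟩ := Metric.isOpen_iff.1 hopen K hne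
  obtain ⟨L, hL, hL0⟩ := happ ε hε
  exact hb hL hL0

/-- Within one orthant with signs σ, a bounded set lies in the simplex with vertices 0 and M σ i e i
for large M. -/
lemma eq_zero_of_orthant (hG : IsLpVal p G) {u : Eucl n} (hV : VanishesOn G u univ)
    {K : ConvexBody (Eucl n)} (h : ∀ i, (∀ x ∈ K, 0 ≤ x i) ∨ (∀ x ∈ K, x i ≤ 0)) : G K u = 0 := by
  obtain ⟨σ, hσ⟩ : ∃ σ : Fin n → ℝ, ∀ i, σ i * σ i = 1 ∧ ∀ x ∈ K, 0 ≤ σ i * x i := by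
    refine Classical.axiomOfChoice (r := fun i (s : ℝ) => s * s = 1 ∧ ∀ x ∈ K, 0 ≤ s * x i)
      fun i => ?_
    rcases h i with h | h
    · exact ⟨1, by norm_num, fun x hx => by simpa using h x hx⟩
    · exact ⟨-1, by norm_num, fun x hx => by simpa using h x hx⟩
  obtain ⟨N, hN⟩ := K.isCompact.bddAbove_image (f := fun x : Eucl n => ∑ i, σ i * x i)
    (by fun_prop)
  set M := max N 1 with hM
  have hM0 : 0 < M := lt_of_lt_of_le one_pos (le_max_right _ _)
  have hv : vdet (fun i => (M * σ i) • stdv (n := n) i) ≠ 0 := by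
    have := vdet.toMultilinearMap.map_smul_univ (fun i => M * σ i) (stdv (n := n))
    refine ne_of_eq_of_ne this (mul_ne_zero (Finset.prod_ne_zero_iff.2 fun i _ => ?_)
      (ne_of_eq_of_ne vdet_stdv one_ne_zero))
    refine mul_ne_zero hM0.ne' fun h => ?_
    have := (hσ i).1
    rw [h] at this
    norm_num at this
  refine eq_zero_of_subset_simplex hG hV (J := Finset.univ) hv fun x hx => ?_
  have hxs : ∑ i, σ i * x i ≤ M := (hN (mem_image_of_mem _ hx)).trans (le_max_left _ _)
  refine mem_hullOn.2 ⟨fun o => o.elim (1 - ∑ i, M⁻¹ * (σ i * x i))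
    fun i => M⁻¹ * (σ i * x i), ?_, by simp, ?_, ?_⟩
  · rintro (_ | i)
    · simp only [Option.elim, ← Finset.mul_sum]
      rw [sub_nonneg, inv_mul_le_one₀ hM0]
      exact hxs
    · exact mul_nonneg (inv_nonneg.2 hM0.le) ((hσ i).2 x hx)
  · rw [Fintype.sum_option]
    simp
  · rw [Fintype.sum_option]
    simp only [Option.elim, withOrigin_none, withOrigin_some, smul_zero, zero_add, smul_smul]
    ext j
    simp only [WithLp.ofLp_sum, WithLp.ofLp_smul, Finset.sum_apply, Pi.smul_apply, smul_eq_mul]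
    rw [Finset.sum_eq_single j]
    · have := (hσ j).1
      simp only [stdv, EuclideanSpace.single, PiLp.single_apply, if_true]
      calc M⁻¹ * (σ j * x j) * (M * σ j) * 1 = (M⁻¹ * M) * (σ j * σ j) * x j := by ring
        _ = x j := by rw [this, inv_mul_cancel₀ hM0.ne']; ring
    · intro i _ hij
      simp [stdv, hij.symm]
    · simp

/-- Cut successively along the coordinate hyperplanes; m in `key` counts the first coordinates whose
sign may still vary on the set. -/
lemma eq_zero_of_vanishesOn (hG : IsLpVal p G) {u : Eucl n} (hV : VanishesOn G u univ)
    (K : ConvexBody (Eucl n)) : G K u = 0 := by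
  have key : ∀ m : ℕ, ∀ A : Set (Eucl n), Convex ℝ A → IsCompact A →
      (∀ i : Fin n, m ≤ i → (∀ x ∈ A, 0 ≤ x i) ∨ (∀ x ∈ A, x i ≤ 0)) → evalSet G A u = 0 := by
    intro m
    induction m with
    | zero =>
      intro A hA hA' h
      rcases A.eq_empty_or_nonempty with rfl | hne
      · exact evalSet_empty u
      · rw [evalSet_mk hA hA' hne]
        exact eq_zero_of_orthant hG hV fun i => h i (Nat.zero_le _)
    | succ m ih =>
      intro A hA hA' h
      by_cases hm : m < n
      · set i : Fin n := ⟨m, hm⟩ with hi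
        have hc : Continuous fun x : Eucl n => x i := by fun_prop
        have hlin : IsLinearMap ℝ fun x : Eucl n => x i := ⟨fun _ _ => rfl, fun _ _ => rfl⟩
        have c1 := hA.inter (convex_halfSpace_le hlin 0)
        have c2 := hA.inter (convex_halfSpace_ge hlin 0)
        have k1 := hA'.inter_right (isClosed_le hc continuous_const : IsClosed {x : Eucl n | x i ≤ 0})
        have k2 := hA'.inter_right (isClosed_le continuous_const hc : IsClosed {x : Eucl n | 0 ≤ x i})
        have hun : (A ∩ {x : Eucl n | x i ≤ 0}) ∪ (A ∩ {x : Eucl n | 0 ≤ x i}) = A := by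
          have : {x : Eucl n | x i ≤ 0} ∪ {x : Eucl n | 0 ≤ x i} = univ :=
            eq_univ_of_forall fun x => (le_total (x i) 0 : x i ≤ 0 ∨ 0 ≤ x i)
          rw [← inter_union_distrib_left, this, inter_univ]
        have hsub : ∀ B ⊆ A, ((∀ x ∈ B, 0 ≤ x i) ∨ (∀ x ∈ B, x i ≤ 0)) →
            ∀ j : Fin n, m ≤ j → (∀ x ∈ B, 0 ≤ x j) ∨ (∀ x ∈ B, x j ≤ 0) := by
          intro B hB hBi j hj
          rcases hj.eq_or_lt with hj | hj
          · have : j = i := Fin.ext hj.symm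
            rw [this]; exact hBi
          · rcases h j hj with h | h
            · exact Or.inl fun x hx => h x (hB hx)
            · exact Or.inr fun x hx => h x (hB hx)
        have := evalSet_union hG c1 k1 c2 k2 (by rw [hun]; exact hA) u
        rw [hun, ih _ c1 k1 (hsub _ inter_subset_left (Or.inr fun x hx => hx.2)),
          ih _ c2 k2 (hsub _ inter_subset_left (Or.inl fun x hx => hx.2)),
          ih _ (c1.inter c2) (k1.inter_right k2.isClosed)
            (hsub _ (inter_subset_left.trans inter_subset_left) (Or.inr fun x hx => hx.1.2))] at this
        linarith
      · exact ih A hA hA' fun i hi => absurd i.2 (by omega)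
  rw [← evalSet_coe G]
  exact key n K K.convex K.isCompact fun i hi => absurd i.2 (by omega)

/-- A valuation is determined by its values on a point, a segment, and two simplices. -/
theorem IsLpVal.eq_zero (hn : 3 ≤ n) (hp : 0 < p) (hG : IsLpVal p G) (i₀ : Fin n)
    (h₁ : ∀ s : ℝ, (s = 1 ∨ s = -1) → stdVal G {some i₀} (fun _ => s) = 0)
    (h₂ : ∀ s : ℝ, (s = 1 ∨ s = -1) → stdVal G {none, some i₀} (fun _ => s) = 0)
    (h₃ : ∀ s : ℝ, (s = 1 ∨ s = -1) → stdVal G Finset.univ (fun _ => s) = 0)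
    (h₄ : ∀ s : ℝ, (s = 1 ∨ s = -1) → stdVal G (Finset.univ.erase none) (fun _ => s) = 0)
    (K : ConvexBody (Eucl n)) (u : Eucl n) : G K u = 0 := by
  have hlow : ∀ (J' : Finset (Option (Fin n))) (k : Fin n) (a : Fin n → ℝ), some k ∉ J' →
      stdVal G J' a = 0 := fun J' k a hk =>
    stdVal_eq_zero_of_lower (by omega) hp hG h₁ h₂ J' hk a
  refine eq_zero_of_vanishesOn hG (fun J v hv => ?_) K
  rw [inter_univ]
  change simplexVal G J v u = 0
  by_cases hJ : ∀ i, some i ∈ J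
  · refine simplexVal_eq_zero_of_top hn hp hG hJ hlow ?_ hv u
    by_cases h0 : none ∈ J
    · rwa [show J = Finset.univ from Finset.eq_univ_iff_forall.2 fun k => by
        rcases k with _ | k
        exacts [h0, hJ k]]
    · rwa [show J = Finset.univ.erase none from by
        ext (_ | k)
        · simpa using h0
        · simpa using hJ k]
  · push Not at hJ
    obtain ⟨k, hk⟩ := hJ
    rw [simplexVal_eq_stdVal (by omega) hG hk hv (a := fun j => inner ℝ (v j) u) fun _ _ => rfl]
    exact hlow J k _ hk

end density

/-! ### Support functions and moments of the test bodies. -/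

section testbodies
variable {n : ℕ} {p : ℝ}

/-- The convex hull of the points `P k`, `k ∈ J`, as a convex body. -/
def hullBody {ι : Type*} (P : ι → Eucl n) {J : Finset ι} (hJ : J.Nonempty) : ConvexBody (Eucl n) :=
  ⟨hullOn P J, convex_hullOn P J, isCompact_hullOn P J, hullOn_nonempty P hJ⟩

lemma simplexVal_eq (G : ConvexBody (Eucl n) → Eucl n → ℝ) {J : Finset (Option (Fin n))}
    (hJ : J.Nonempty) (v : Fin n → Eucl n) (u : Eucl n) :
    simplexVal G J v u = G (hullBody (withOrigin v) hJ) u :=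
  evalSet_mk _ _ _ u

lemma suppFun_hullBody_eq {ι : Type*} {P : ι → Eucl n} {J : Finset ι} (hJ : J.Nonempty)
    {u : Eucl n} {c : ℝ} (hle : ∀ k ∈ J, inner ℝ (P k) u ≤ c)
    (hex : ∃ k ∈ J, inner ℝ (P k) u = c) : suppFun (hullBody P hJ) u = c := by
  refine le_antisymm (suppFun_le fun x hx => hullOn_subset (convex_inner_le u c) hle hx) ?_
  obtain ⟨k, hk, rfl⟩ := hex
  exact inner_le_suppFun (mem_hullOn_of_mem hk) u

lemma hullO_hullBody (v : Fin n → Eucl n) {J : Finset (Option (Fin n))} (hJ : J.Nonempty) :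
    (hullO (hullBody (withOrigin v) hJ)).1 =
      hullBody (withOrigin v) (Finset.insert_nonempty none J) := by
  refine suppFun_ext fun u => ?_
  rw [suppFun_hullO, hullBody, hullBody, suppFun_hullOn _ hJ, suppFun_hullOn _
    (Finset.insert_nonempty none J), Finset.sup'_insert hJ, withOrigin_none, inner_zero_left]

lemma volume_hyperplane {w : Eucl n} (hw : w ≠ 0) (c : ℝ) :
    volume {x : Eucl n | inner ℝ x w = c} = 0 := by
  let A : AffineSubspace ℝ (Eucl n) := (AffineSubspace.mk' c ⊥).comap (innerₗ (Eucl n) w).toAffineMap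
  have hA : (A : Set (Eucl n)) = {x : Eucl n | inner ℝ x w = c} := by
    ext x
    simp only [A, AffineSubspace.coe_comap, mem_preimage, SetLike.mem_coe, AffineSubspace.mem_mk',
      LinearMap.coe_toAffineMap, innerₗ_apply_apply, vsub_eq_sub, Submodule.mem_bot, sub_eq_zero,
      mem_ofPred_eq, real_inner_comm]
  rw [← hA]
  refine Measure.addHaar_affineSubspace volume A fun h => ?_
  have hall : ∀ x : Eucl n, inner ℝ x w = c := fun x => by
    have : x ∈ (A : Set (Eucl n)) := by rw [h]; trivial
    rwa [hA] at this
  have h0 := hall 0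
  rw [inner_zero_left] at h0
  have h1 := hall w
  rw [← h0] at h1
  exact hw (inner_self_eq_zero.1 h1)

lemma momFun_eq_zero_of_subset {K : ConvexBody (Eucl n)} {w : Eucl n} (hw : w ≠ 0) {c : ℝ}
    (h : ∀ x ∈ K, inner ℝ x w = c) (u : Eucl n) : momFun p K u = 0 :=
  setIntegral_measure_zero _ (measure_mono_null (fun x hx => h x hx) (volume_hyperplane hw c))

lemma momFun_eq_zero_of_suppFun {K : ConvexBody (Eucl n)} {u : Eucl n} (hp : p ≠ 0)
    (h : suppFun K u ≤ 0) : momFun p K u = 0 := by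
  rw [momFun, setIntegral_congr_fun (g := fun _ => (0 : ℝ)) K.isClosed.measurableSet fun x hx => ?_]
  · simp
  · change max 0 (inner ℝ x u : ℝ) ^ p = 0
    rw [max_eq_left ((inner_le_suppFun hx u).trans h), Real.zero_rpow hp]

lemma momFun_nonneg (K : ConvexBody (Eucl n)) (u : Eucl n) : 0 ≤ momFun p K u :=
  integral_nonneg fun _ => Real.rpow_nonneg (le_max_left _ _) _

lemma exists_momFun_pos (hn : 1 ≤ n) (hp : 0 ≤ p) :
    ∃ (K : ConvexBody (Eucl n)) (u : Eucl n), 0 < momFun p K u := by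
  set u : Eucl n := stdv ⟨0, by omega⟩ with hu
  refine ⟨⟨Metric.closedBall 0 1, convex_closedBall _ _, isCompact_closedBall _ _,
    ⟨0, by simp⟩⟩, u, ?_⟩
  rw [momFun, setIntegral_pos_iff_support_of_nonneg_ae
    (Eventually.of_forall fun _ => Real.rpow_nonneg (le_max_left _ _) _)
    (integrableOn_max_inner_rpow hp _ u)]
  have hopen : IsOpen (Metric.ball (0 : Eucl n) 1 ∩ {x | 0 < inner ℝ x u}) :=
    Metric.isOpen_ball.inter (isOpen_lt continuous_const (by fun_prop))
  have hun : (inner ℝ u u : ℝ) = 1 := by rw [hu, inner_stdv]; simp [stdv]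
  refine (hopen.measure_pos volume ⟨(1 / 2 : ℝ) • u, ?_, ?_⟩).trans_le (measure_mono ?_)
  · have : ‖u‖ = 1 := by rw [hu]; simp [stdv]
    rw [mem_ball_zero_iff, norm_smul, this]
    norm_num
  · rw [mem_ofPred_eq, real_inner_smul_left, hun]; norm_num
  · rintro x ⟨hx1, hx2⟩
    refine ⟨?_, Metric.ball_subset_closedBall hx1⟩
    rw [Function.mem_support, max_eq_right (le_of_lt hx2)]
    exact (Real.rpow_pos_of_pos hx2 p).ne'

/-- The direction all of whose coordinates are `s`. -/
noncomputable def diagDir (n : ℕ) (s : ℝ) : Eucl n := WithLp.toLp 2 fun _ => s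

lemma neg_diagDir (s : ℝ) : -diagDir n s = diagDir n (-s) := rfl

lemma stdVal_const (G : ConvexBody (Eucl n) → Eucl n → ℝ) {J : Finset (Option (Fin n))}
    (hJ : J.Nonempty) (s : ℝ) :
    stdVal G J (fun _ => s) = G (hullBody (withOrigin stdv) hJ) (diagDir n s) :=
  simplexVal_eq _ _ _ _

lemma suppFun_of_inner_eq_one {J : Finset (Option (Fin n))} {v : Fin n → Eucl n} {u : Eucl n}
    (h : ∀ i, inner ℝ (v i) u = (1 : ℝ)) {i : Fin n} (hi : some i ∈ J) (hJ : J.Nonempty) :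
    suppFun (hullBody (withOrigin v) hJ) u = 1 := by
  refine suppFun_hullBody_eq hJ ?_ ⟨some i, hi, h i⟩
  rintro (_ | k) _
  · simp
  · exact (h k).le

lemma suppFun_neg_of_inner_eq_one {J : Finset (Option (Fin n))} {v : Fin n → Eucl n} {u : Eucl n}
    (h : ∀ i, inner ℝ (v i) u = (1 : ℝ)) (hJ : J.Nonempty) :
    suppFun (hullBody (withOrigin v) hJ) (-u) = if none ∈ J then 0 else -1 := by
  split_ifs with h0
  · refine suppFun_hullBody_eq hJ ?_ ⟨none, h0, by simp⟩
    rintro (_ | k) _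
    · simp
    · rw [withOrigin_some, inner_neg_right, h]; norm_num
  · have key : ∀ k ∈ J, inner ℝ (withOrigin v k) (-u) = (-1 : ℝ) := by
      rintro (_ | k) hk
      · exact absurd hk h0
      · rw [withOrigin_some, inner_neg_right, h]
    obtain ⟨k, hk⟩ := hJ
    exact suppFun_hullBody_eq _ (fun k hk => (key k hk).le) ⟨k, hk, key k hk⟩

lemma inner_stdv_diagDir (i : Fin n) (s : ℝ) : inner ℝ (stdv i) (diagDir n s) = s :=
  inner_stdv i _

lemma inner_eq_zero_of_mem_hullO {K : ConvexBody (Eucl n)} {w : Eucl n}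
    (h : ∀ x ∈ K, inner ℝ x w = (0 : ℝ)) : ∀ x ∈ (hullO K).1, inner ℝ x w = (0 : ℝ) := by
  intro x hx
  obtain ⟨t, _, y, hy, rfl⟩ := mem_hullO.1 hx
  rw [real_inner_smul_left, h y hy, mul_zero]

lemma inner_eq_of_mem_hullBody {ι : Type*} {P : ι → Eucl n} {J : Finset ι} (hJ : J.Nonempty)
    {w : Eucl n} {c : ℝ} (h : ∀ k ∈ J, inner ℝ (P k) w = c) :
    ∀ x ∈ hullBody P hJ, inner ℝ x w = c := fun _ hx =>
  le_antisymm (hullOn_subset (convex_inner_le w c) (fun k hk => (h k hk).le) hx)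
    (hullOn_subset (convex_le_inner w c) (fun k hk => (h k hk).ge) hx)

lemma stdv_ne_zero (i : Fin n) : stdv i ≠ (0 : Eucl n) := by
  intro h
  have := inner_stdv_diagDir i 1
  rw [h, inner_zero_left] at this
  exact zero_ne_one this

/-- The body has at most one vertex besides the origin, so both it and its hull with the origin lie
in a coordinate hyperplane. -/
lemma momFun_small (hn : 2 ≤ n) {i₀ : Fin n} {J : Finset (Option (Fin n))} (hJ : J.Nonempty)
    (h : ∀ i, some i ∈ J → i = i₀) (u : Eucl n) :
    momFun p (hullBody (withOrigin stdv) hJ) u = 0 ∧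
      momFun p (hullO (hullBody (withOrigin stdv) hJ)).1 u = 0 := by
  have : Nontrivial (Fin n) := Fin.nontrivial_iff_two_le.2 hn
  obtain ⟨k, hk⟩ := exists_ne i₀
  have key := inner_eq_of_mem_hullBody (P := withOrigin (stdv (n := n))) hJ (w := stdv k) (c := 0)
    (by
      rintro (_ | i) hi
      · simp
      · have : i ≠ k := by rw [h i hi]; exact hk.symm
        rw [withOrigin_some, inner_stdv]
        simp [stdv, this])
  exact ⟨momFun_eq_zero_of_subset (stdv_ne_zero k) key u,
    momFun_eq_zero_of_subset (stdv_ne_zero k) (inner_eq_zero_of_mem_hullO key) u⟩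

lemma momFun_face (hn : 1 ≤ n) {v : Fin n → Eucl n} {w : Eucl n}
    (h : ∀ i, inner ℝ (v i) w = (1 : ℝ)) {J : Finset (Option (Fin n))} (hJ : J.Nonempty)
    (h0 : none ∉ J) (u : Eucl n) : momFun p (hullBody (withOrigin v) hJ) u = 0 := by
  refine momFun_eq_zero_of_subset (w := w) (c := 1) ?_ (inner_eq_of_mem_hullBody hJ ?_) u
  · rintro rfl
    have := h ⟨0, by omega⟩
    rw [inner_zero_right] at this
    exact zero_ne_one this
  · rintro (_ | i) hi
    · exact absurd hi h0
    · exact h i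

lemma univ_erase_none_nonempty (hn : 1 ≤ n) :
    ((Finset.univ : Finset (Option (Fin n))).erase none).Nonempty :=
  ⟨some ⟨0, by omega⟩, by simp⟩

lemma momFun_lower (hn : 2 ≤ n) (hp : 0 < p) (J : Finset (Option (Fin n))) (k : Fin n)
    (a : Fin n → ℝ) (hk : some k ∉ J) : stdVal (momFun p) J a = 0 := by
  refine stdVal_eq_zero_of_lower hn hp (isLpVal_momFun hp.le) (i₀ := k) (fun s _ => ?_)
    (fun s _ => ?_) J hk a
  · rw [stdVal_const _ (Finset.singleton_nonempty _)]
    exact (momFun_small hn _ (i₀ := k) (by simp) _).1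
  · rw [stdVal_const _ (Finset.insert_nonempty _ _)]
    exact (momFun_small hn _ (i₀ := k) (by simp) _).1

lemma momFun_std_neg (hp : 0 < p) {v : Fin n → Eucl n} {u : Eucl n}
    (h : ∀ i, inner ℝ (v i) u = (1 : ℝ)) {J : Finset (Option (Fin n))} (hJ : J.Nonempty) :
    momFun p (hullBody (withOrigin v) hJ) (-u) = 0 := by
  refine momFun_eq_zero_of_suppFun hp.ne' ?_
  rw [suppFun_neg_of_inner_eq_one h]
  split_ifs <;> norm_num

/-- The moment of the standard simplex in the direction `(1, …, 1)`. -/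
noncomputable def stdMoment (n : ℕ) (p : ℝ) : ℝ :=
  momFun p (hullBody (withOrigin (stdv (n := n))) Finset.univ_nonempty) (diagDir n 1)

/-- No integral is computed: the moment is zero at the other test values, so if it were zero here
too it would vanish identically by `IsLpVal.eq_zero`, which is false for a ball. -/
lemma stdMoment_pos (hn : 3 ≤ n) (hp : 0 < p) : 0 < stdMoment n p := by
  refine lt_of_le_of_ne (momFun_nonneg _ _) fun h0 => ?_
  have i₀ : Fin n := ⟨0, by omega⟩
  obtain ⟨K, u, hK⟩ := exists_momFun_pos (n := n) (by omega) hp.le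
  refine hK.ne' ((isLpVal_momFun hp.le).eq_zero hn hp i₀ (fun s _ => ?_) (fun s _ => ?_)
    (fun s hs => ?_) (fun s _ => ?_) K u)
  · rw [stdVal_const _ (Finset.singleton_nonempty _)]
    exact (momFun_small (by omega) _ (i₀ := i₀) (by simp) _).1
  · rw [stdVal_const _ (Finset.insert_nonempty _ _)]
    exact (momFun_small (by omega) _ (i₀ := i₀) (by simp) _).1
  · rw [stdVal_const _ Finset.univ_nonempty]
    rcases hs with rfl | rfl
    · exact h0.symm
    · rw [← neg_diagDir]
      exact momFun_std_neg hp (fun i => inner_stdv_diagDir i 1) _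
  · rw [stdVal_const _ (univ_erase_none_nonempty (by omega))]
    exact momFun_face (by omega) (fun i => inner_stdv_diagDir i 1) _ (by simp) _

/-- The moment of a full-dimensional simplex with one vertex at the origin. -/
lemma momFun_simplex (hn : 3 ≤ n) (hp : 0 < p) {v : Fin n → Eucl n} (hv : vdet v ≠ 0) {u : Eucl n}
    (h : ∀ i, inner ℝ (v i) u = (1 : ℝ)) :
    momFun p (hullBody (withOrigin v) Finset.univ_nonempty) u = |vdet v| * stdMoment n p := by
  have i₀ : Fin n := ⟨0, by omega⟩
  have hG := isLpVal_momFun (n := n) hp.le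
  rw [← simplexVal_eq (momFun p), simplexVal_eq_topVal hG _ i₀ hv rfl h, topVal_eq hn hG (by simp)
    (fun J' k a hk => momFun_lower (by omega) hp J' k a hk) i₀ hv, stdMoment, ← simplexVal_eq (momFun p),
    simplexVal_eq_topVal hG _ i₀ one_ne_zero vdet_stdv fun i => inner_stdv_diagDir i 1]

end testbodies

/-! ### The span of the eight basic valuations. -/

section classification
variable {n : ℕ} {p : ℝ}

/-- The general linear combination of the eight basic valuations. -/
noncomputable def basicComb (p a a' b b' c₁ c₂ c₃ c₄ : ℝ) (K : ConvexBody (Eucl n)) (u : Eucl n) :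
    ℝ :=
  a * suppPos p K u + a' * suppPos p K (-u) + b * minPos p K u + b' * minPos p K (-u) +
    c₁ * momFun p K u + c₂ * momFun p K (-u) +
    c₃ * (momFun p (hullO K).1 u - momFun p K u) +
    c₄ * (momFun p (hullO K).1 (-u) - momFun p K (-u))

lemma isLpVal_basicComb (hp : 0 ≤ p) (a a' b b' c₁ c₂ c₃ c₄ : ℝ) :
    IsLpVal (n := n) p (basicComb p a a' b b' c₁ c₂ c₃ c₄) := by
  have h1 := isLpVal_momFun (n := n) hp
  have h2 := isLpVal_comp_hullO h1
  have h3 := isLpVal_suppPos (n := n) hp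
  have h4 := isLpVal_minPos (n := n) hp
  exact (((((((h3.const_mul a).add (h3.refl.const_mul a')).add (h4.const_mul b)).add
    (h4.refl.const_mul b')).add (h1.const_mul c₁)).add (h1.refl.const_mul c₂)).add
    ((h2.sub h1).const_mul c₃)).add ((h2.refl.sub h1.refl).const_mul c₄)

lemma basicComb_neg (a a' b b' c₁ c₂ c₃ c₄ : ℝ) (K : ConvexBody (Eucl n)) (u : Eucl n) :
    basicComb p a a' b b' c₁ c₂ c₃ c₄ K (-u) = basicComb p a' a b' b c₂ c₁ c₄ c₃ K u := by
  simp only [basicComb, neg_neg]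
  ring

/-- All nonzero vertices have height 1 above u, so the terms in the direction -u vanish, and the
minimum over the body is 0 or 1 according to whether the origin is a vertex. -/
lemma basicComb_eval (hp : 0 < p) (a a' b b' c₁ c₂ c₃ c₄ : ℝ) {v : Fin n → Eucl n}
    {u : Eucl n} (h : ∀ i, inner ℝ (v i) u = (1 : ℝ)) {i : Fin n} {J : Finset (Option (Fin n))}
    (hi : some i ∈ J) (hJ : J.Nonempty) :
    basicComb p a a' b b' c₁ c₂ c₃ c₄ (hullBody (withOrigin v) hJ) u =
      a + (if none ∈ J then 0 else b) + c₁ * momFun p (hullBody (withOrigin v) hJ) u +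
        c₃ * (momFun p (hullBody (withOrigin v) (Finset.insert_nonempty none J)) u -
          momFun p (hullBody (withOrigin v) hJ) u) := by
  rw [basicComb, hullO_hullBody, momFun_std_neg hp h, momFun_std_neg hp h]
  simp only [suppPos, minPos, neg_neg]
  rw [suppFun_of_inner_eq_one h hi, suppFun_neg_of_inner_eq_one h]
  split_ifs <;> simp [hp.ne']

/-- Every `L_p`-valuation is a linear combination of the eight basic ones. -/
lemma IsLpVal.eq_basicComb (hn : 3 ≤ n) (hp : 0 < p) {F : ConvexBody (Eucl n) → Eucl n → ℝ}
    (hF : IsLpVal p F) : ∃ a a' b b' c₁ c₂ c₃ c₄ : ℝ, ∀ K u,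
      F K u = basicComb p a a' b b' c₁ c₂ c₃ c₄ K u := by
  have hn1 : 1 ≤ n := by omega
  have hn2 : 2 ≤ n := by omega
  have i₀ : Fin n := ⟨0, by omega⟩
  have hμ := (stdMoment_pos hn hp).ne'
  have h1 : ∀ i, inner ℝ (stdv i) (diagDir n 1) = (1 : ℝ) := fun i => inner_stdv_diagDir i 1
  set x : ℝ → ℝ := fun s => stdVal F {some i₀} (fun _ => s) with hx
  set y : ℝ → ℝ := fun s => stdVal F {none, some i₀} (fun _ => s) with hy
  set z : ℝ → ℝ := fun s => stdVal F Finset.univ (fun _ => s) with hz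
  set w : ℝ → ℝ := fun s => stdVal F (Finset.univ.erase none) (fun _ => s) with hw
  -- With μ the standard moment, the combination takes the values a + b on the point, a on the
  -- segment, a + c₁ μ on the simplex and a + b + c₃ μ on its facet. Solving this triangular system
  -- in each of the two directions gives the coefficients.
  refine ⟨y 1, y (-1), x 1 - y 1, x (-1) - y (-1), (z 1 - y 1) / stdMoment n p,
    (z (-1) - y (-1)) / stdMoment n p, (w 1 - x 1) / stdMoment n p,
    (w (-1) - x (-1)) / stdMoment n p, fun K u => ?_⟩
  have hG := hF.sub (isLpVal_basicComb (n := n) hp.le (y 1) (y (-1)) (x 1 - y 1) (x (-1) - y (-1))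
    ((z 1 - y 1) / stdMoment n p) ((z (-1) - y (-1)) / stdMoment n p)
    ((w 1 - x 1) / stdMoment n p) ((w (-1) - x (-1)) / stdMoment n p))
  have he : (Finset.univ.erase none : Finset (Option (Fin n))).Nonempty :=
    univ_erase_none_nonempty hn1
  have e0 : ∀ h : (insert none (Finset.univ.erase none) : Finset (Option (Fin n))).Nonempty,
      momFun p (hullBody (withOrigin (stdv (n := n))) h) (diagDir n 1) = stdMoment n p := by
    rw [Finset.insert_erase (Finset.mem_univ _)]
    exact fun _ => rfl
  have e1 : ∀ h : (insert none Finset.univ : Finset (Option (Fin n))).Nonempty,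
      momFun p (hullBody (withOrigin (stdv (n := n))) h) (diagDir n 1) = stdMoment n p := by
    rw [Finset.insert_eq_of_mem (Finset.mem_univ _)]
    exact fun _ => rfl
  have e2 : momFun p (hullBody (withOrigin (stdv (n := n))) Finset.univ_nonempty) (diagDir n 1) =
    stdMoment n p := rfl
  refine sub_eq_zero.1 (hG.eq_zero hn hp i₀ (fun s hs => ?_) (fun s hs => ?_) (fun s hs => ?_)
    (fun s hs => ?_) K u)
  · rw [stdVal_const _ (Finset.singleton_nonempty _)]
    rcases hs with rfl | rfl
    · rw [basicComb_eval hp _ _ _ _ _ _ _ _ h1 (i := i₀) (by simp),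
        (momFun_small hn2 _ (i₀ := i₀) (by simp) _).1, (momFun_small hn2 _ (i₀ := i₀) (by simp) _).1]
      simp [hx, stdVal_const _ (Finset.singleton_nonempty _)]
    · rw [← neg_diagDir, basicComb_neg, basicComb_eval hp _ _ _ _ _ _ _ _ h1 (i := i₀) (by simp),
        (momFun_small hn2 _ (i₀ := i₀) (by simp) _).1, (momFun_small hn2 _ (i₀ := i₀) (by simp) _).1]
      simp [hx, stdVal_const _ (Finset.singleton_nonempty _), neg_diagDir]
  · rw [stdVal_const _ (Finset.insert_nonempty _ _)]
    rcases hs with rfl | rfl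
    · rw [basicComb_eval hp _ _ _ _ _ _ _ _ h1 (i := i₀) (by simp),
        (momFun_small hn2 _ (i₀ := i₀) (by simp) _).1, (momFun_small hn2 _ (i₀ := i₀) (by simp) _).1]
      simp [hy, stdVal_const _ (Finset.insert_nonempty _ _)]
    · rw [← neg_diagDir, basicComb_neg, basicComb_eval hp _ _ _ _ _ _ _ _ h1 (i := i₀) (by simp),
        (momFun_small hn2 _ (i₀ := i₀) (by simp) _).1, (momFun_small hn2 _ (i₀ := i₀) (by simp) _).1]
      simp [hy, stdVal_const _ (Finset.insert_nonempty _ _), neg_diagDir]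
  · rw [stdVal_const _ Finset.univ_nonempty]
    rcases hs with rfl | rfl
    · rw [basicComb_eval hp _ _ _ _ _ _ _ _ h1 (i := i₀) (by simp), e1, e2]
      simp [hz, stdVal_const _ Finset.univ_nonempty, hμ]
    · rw [← neg_diagDir, basicComb_neg, basicComb_eval hp _ _ _ _ _ _ _ _ h1 (i := i₀) (by simp),
        e1, e2]
      simp [hz, stdVal_const _ Finset.univ_nonempty, hμ, neg_diagDir]
  · rw [stdVal_const _ he]
    rcases hs with rfl | rfl
    · rw [basicComb_eval hp _ _ _ _ _ _ _ _ h1 (i := i₀) (by simp), e0,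
        momFun_face hn1 h1 _ (by simp)]
      simp [hw, stdVal_const _ he, hμ]
    · rw [← neg_diagDir, basicComb_neg, basicComb_eval hp _ _ _ _ _ _ _ _ h1 (i := i₀) (by simp),
        e0, momFun_face hn1 h1 _ (by simp)]
      simp [hw, stdVal_const _ he, hμ, neg_diagDir]

end classification

/-! ### Consequences of convexity and nonnegativity. -/

section classification
variable {n : ℕ} {p : ℝ}

/-- A body in a hyperplane through the origin has K_o in that hyperplane as well, so all moments
vanish and only the maximum and minimum of ⟨x, u⟩ remain. -/
lemma basicComb_eval_flat (hp : 0 < p) (a a' b b' c₁ c₂ c₃ c₄ : ℝ) {K : ConvexBody (Eucl n)}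
    {u w : Eucl n} {c d : ℝ} (hc : 0 ≤ c) (hd : 0 ≤ d) (h1 : suppFun K u = c)
    (h2 : suppFun K (-u) = -d) (hw : w ≠ 0) (hK : ∀ x ∈ K, inner ℝ x w = (0 : ℝ)) :
    basicComb p a a' b b' c₁ c₂ c₃ c₄ K u = a * c ^ p + b * d ^ p := by
  have hK' := inner_eq_zero_of_mem_hullO hK
  simp only [basicComb, suppPos, minPos, neg_neg, h1, h2, momFun_eq_zero_of_subset hw hK,
    momFun_eq_zero_of_subset hw hK']
  rw [max_eq_right hc, max_eq_right hd, max_eq_left (neg_nonpos.2 hc),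
    max_eq_left (neg_nonpos.2 hd), Real.zero_rpow hp.ne']
  ring

/-- The vertices of a triangle in a coordinate plane. -/
noncomputable def triVertices (i j : Fin n) : Fin 3 → Eucl n :=
  ![(2 : ℝ) • stdv i, stdv i, stdv j]

/-- A direction with coordinates `1` and `1 + t` in a coordinate plane. -/
noncomputable def planeDir (i : Fin n) (t : ℝ) : Eucl n :=
  WithLp.toLp 2 fun k => if k = i then 1 else 1 + t

lemma planeDir_mid (i : Fin n) (t : ℝ) :
    (1 / 2 : ℝ) • (planeDir i t + planeDir i (-t)) = planeDir i 0 := by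
  ext k
  simp only [planeDir, PiLp.smul_apply, PiLp.add_apply, smul_eq_mul]
  split_ifs <;> ring

lemma inner_triVertices {i j : Fin n} (hij : j ≠ i) (t : ℝ) (k : Fin 3) :
    inner ℝ (triVertices i j k) (planeDir i t) = (![2, 1, 1 + t] : Fin 3 → ℝ) k := by
  fin_cases k <;> simp [triVertices, real_inner_smul_left, inner_stdv, planeDir, hij]

lemma inner_triVertices_eq_zero {i j l : Fin n} (hil : l ≠ i) (hjl : l ≠ j) (k : Fin 3) :
    inner ℝ (triVertices i j k) (stdv l) = (0 : ℝ) := by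
  have h : ∀ m, l ≠ m → inner ℝ (stdv m) (stdv l) = (0 : ℝ) := fun m hm => by
    rw [inner_stdv]
    simp [stdv, hm.symm]
  fin_cases k <;> simp [triVertices, real_inner_smul_left, h i hil, h j hjl]

/-- The endpoints have heights 2 and 1 + t. The maximum stays constant as t varies, which isolates
the term with coefficient b. -/
lemma basicComb_segment (hp : 0 < p) (a a' b b' c₁ c₂ c₃ c₄ : ℝ) {i j l : Fin n} (hij : j ≠ i)
    (hil : l ≠ i) (hjl : l ≠ j) {t : ℝ} (ht : -1 ≤ t) (ht' : t ≤ 1) :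
    basicComb p a a' b b' c₁ c₂ c₃ c₄
      (hullBody (triVertices i j) (J := {0, 2}) (Finset.insert_nonempty _ _)) (planeDir i t) =
      a * 2 ^ p + b * (1 + t) ^ p := by
  refine basicComb_eval_flat hp _ _ _ _ _ _ _ _ two_pos.le (by linarith) ?_ ?_ (stdv_ne_zero l)
    (inner_eq_of_mem_hullBody _ fun k _ => inner_triVertices_eq_zero hil hjl k)
  · refine suppFun_hullBody_eq _ (fun k hk => ?_) ⟨0, by simp, by simp [inner_triVertices hij]⟩
    rw [inner_triVertices hij]
    have : k = 0 ∨ k = 2 := by simpa using hk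
    rcases this with rfl | rfl <;> simp
    linarith
  · refine suppFun_hullBody_eq _ (fun k hk => ?_)
      ⟨2, by simp, by rw [inner_neg_right, inner_triVertices hij]; simp⟩
    rw [inner_neg_right, inner_triVertices hij]
    have : k = 0 ∨ k = 2 := by simpa using hk
    rcases this with rfl | rfl <;> simp
    linarith

/-- The extra vertex at height 1 changes the minimum from 1 + t to min 1 (1 + t), which is concave
in t. -/
lemma basicComb_triangle (hp : 0 < p) (a a' b b' c₁ c₂ c₃ c₄ : ℝ) {i j l : Fin n} (hij : j ≠ i)
    (hil : l ≠ i) (hjl : l ≠ j) {t : ℝ} (ht : -1 ≤ t) (ht' : t ≤ 1) :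
    basicComb p a a' b b' c₁ c₂ c₃ c₄
      (hullBody (triVertices i j) (J := Finset.univ) Finset.univ_nonempty) (planeDir i t) =
      a * 2 ^ p + b * (min 1 (1 + t)) ^ p := by
  refine basicComb_eval_flat hp _ _ _ _ _ _ _ _ two_pos.le
    (le_min zero_le_one (by linarith)) ?_ ?_ (stdv_ne_zero l)
    (inner_eq_of_mem_hullBody _ fun k _ => inner_triVertices_eq_zero hil hjl k)
  · refine suppFun_hullBody_eq _ (fun k hk => ?_) ⟨0, by simp, by simp [inner_triVertices hij]⟩
    rw [inner_triVertices hij]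
    fin_cases k <;> simp
    linarith
  · refine suppFun_hullBody_eq _ (fun k hk => ?_) ?_
    · rw [inner_neg_right, inner_triVertices hij, neg_le_neg_iff]
      fin_cases k <;> simp
    · rcases le_total t 0 with h | h
      · refine ⟨2, by simp, ?_⟩
        rw [inner_neg_right, inner_triVertices hij, min_eq_right (by linarith)]
        simp
      · refine ⟨1, by simp, ?_⟩
        rw [inner_neg_right, inner_triVertices hij, min_eq_left (by linarith)]
        simp

lemma nonneg_of_forall_pos {a c μ : ℝ} (hμ : 0 < μ) (h : ∀ s : ℝ, 0 < s → 0 ≤ a + c * (s * μ)) :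
    0 ≤ c := by
  by_contra hc
  have hc : c < 0 := not_le.1 hc
  have h1 := h ((|a| + 1) / (-c * μ)) (div_pos (by positivity) (mul_pos (neg_pos.2 hc) hμ))
  have h2 : c * ((|a| + 1) / (-c * μ) * μ) = -(|a| + 1) := by
    have := hc.ne
    field_simp
  rw [h2] at h1
  linarith [le_abs_self a]

/-- Sign conditions on the coefficients of a nonnegative and convex linear combination. -/
lemma basicComb_coeff (hn : 3 ≤ n) (hp : 1 < p) {a a' b b' c₁ c₂ c₃ c₄ : ℝ}
    (hnn : ∀ (K : ConvexBody (Eucl n)) u, 0 ≤ basicComb p a a' b b' c₁ c₂ c₃ c₄ K u)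
    (hcvx : ∀ (K : ConvexBody (Eucl n)) u v,
      2 * basicComb p a a' b b' c₁ c₂ c₃ c₄ K ((1 / 2 : ℝ) • (u + v)) ≤
      basicComb p a a' b b' c₁ c₂ c₃ c₄ K u + basicComb p a a' b b' c₁ c₂ c₃ c₄ K v) :
    b = 0 ∧ 0 ≤ a ∧ 0 ≤ c₁ ∧ 0 ≤ c₃ := by
  have hp0 : 0 < p := by linarith
  have hn1 : 1 ≤ n := by omega
  obtain ⟨i, j, l, hij, hil, hjl⟩ : ∃ i j l : Fin n, j ≠ i ∧ l ≠ i ∧ l ≠ j :=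
    ⟨⟨0, by omega⟩, ⟨1, by omega⟩, ⟨2, by omega⟩, by simp, by simp, by simp⟩
  have hb : b = 0 := by
    refine le_antisymm ?_ ?_
    -- On the triangle, midpoint convexity between t = 1/2 and t = -1/2 reads b ≤ b (1/2)^p, so b ≤
    -- 0.
    · have h := hcvx (hullBody (triVertices i j) (J := Finset.univ) Finset.univ_nonempty)
        (planeDir i (1 / 2)) (planeDir i (-(1 / 2)))
      rw [planeDir_mid, basicComb_triangle hp0 _ _ _ _ _ _ _ _ hij hil hjl (by norm_num)
        (by norm_num), basicComb_triangle hp0 _ _ _ _ _ _ _ _ hij hil hjl (by norm_num)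
        (by norm_num), basicComb_triangle hp0 _ _ _ _ _ _ _ _ hij hil hjl (by norm_num)
        (by norm_num), min_eq_left (by norm_num), min_eq_left (by norm_num),
        min_eq_right (by norm_num), Real.one_rpow] at h
      have h2 : (1 + -(1 / 2) : ℝ) ^ p < 1 := Real.rpow_lt_one (by norm_num) (by norm_num) hp0
      nlinarith
    -- On the segment it reads 2 b ≤ b ((3/2)^p + (1/2)^p). By the strict Bernoulli inequality for p
    -- > 1 the bracket exceeds 2, so b ≥ 0.
    · have h := hcvx (hullBody (triVertices i j) (J := {0, 2}) (Finset.insert_nonempty _ _))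
        (planeDir i (1 / 2)) (planeDir i (-(1 / 2)))
      rw [planeDir_mid, basicComb_segment hp0 _ _ _ _ _ _ _ _ hij hil hjl (by norm_num)
        (by norm_num), basicComb_segment hp0 _ _ _ _ _ _ _ _ hij hil hjl (by norm_num)
        (by norm_num), basicComb_segment hp0 _ _ _ _ _ _ _ _ hij hil hjl (by norm_num)
        (by norm_num), add_zero, Real.one_rpow] at h
      have h1 := one_add_mul_self_lt_rpow_one_add (s := 1 / 2) (by norm_num) (by norm_num) hp
      have h2 := one_add_mul_self_lt_rpow_one_add (s := -(1 / 2)) (by norm_num) (by norm_num) hp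
      nlinarith
  have h1 : ∀ i, inner ℝ (stdv i) (diagDir n 1) = (1 : ℝ) := fun i => inner_stdv_diagDir i 1
  have hμ := stdMoment_pos hn hp0
  -- Simplices of any determinant s with all inner products equal to 1 have moment s times the
  -- standard one. As s → ∞ the moment term dominates, which gives the sign of its coefficient.
  have hframe : ∀ s : ℝ, 0 < s → ∃ (v : Fin n → Eucl n) (u : Eucl n), vdet v = s ∧
      ∀ k, inner ℝ (v k) u = (1 : ℝ) := fun s hs => by
    obtain ⟨u, hu⟩ := exists_inner_eq (v := Function.update (stdv (n := n)) i (s • stdv i))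
      (by rw [vdet_topFrame]; exact hs.ne') fun _ => 1
    exact ⟨_, u, vdet_topFrame i s, hu⟩
  refine ⟨hb, ?_, nonneg_of_forall_pos (a := a) hμ fun s hs => ?_,
    nonneg_of_forall_pos (a := a) hμ fun s hs => ?_⟩
  · have h := hnn (hullBody (withOrigin stdv) (J := {none, some i}) (Finset.insert_nonempty _ _))
      (diagDir n 1)
    rw [basicComb_eval hp0 _ _ _ _ _ _ _ _ h1 (i := i) (by simp),
      (momFun_small (by omega) _ (i₀ := i) (by simp) _).1,
      (momFun_small (by omega) _ (i₀ := i) (by simp) _).1] at h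
    simpa using h
  · obtain ⟨v, u, hv, hu⟩ := hframe s hs
    have h := hnn (hullBody (withOrigin v) (J := Finset.univ) Finset.univ_nonempty) u
    have e1 : ∀ h : (insert none Finset.univ : Finset (Option (Fin n))).Nonempty,
        momFun p (hullBody (withOrigin v) h) u = s * stdMoment n p := by
      rw [Finset.insert_eq_of_mem (Finset.mem_univ _)]
      intro _
      rw [momFun_simplex hn hp0 (by rw [hv]; exact hs.ne') hu, hv, abs_of_pos hs]
    rw [basicComb_eval hp0 _ _ _ _ _ _ _ _ hu (i := i) (by simp), e1,
      momFun_simplex hn hp0 (by rw [hv]; exact hs.ne') hu, hv, abs_of_pos hs] at h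
    simpa using h
  · obtain ⟨v, u, hv, hu⟩ := hframe s hs
    have h := hnn (hullBody (withOrigin v) (univ_erase_none_nonempty hn1)) u
    have e1 : ∀ h : (insert none (Finset.univ.erase none) : Finset (Option (Fin n))).Nonempty,
        momFun p (hullBody (withOrigin v) h) u = s * stdMoment n p := by
      rw [Finset.insert_erase (Finset.mem_univ _)]
      intro _
      rw [momFun_simplex hn hp0 (by rw [hv]; exact hs.ne') hu, hv, abs_of_pos hs]
    rw [basicComb_eval hp0 _ _ _ _ _ _ _ _ hu (i := i) (by simp), e1,
      momFun_face hn1 hu _ (by simp), hb] at h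
    simpa using h

/-- Support functions are convex and t ↦ t^p is convex and increasing for t ≥ 0. -/
lemma two_mul_suppFun_rpow_le (hp : 1 ≤ p) (K : BodyO n) (u v : Eucl n) :
    2 * suppFun K.1 ((1 / 2 : ℝ) • (u + v)) ^ p ≤ suppFun K.1 u ^ p + suppFun K.1 v ^ p := by
  have h1 : suppFun K.1 ((1 / 2 : ℝ) • (u + v)) ≤
      (1 / 2 : ℝ) * suppFun K.1 u + (1 / 2 : ℝ) * suppFun K.1 v := by
    rw [suppFun_smul _ one_half_pos, ← mul_add]
    exact mul_le_mul_of_nonneg_left (suppFun_add_le _ _ _) one_half_pos.le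
  have h2 := Real.rpow_le_rpow (suppFun_nonneg K _) h1 (zero_le_one.trans hp)
  have h3 := (convexOn_rpow hp).2 (suppFun_nonneg K u) (suppFun_nonneg K v)
    one_half_pos.le one_half_pos.le (add_halves (1 : ℝ))
  simp only [smul_eq_mul] at h3
  linarith

end classification

/-! ### The classification. -/

theorem mainTheorem2 (n : ℕ) (hn : 3 ≤ n) (p : ℝ) (hp : 1 < p)
    (Φ : ConvexBody (Eucl n) → BodyO n) :
    (Continuous Φ ∧ IsSLCovariant Φ ∧ IsLpMinkowskiValuation p Φ) ↔
      ∃ c₁ c₂ c₃ c₄ c₅ c₆ : ℝ,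
        0 ≤ c₁ ∧ 0 ≤ c₂ ∧ 0 ≤ c₃ ∧ 0 ≤ c₄ ∧ 0 ≤ c₅ ∧ 0 ≤ c₆ ∧
        ∀ K : ConvexBody (Eucl n),
          Φ K = lpAdd p (lpAdd p (lpAdd p (lpAdd p (lpAdd p
            (c₁ • MPos p K) (c₂ • MNeg p K)) (c₃ • MPosStar p K)) (c₄ • MNegStar p K))
            (c₅ • hullO K)) (c₆ • (-hullO K)) := by
  have hp0 : 0 < p := by linarith
  rw [isLpVal_suppFun_iff hp.le]
  constructor
  · intro hF
    obtain ⟨a, a', b, b', c₁, c₂, c₃, c₄, h⟩ := hF.eq_basicComb hn hp0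
    obtain ⟨rfl, ha, h₁, h₃⟩ := basicComb_coeff hn hp (a := a) (a' := a') (b := b) (b' := b')
      (c₁ := c₁) (c₂ := c₂) (c₃ := c₃) (c₄ := c₄)
      (fun K u => by rw [← h]; exact Real.rpow_nonneg (suppFun_nonneg _ _) _)
      (fun K u v => by rw [← h, ← h, ← h]; exact two_mul_suppFun_rpow_le hp.le _ u v)
    -- Replacing u by -u exchanges the coefficients in pairs, so the same sign conditions apply to
    -- the second of each pair.
    obtain ⟨rfl, ha', h₂, h₄⟩ := basicComb_coeff hn hp (a := a') (a' := a) (b := b') (b' := 0)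
      (c₁ := c₂) (c₂ := c₁) (c₃ := c₄) (c₄ := c₃)
      (fun K u => by
        rw [← basicComb_neg, ← h]; exact Real.rpow_nonneg (suppFun_nonneg _ _) _)
      (fun K u v => by
        simp only [← basicComb_neg (p := p) a a' 0 b' c₁ c₂ c₃ c₄, ← h, ← smul_neg, neg_add]
        exact two_mul_suppFun_rpow_le hp.le _ _ _)
    -- Dilation of a body by c multiplies h^p by c^p, so the constants are the p-th roots of the
    -- coefficients.
    refine ⟨c₁ ^ (1 / p), c₂ ^ (1 / p), c₃ ^ (1 / p), c₄ ^ (1 / p), a ^ (1 / p), a' ^ (1 / p),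
      by positivity, by positivity, by positivity, by positivity, by positivity, by positivity,
      fun K => Subtype.ext (suppFun_ext fun u => ?_)⟩
    rw [← Real.rpow_left_inj (suppFun_nonneg _ _) (suppFun_nonneg _ _) hp0.ne',
      suppFun_classification hp.le (by positivity) (by positivity) (by positivity) (by positivity)
        (by positivity) (by positivity), h K u]
    have hroot : ∀ {x : ℝ}, 0 ≤ x → (x ^ (1 / p)) ^ p = x := fun hx => by
      rw [← Real.rpow_mul hx, one_div_mul_cancel hp0.ne', Real.rpow_one]
    rw [hroot h₁, hroot h₂, hroot h₃, hroot h₄, hroot ha, hroot ha', basicComb]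
    ring
  · rintro ⟨c₁, c₂, c₃, c₄, c₅, c₆, h₁, h₂, h₃, h₄, h₅, h₆, h⟩
    simp only [h, suppFun_classification hp.le h₁ h₂ h₃ h₄ h₅ h₆]
    exact isLpVal_classification hp0.le _ _ _ _ _ _
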